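/- **Setting.** For $f_{\max},L,\sigma\ge 0$ and $\rho>0$ consider twice differentiable $f:\mathbb R^d\to\mathbb R$ ($d\ge 1$) with $|f(x)-f(y)|\le f_{\max}$, $\|\nabla f(x)-\nabla f(y)\|\le L\|x-y\|$ and $\|\nabla^2 f(x)-\nabla^2 f(y)\|\le\rho\|x-y\|$ for all $x,y$, together with a stochastic gradient oracle $G(x,\theta)$, $\theta\sim\mathcal D$, such that $\mathbb E\,G(x,\theta)=\nabla f(x)$ and $\mathbb E\|G(x,\theta)-\nabla f(x)\|^2\le\sigma^2$ for all $x$. A point $x$ is an $\varepsilon$-SOSP if $\|\nabla f(x)\|\le\varepsilon$ and $\lambda_{\min}(\nabla^2 f(x))\ge-\sqrt{\rho\varepsilon}$. Compressed SGD with step size $\eta>0$, noise level $r>0$ and starting point $x_0$ sets $e_0=0$ and, for $t=0,\dots,T-1$, draws independently $\theta_t\sim\mathcal D$, $\xi_t\sim\mathcal N(0,\tfrac{r^2}{d}I)$ and a random set $S_t$ of coordinates, and puts $v_t=e_t+G(x_t,\theta_t)+\xi_t$, $g_t=v_t$ restricted to the coordinates in $S_t$ (zero elsewhere), $x_{t+1}=x_t-\eta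 g_t$, $e_{t+1}=v_t-g_t$. For RandomK, $S_t$ is uniform among the $k$-element subsets of the coordinates; uncompressed SGD has $S_t=\{1,\dots,d\}$. The total communication (per worker) is the number of coordinates sent, $\sum_{t<T}|S_t|$, i.e. $kT$ for RandomK and $dT$ for uncompressed SGD. For a fixed $\delta>0$, we say that the algorithm finds $\varepsilon$-SOSPs in $T$ iterations if, for all $f$ and oracles in the class and every $x_0$, at least half of the visited points $x_0,\dots,x_{T-1}$ are $\varepsilon$-SOSPs with probability at least $1-\delta$, and the expected number of $\varepsilon$-SOSPs among them is at least $T/2$. **Statement.** Let $\alpha=1$ if the class is restricted to oracles with $\|G(x,\theta)-G(y,\theta)\|\le\tilde\ell\|x-y\|$ for all $x,y,\theta$ (for a given $\tilde\ell\ge0$), and $\alpha=d$ if there is no such restriction. Let $0<\varepsilon\le 1$ with $d\varepsilon^{3/4}/\sqrt\alpha\ge 1$ and let $k=\lceil d\varepsilon^{3/4}/\sqrt\alpha\rceil$. Then there are step sizes and noise levels (depending only on $\delta,d,\varepsilon,f_{\max},L,\rho,\sigma$ and, in the first case, $\tilde\ell$) with which uncompressed SGD finds $\varepsilon$-SOSPs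 in $T_1=\tilde\Theta(\alpha/\varepsilon^4)$ iterations and RandomK compressed SGD finds $\varepsilon$-SOSPs in $T_2=\tilde\Theta(\alpha/\varepsilon^4)$ iterations, and the total communication of RandomK compressed SGD is smaller than that of uncompressed SGD by the factor $$\frac{d\,T_1}{k\,T_2}=\tilde\Theta\bigl(\varepsilon^{-3/4}\bigr)\ \text{ if the stochastic gradient is Lipschitz } (\alpha=1),\qquad \frac{d\,T_1}{k\,T_2}=\tilde\Theta\bigl(\sqrt d\,\varepsilon^{-3/4}\bigr)\ \text{ otherwise } (\alpha=d).$$ Here $A=\tilde\Theta(B)$ means $B/K\le A\le KB$ with $K=C\Lambda^p\,(1+\log\tfrac d\varepsilon)^p$, where $C>0$ and $p\in\mathbb N$ depend only on $\delta$, and $\Lambda=1+f_{\max}+L+\rho+\rho^{-1}+\sigma+\tilde\ell$ (without $\tilde\ell$ in the second case). -/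

import Mathlib

open MeasureTheory ProbabilityTheory
open scoped ENNReal Gradient

universe u

noncomputable section

namespace CompressedSGD

/-- Parameter space `ℝ^d` with the Euclidean norm. -/
abbrev Vec (d : ℕ) : Type := EuclideanSpace ℝ (Fin d)

/-- The Hessian of `f` at `x`, as the derivative of the gradient. -/
def hessian {d : ℕ} (f : Vec d → ℝ) (x : Vec d) : Vec d →L[ℝ] Vec d :=
  fderiv ℝ (∇ f) x

/-- `f` is twice differentiable, `fmax`-bounded, `L`-smooth and has a `ρ`-Lipschitz Hessian. -/
structure SmoothObjective {d : ℕ} (f : Vec d → ℝ) (fmax L ρ : ℝ) : Prop where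
  differentiable : Differentiable ℝ f
  twice_differentiable : Differentiable ℝ (∇ f)
  bounded : ∀ x y, |f x - f y| ≤ fmax
  smooth : ∀ x y, ‖∇ f x - ∇ f y‖ ≤ L * ‖x - y‖
  hessian_lipschitz : ∀ x y, ‖hessian f x - hessian f y‖ ≤ ρ * ‖x - y‖

/-- `x` is an `ε`-second-order stationary point of a function with `ρ`-Lipschitz Hessian:
the gradient has norm at most `ε` and every eigenvalue of the Hessian is at least `-√(ρ ε)`. -/
def IsSOSP {d : ℕ} (f : Vec d → ℝ) (ρ ε : ℝ) (x : Vec d) : Prop :=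
  ‖∇ f x‖ ≤ ε ∧
    ∀ lam : ℝ, Module.End.HasEigenvalue (hessian f x : Vec d →ₗ[ℝ] Vec d) lam →
      -√(ρ * ε) ≤ lam

/-- `G x θ`, with `θ ∼ D`, is an unbiased stochastic gradient of `f` at `x`
whose variance is at most `σ²`. -/
structure StochasticOracle {d : ℕ} {Θ : Type u} [MeasurableSpace Θ] (D : Measure Θ)
    (f : Vec d → ℝ) (G : Vec d → Θ → Vec d) (σ : ℝ) : Prop where
  measurable : Measurable (Function.uncurry G)
  unbiased : ∀ x, Integrable (G x) D ∧ ∫ θ, G x θ ∂D = ∇ f x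
  variance_le : ∀ x, ∫⁻ θ, ‖G x θ - ∇ f x‖ₑ ^ 2 ∂D ≤ ENNReal.ofReal (σ ^ 2)

/-- The stochastic gradient is `ℓ`-Lipschitz. For `ℓ = ∞` this is no restriction. -/
def LipschitzOracle {d : ℕ} {Θ : Type u} (G : Vec d → Θ → Vec d) (ℓ : ℝ≥0∞) : Prop :=
  ∀ θ x y, edist (G x θ) (G y θ) ≤ ℓ * edist x y

/-- The compressor that preserves the coordinates in `S` and sets the others to zero. -/
def keep {d : ℕ} (S : Finset (Fin d)) (x : Vec d) : Vec d :=
  WithLp.toLp 2 fun i => if i ∈ S then x i else 0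

/-- RandomK: the set of preserved coordinates is uniform among the subsets of size `k`
(all coordinates are preserved if `k ≥ d`). -/
def randomK (d k : ℕ) : PMF (Finset (Fin d)) :=
  PMF.uniformOfFinset (Finset.powersetCard (min k d) Finset.univ)
    (Finset.powersetCard_nonempty.2 (by simp))

/-- No compression: all coordinates are preserved. -/
def noCompression (d : ℕ) : PMF (Finset (Fin d)) :=
  PMF.pure Finset.univ

/-- The artificial noise: centred isotropic Gaussian on `ℝ^d` of total variance `r²`,
that is, with covariance matrix `(r² / d) I`. -/
def noiseLaw (d : ℕ) (r : ℝ) : Measure (Vec d) :=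
  multivariateGaussian 0 ((r ^ 2 / d) • (1 : Matrix (Fin d) (Fin d) ℝ))

/-- The randomness of one run: in every iteration `t`, independently, the oracle's sample `θ_t ∼ D`,
the artificial noise `ξ_t` and the set `S_t` of preserved coordinates. -/
def runLaw {d : ℕ} {Θ : Type u} [MeasurableSpace Θ] (D : Measure Θ) (r : ℝ)
    (ν : PMF (Finset (Fin d))) : Measure (ℕ → Θ × Vec d × Finset (Fin d)) :=
  Measure.infinitePi fun _ => D.prod ((noiseLaw d r).prod ν.toMeasure)

/-- Compressed SGD with error feedback, step size `η` and starting point `x₀`, without error resets: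
the state after `t` iterations is the pair of the iterate `x_t` and the accumulated compression
error `e_t`. If all coordinates are preserved, then `e_t = 0` and this is uncompressed SGD with
artificial noise. -/
def state {d : ℕ} {Θ : Type u} (G : Vec d → Θ → Vec d) (η : ℝ) (x₀ : Vec d)
    (ω : ℕ → Θ × Vec d × Finset (Fin d)) : ℕ → Vec d × Vec d
  | 0 => (x₀, 0)
  | t + 1 =>
    let x := (state G η x₀ ω t).1
    let e := (state G η x₀ ω t).2
    let v := e + G x (ω t).1 + (ω t).2.1
    let g := keep (ω t).2.2 v
    (x - η • g, v - g)

open Classical in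
/-- The number of `ε`-SOSPs among the first `T` visited points `x_0, …, x_{T-1}`. -/
def numSOSP {d : ℕ} {Θ : Type u} (f : Vec d → ℝ) (ρ ε : ℝ) (G : Vec d → Θ → Vec d) (η : ℝ)
    (x₀ : Vec d) (T : ℕ) (ω : ℕ → Θ × Vec d × Finset (Fin d)) : ℕ :=
  ((Finset.range T).filter fun t => IsSOSP f ρ ε (state G η x₀ ω t).1).card

/-- Compressed SGD with coordinate selection `ν`, step size `η`, noise `r` and `T` iterations finds
`ε`-SOSPs, for every objective and every oracle of the given class and from every starting point:
at least half of the visited points are `ε`-SOSPs with probability at least `1 - δ`,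
and at least half of them are in expectation. -/
def FindsSOSP {d : ℕ} (ν : PMF (Finset (Fin d))) (η r : ℝ) (T : ℕ)
    (δ ε fmax L ρ σ : ℝ) (ℓ : ℝ≥0∞) : Prop :=
  ∀ (Θ : Type u) [MeasurableSpace Θ] (D : Measure Θ) [IsProbabilityMeasure D]
    (f : Vec d → ℝ) (G : Vec d → Θ → Vec d) (x₀ : Vec d),
    SmoothObjective f fmax L ρ → StochasticOracle D f G σ → LipschitzOracle G ℓ →
      1 - δ ≤ (runLaw D r ν).real {ω | (T : ℝ) / 2 ≤ numSOSP f ρ ε G η x₀ T ω} ∧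
      (T : ℝ) / 2 ≤ ∫ ω, (numSOSP f ρ ε G η x₀ T ω : ℝ) ∂(runLaw D r ν)

/-- Total communication per worker in `T` iterations: the (expected) number of coordinates that the
worker sends. The randomness of the selection is shared, so that in iteration `t` the worker sends
exactly the coordinates in `S_t` of its vector. -/
def totalCommunication {d : ℕ} (ν : PMF (Finset (Fin d))) (T : ℕ) : ℝ :=
  ∫ S : ℕ → Finset (Fin d), ∑ t ∈ Finset.range T, ((S t).card : ℝ)
    ∂(Measure.infinitePi fun _ => ν.toMeasure)

/-- `A` and `B` agree up to the factor `K`. -/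
def AgreeUpTo (K A B : ℝ) : Prop :=
  K⁻¹ * B ≤ A ∧ A ≤ K * B

/-- A factor that is polynomial in `Λ` and polylogarithmic in `d` and `1 / ε`. -/
def hiddenFactor (C : ℝ) (p : ℕ) (Λ : ℝ) (d : ℕ) (ε : ℝ) : ℝ :=
  C * Λ ^ p * (1 + Real.log (d / ε)) ^ p

/-- For a problem class with parameters `fmax, L, ρ, σ, ℓ`, uncompressed SGD and RandomK compressed
SGD both find `ε`-SOSPs, both in `α / ε⁴` iterations up to the factor `K`, and the total
communication of the former exceeds that of the latter by `factor`, up to `K`. -/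
def CommunicationDecreases (K δ : ℝ) (d k : ℕ) (ε fmax L ρ σ : ℝ) (ℓ : ℝ≥0∞)
    (α factor : ℝ) : Prop :=
  ∃ (η₁ r₁ : ℝ) (T₁ : ℕ) (η₂ r₂ : ℝ) (T₂ : ℕ),
    0 < η₁ ∧ 0 < r₁ ∧ 0 < η₂ ∧ 0 < r₂ ∧
    FindsSOSP.{u} (noCompression d) η₁ r₁ T₁ δ ε fmax L ρ σ ℓ ∧
    FindsSOSP.{u} (randomK d k) η₂ r₂ T₂ δ ε fmax L ρ σ ℓ ∧
    AgreeUpTo K T₁ (α / ε ^ 4) ∧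
    AgreeUpTo K T₂ (α / ε ^ 4) ∧
    AgreeUpTo K
      (totalCommunication (noCompression d) T₁ / totalCommunication (randomK d k) T₂) factor

end CompressedSGD

end

/-! Keeping all coordinates is in particular a compression that preserves, in mean square, a
fraction μ = ε^(3/4)/√α of every vector, and RandomK preserves the fraction k/d ≥ μ. One result for
compressors of quality μ, `findsSOSP_of_parameterBounds`, therefore serves both algorithms, with the
same step size, noise and number of iterations. The communication ratio is then exactly d/k, and
rounding k up costs at most a factor 2. A single number N dominates all constants of the class, 1/δ
and log(d/ε); up to powers of N, η = ε²/α, r² = α and T = α/ε⁴. In the proof w stands for ε^(1/4).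

Large gradients are rare. The corrected iterate y = x - ηe moves by the uncompressed noisy gradient,
so f(y) plus a multiple of ‖e‖² is a Lyapunov function. Its drift bounds the average of ‖∇f(x)‖² and
of the scaled ‖e‖² by a constant times ε²/N¹³ (`sum_lintegral_gradient_le`,
`sum_lintegral_energy_le`).

Strict saddle points are rare. Let -γ be the least Hessian eigenvalue at such a point, with unit
eigenvector u. Two runs start there with the same samples and the same selected sets, but with
Gaussian noises that are mirror images along u; by rotation invariance each is a genuine run. The
linear part of their difference is a scalar Gaussian process multiplied by 1 + ηγ in each step.
While both runs stay within R, of order √ε, of the start, everything else in the difference is much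
smaller in mean square (`coupled_moments_le`). After about N/(ηγ) steps the Gaussian part would
exceed the diameter of the ball, so with probability at least 1/12 one of the runs leaves it
(`localLaw_region_le`, `exists_exit_time`). The noise alone is too weak for such a displacement, so
large gradients or a large initial compression error must account for it (`exit_probability_le`,
`radius_sq_le_sum_gradient`).

No decrease of f is attributed to an individual saddle. Instead each visit to a saddle is charged to
the energy of the window that follows it. Summing over starting times and using the average energy
bound leaves at most 10⁶T/N bad iterates in expectation (`sum_sgdLaw_not_isSOSP_le`), and Markov's
inequality finishes. -/

noncomputable section

namespace CompressedSGD

/-! ### Markov chains driven by independent noise, and their killed versions. -/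

section Chain

variable {X Y Z W : Type*} [MeasurableSpace X] [MeasurableSpace Y] [MeasurableSpace Z]
  [MeasurableSpace W]

/-- The law after `n` steps of a Markov chain with initial law `m`, transition map `step` and
driving noise of law `μ`, killed when it leaves `A`. -/
def killedLaw (μ : Measure Z) (step : X → Z → X) (A : Set X) (m : Measure X) : ℕ → Measure X
  | 0 => m
  | n + 1 => (((killedLaw μ step A m n).restrict A).prod μ).map (Function.uncurry step)

/-- The law after `n` steps of a Markov chain with initial law `m`, transition map `step` and
driving noise of law `μ`. -/
def chainLaw (μ : Measure Z) (step : X → Z → X) (m : Measure X) : ℕ → Measure X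
  | 0 => m
  | n + 1 => ((chainLaw μ step m n).prod μ).map (Function.uncurry step)

variable {μ : Measure Z} {step : X → Z → X} {A : Set X} {m : Measure X}

lemma chainLaw_add (n k : ℕ) :
    chainLaw μ step m (n + k) = chainLaw μ step (chainLaw μ step m n) k := by
  induction k with
  | zero => rfl
  | succ k ih => rw [← add_assoc, chainLaw, ih]; rfl

variable [IsProbabilityMeasure μ]

lemma chainLaw_isProbabilityMeasure (hstep : Measurable (Function.uncurry step))
    [IsProbabilityMeasure m] (n : ℕ) : IsProbabilityMeasure (chainLaw μ step m n) := by
  induction n with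
  | zero => simpa [chainLaw]
  | succ n ih => rw [chainLaw]; exact Measure.isProbabilityMeasure_map hstep.aemeasurable

instance chainLaw_isFinite [IsFiniteMeasure m] (n : ℕ) :
    IsFiniteMeasure (chainLaw μ step m n) := by
  induction n with
  | zero => simpa [chainLaw]
  | succ n ih => rw [chainLaw]; infer_instance

lemma lintegral_killedLaw_succ (hstep : Measurable (Function.uncurry step)) (n : ℕ)
    {h : X → ℝ≥0∞} (hh : Measurable h) :
    ∫⁻ x, h x ∂(killedLaw μ step A m (n + 1)) =
      ∫⁻ x in A, ∫⁻ z, h (step x z) ∂μ ∂(killedLaw μ step A m n) := by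
  rw [killedLaw, lintegral_map hh hstep,
    lintegral_prod (fun p => h (Function.uncurry step p)) (hh.comp hstep).aemeasurable]
  rfl

lemma lintegral_chainLaw_succ (hstep : Measurable (Function.uncurry step)) (n : ℕ)
    {h : X → ℝ≥0∞} (hh : Measurable h) :
    ∫⁻ x, h x ∂(chainLaw μ step m (n + 1)) =
      ∫⁻ x, ∫⁻ z, h (step x z) ∂μ ∂(chainLaw μ step m n) := by
  rw [chainLaw, lintegral_map hh hstep,
    lintegral_prod (fun p => h (Function.uncurry step p)) (hh.comp hstep).aemeasurable]
  rfl

lemma killedLaw_le_chainLaw [IsFiniteMeasure m] (hstep : Measurable (Function.uncurry step))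
    (n : ℕ) : killedLaw μ step A m n ≤ chainLaw μ step m n := by
  induction n with
  | zero => exact le_rfl
  | succ n ih =>
    rw [killedLaw, chainLaw]
    exact Measure.map_mono
      (Measure.prod_mono (Measure.restrict_le_self.trans ih) le_rfl) hstep

/-- Killing acts at the beginning of a step: the law at time `n` may still charge the complement of
`A`, and exactly this mass is lost in the next step. -/
lemma killedLaw_univ_succ (hstep : Measurable (Function.uncurry step)) (n : ℕ) :
    killedLaw μ step A m (n + 1) Set.univ = killedLaw μ step A m n A := by
  have := lintegral_killedLaw_succ (μ := μ) (A := A) (m := m) hstep n (h := fun _ => 1)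
    measurable_const
  simpa using this

/-- A map that intertwines two transition maps, up to a measure-preserving change of the noise,
intertwines the chains. This gives both marginals of the coupling and the law of its scalar
component. -/
lemma chainLaw_map [IsFiniteMeasure m] {ν : Measure W} [IsProbabilityMeasure ν] {π : X → Y}
    {φ : Z → W} {step' : Y → W → Y} (hπ : Measurable π) (hφ : MeasurePreserving φ μ ν)
    (hstep : Measurable (Function.uncurry step)) (hstep' : Measurable (Function.uncurry step'))
    (h : ∀ x z, π (step x z) = step' (π x) (φ z)) (n : ℕ) :
    (chainLaw μ step m n).map π = chainLaw ν step' (m.map π) n := by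
  induction n with
  | zero => rfl
  | succ n ih =>
    rw [chainLaw, chainLaw, ← ih, ← hφ.map_eq, Measure.map_prod_map _ _ hπ hφ.measurable,
      Measure.map_map hπ hstep, Measure.map_map hstep' (hπ.prodMap hφ.measurable)]
    congr 1
    ext p
    exact h p.1 p.2

/-- `H` is the n-step transition operator applied to `h`. That one measurable `H` serves all initial
laws is all that is needed of the Markov property, so no kernels are constructed. -/
lemma exists_lintegral_chainLaw (hstep : Measurable (Function.uncurry step)) (n : ℕ)
    {h : X → ℝ≥0∞} (hh : Measurable h) :
    ∃ H : X → ℝ≥0∞, Measurable H ∧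
      ∀ m : Measure X, ∫⁻ x, h x ∂(chainLaw μ step m n) = ∫⁻ x, H x ∂m := by
  induction n generalizing h with
  | zero => exact ⟨h, hh, fun m => rfl⟩
  | succ n ih =>
    have h1 : Measurable fun x => ∫⁻ z, h (step x z) ∂μ :=
      (hh.comp hstep).lintegral_prod_right'
    obtain ⟨H, hH, hH'⟩ := ih h1
    exact ⟨H, hH, fun m => by rw [lintegral_chainLaw_succ hstep n hh, hH']⟩

lemma measurable_lintegral_chainLaw_dirac (hstep : Measurable (Function.uncurry step)) (n : ℕ)
    {h : X → ℝ≥0∞} (hh : Measurable h) :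
    Measurable fun x => ∫⁻ y, h y ∂(chainLaw μ step (Measure.dirac x) n) := by
  obtain ⟨H, hH, hH'⟩ := exists_lintegral_chainLaw (μ := μ) hstep n hh
  simpa [hH', lintegral_dirac' _ hH] using hH

lemma lintegral_chainLaw_add (hstep : Measurable (Function.uncurry step)) (n k : ℕ)
    {h : X → ℝ≥0∞} (hh : Measurable h) :
    ∫⁻ x, h x ∂(chainLaw μ step m (n + k)) =
      ∫⁻ x, ∫⁻ y, h y ∂(chainLaw μ step (Measure.dirac x) k) ∂(chainLaw μ step m n) := by
  obtain ⟨H, hH, hH'⟩ := exists_lintegral_chainLaw (μ := μ) hstep k hh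
  simp [chainLaw_add, hH', lintegral_dirac' _ hH]

/-- The state at time `n` is a measurable function of the noise coordinates below `n`, hence
independent of coordinate `n`; the joint law of state and next noise is therefore a product. -/
lemma map_infinitePi_eq_chainLaw (hstep : Measurable (Function.uncurry step))
    {F : (ℕ → Z) → ℕ → X} {x₀ : X} (h0 : ∀ ω, F ω 0 = x₀)
    (hsucc : ∀ ω n, F ω (n + 1) = step (F ω n) (ω n)) (n : ℕ) :
    Measurable (fun ω => F ω n) ∧
      (Measure.infinitePi fun _ : ℕ => μ).map (fun ω => F ω n) =
        chainLaw μ step (Measure.dirac x₀) n := by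
  have key : ∀ n, ∃ g : (Finset.range n → Z) → X, Measurable g ∧
      ∀ ω, F ω n = g fun i => ω i := by
    intro n
    induction n with
    | zero => exact ⟨fun _ => x₀, measurable_const, fun ω => h0 ω⟩
    | succ n ih =>
      obtain ⟨g, hg, hg'⟩ := ih
      refine ⟨fun w => step (g fun i => w ⟨i, by
        have := i.2; simp only [Finset.mem_range] at this ⊢; lia⟩) (w ⟨n, by simp⟩), ?_, ?_⟩
      · exact hstep.comp ((hg.comp (by fun_prop)).prodMk (by fun_prop))
      · intro ω; rw [hsucc, hg']
  have hmeas : ∀ n, Measurable fun ω => F ω n := by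
    intro n
    obtain ⟨g, hg, hg'⟩ := key n
    simp only [hg']
    exact hg.comp (by fun_prop)
  refine ⟨hmeas n, ?_⟩
  induction n with
  | zero => simp [h0, chainLaw]
  | succ n ih =>
    obtain ⟨g, hg, hg'⟩ := key n
    have hind : iIndepFun (fun (i : ℕ) (ω : ℕ → Z) => ω i) (Measure.infinitePi fun _ : ℕ => μ) :=
      iIndepFun_infinitePi (P := fun _ : ℕ => μ) (X := fun _ => id) (fun _ => measurable_id)
    have hψ : Measurable fun w : ({n} : Finset ℕ) → Z => w ⟨n, by simp⟩ := measurable_pi_apply _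
    have h2 := (hind.indepFun_finset (Finset.range n) {n} (by simp) (by fun_prop)).comp
      hg hψ
    have h3 : IndepFun (fun ω => F ω n) (fun ω : ℕ → Z => ω n)
        (Measure.infinitePi fun _ : ℕ => μ) := by
      convert h2 using 1
      · ext ω; exact hg' ω
      · rfl
    rw [indepFun_iff_map_prod_eq_prod_map_map (hmeas n).aemeasurable
        (measurable_pi_apply n).aemeasurable,
      Measure.infinitePi_map_eval, ih] at h3
    rw [chainLaw, ← h3, Measure.map_map hstep ((hmeas n).prodMk (measurable_pi_apply n))]
    congr 1
    ext ω
    exact hsucc ω n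

end Chain

/-! ### The isotropic Gaussian noise: rotation invariance and second moments. -/

section Noise

variable {d : ℕ}

instance (r : ℝ) : IsProbabilityMeasure (noiseLaw d r) := by
  unfold noiseLaw; infer_instance

instance (r : ℝ) : IsGaussian (noiseLaw d r) := by
  unfold noiseLaw; infer_instance

lemma posSemidef_smul_one {c : ℝ} (hc : 0 ≤ c) :
    (c • (1 : Matrix (Fin d) (Fin d) ℝ)).PosSemidef :=
  Matrix.PosSemidef.one.smul hc

lemma charFun_noiseLaw (r : ℝ) (t : Vec d) :
    charFun (noiseLaw d r) t = Complex.exp (-((r ^ 2 / d * ‖t‖ ^ 2 : ℝ) : ℂ) / 2) := by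
  rw [noiseLaw, charFun_multivariateGaussian (posSemidef_smul_one (by positivity))]
  congr 1
  have : t.ofLp ⬝ᵥ (r ^ 2 / d) • t.ofLp = r ^ 2 / d * ‖t‖ ^ 2 := by
    rw [dotProduct_smul, EuclideanSpace.real_norm_sq_eq]
    simp [dotProduct, pow_two]
  simp only [inner_zero_right, Matrix.smul_mulVec, Matrix.one_mulVec, this]
  push_cast
  ring

/-- The characteristic function depends on its argument only through the norm. -/
lemma measurePreserving_noiseLaw (r : ℝ) (U : Vec d ≃ₗᵢ[ℝ] Vec d) :
    MeasurePreserving U (noiseLaw d r) (noiseLaw d r) := by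
  have hU : Measurable U := U.continuous.measurable
  refine ⟨hU, ?_⟩
  have := Measure.isProbabilityMeasure_map (μ := noiseLaw d r) hU.aemeasurable
  apply Measure.ext_of_charFun
  ext t
  have h : charFun ((noiseLaw d r).map U) t = charFun (noiseLaw d r) (U.symm t) := by
    rw [charFun_apply, charFun_apply, integral_map hU.aemeasurable (by fun_prop)]
    congr 1
    ext x
    rw [← U.inner_map_map x (U.symm t)]
    simp
  rw [h, charFun_noiseLaw, charFun_noiseLaw, U.symm.norm_map]

lemma integral_noiseLaw (r : ℝ) : ∫ ξ, ξ ∂(noiseLaw d r) = 0 := by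
  simp [noiseLaw]

lemma memLp_noiseLaw (r : ℝ) : MemLp (fun ξ => ξ) 2 (noiseLaw d r) :=
  IsGaussian.memLp_two_id

lemma map_inner_noiseLaw (r : ℝ) {u : Vec d} (hu : ‖u‖ = 1) :
    (noiseLaw d r).map (fun ξ => inner ℝ u ξ) = gaussianReal 0 (r ^ 2 / d).toNNReal := by
  have hU : Measurable fun ξ : Vec d => inner ℝ u ξ := by fun_prop
  have := Measure.isProbabilityMeasure_map (μ := noiseLaw d r) hU.aemeasurable
  apply Measure.ext_of_charFun
  ext t
  have h : charFun ((noiseLaw d r).map fun ξ => inner ℝ u ξ) t =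
      charFun (noiseLaw d r) (t • u) := by
    rw [charFun_apply, charFun_apply, integral_map hU.aemeasurable (by fun_prop)]
    congr 1
    ext x
    simp [inner_smul_right, real_inner_comm]
  rw [h, charFun_noiseLaw, charFun_gaussianReal, norm_smul, hu]
  congr 1
  simp [Real.coe_toNNReal _ (show (0 : ℝ) ≤ r ^ 2 / d by positivity), neg_div]

lemma lintegral_norm_sq_noiseLaw (hd : 0 < d) (r : ℝ) :
    ∫⁻ ξ, ENNReal.ofReal (‖ξ‖ ^ 2) ∂(noiseLaw d r) = ENNReal.ofReal (r ^ 2) := by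
  have hi : ∀ i, Integrable (fun ξ : Vec d => ξ i ^ 2) (noiseLaw d r) := fun i =>
    ((EuclideanSpace.proj (𝕜 := ℝ) i).comp_memLp' (memLp_noiseLaw r)).integrable_sq
  have h0 : ∀ i, ∫ ξ : Vec d, ξ i ∂(noiseLaw d r) = 0 := fun i => by
    have := (EuclideanSpace.proj (𝕜 := ℝ) i).integral_comp_comm
      ((memLp_noiseLaw (d := d) r).integrable (by norm_num))
    rw [integral_noiseLaw] at this
    simpa using this
  have hv : ∀ i, ∫ ξ : Vec d, ξ i ^ 2 ∂(noiseLaw d r) = r ^ 2 / d := fun i => by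
    have h1 := variance_eval_multivariateGaussian (μ := 0)
      (posSemidef_smul_one (d := d) (show (0 : ℝ) ≤ r ^ 2 / d by positivity)) i
    rw [← noiseLaw, variance_of_integral_eq_zero (by fun_prop) (h0 i)] at h1
    simpa using h1
  rw [← ofReal_integral_eq_lintegral_ofReal ((memLp_noiseLaw r).integrable_norm_pow (by norm_num))
    (ae_of_all _ fun _ => by positivity)]
  simp only [EuclideanSpace.real_norm_sq_eq]
  rw [integral_finsetSum _ fun i _ => hi i]
  simp only [hv]
  have : (d : ℝ) ≠ 0 := by positivity
  simp [mul_div_cancel₀ _ this]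

end Noise

/-! ### Mean-square quality of the compressors. -/

section Compressor

variable {d : ℕ}

/-- In expectation, the compressor with coordinate selection `ν` preserves at least a fraction `μ`
of the squared norm. -/
def IsCompressor (ν : PMF (Finset (Fin d))) (μ : ℝ) : Prop :=
  ∀ v : Vec d, ∫⁻ S, ENNReal.ofReal (‖v - keep S v‖ ^ 2) ∂ν.toMeasure ≤
    ENNReal.ofReal ((1 - μ) * ‖v‖ ^ 2)

lemma IsCompressor.mono {ν : PMF (Finset (Fin d))} {μ μ' : ℝ} (h : IsCompressor ν μ)
    (hμ : μ' ≤ μ) : IsCompressor ν μ' := fun v =>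
  (h v).trans (ENNReal.ofReal_le_ofReal (by gcongr))

lemma isCompressor_noCompression : IsCompressor (noCompression d) 1 := by
  intro v
  have : keep Finset.univ v = v := by ext i; simp [keep]
  simp [noCompression, PMF.toMeasure_pure, this]

lemma norm_sub_keep_sq (S : Finset (Fin d)) (v : Vec d) :
    ‖v - keep S v‖ ^ 2 = ∑ i, if i ∈ S then 0 else v i ^ 2 := by
  rw [EuclideanSpace.real_norm_sq_eq]
  refine Finset.sum_congr rfl fun i _ => ?_
  by_cases h : i ∈ S <;> simp [keep, h]

lemma card_powersetCard_filter_notMem (m : ℕ) (i : Fin d) :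
    ((Finset.powersetCard m (Finset.univ : Finset (Fin d))).filter fun S => i ∉ S).card =
      (d - 1).choose m := by
  have : (Finset.powersetCard m (Finset.univ : Finset (Fin d))).filter (fun S => i ∉ S) =
      Finset.powersetCard m (Finset.univ.erase i) := by
    ext S
    simp only [Finset.mem_filter, Finset.mem_powersetCard, Finset.subset_erase]
    tauto
  rw [this, Finset.card_powersetCard, Finset.card_erase_of_mem (Finset.mem_univ i)]
  simp

/-- A coordinate is missed by C(d-1, k) of the C(d, k) sets, that is, with probability 1 - k/d.
Summing over the coordinates gives equality. -/
lemma isCompressor_randomK (hd : 0 < d) {k : ℕ} (hk : k ≤ d) :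
    IsCompressor (randomK d k) (k / d) := by
  intro v
  have hpos : 0 < d.choose k := Nat.choose_pos hk
  have hd' : (0 : ℝ) < d := by exact_mod_cast hd
  rw [← ofReal_integral_eq_lintegral_ofReal .of_finite (ae_of_all _ fun _ => by positivity)]
  refine ENNReal.ofReal_le_ofReal (le_of_eq ?_)
  rw [PMF.integral_eq_sum]
  have h1 : ∀ S : Finset (Fin d), (randomK d k S).toReal • ‖v - keep S v‖ ^ 2 =
      if S ∈ Finset.powersetCard k Finset.univ then
        (d.choose k : ℝ)⁻¹ * ∑ i, if i ∈ S then 0 else v i ^ 2 else 0 := by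
    intro S
    rw [norm_sub_keep_sq, randomK, PMF.uniformOfFinset_apply, min_eq_left hk,
      Finset.card_powersetCard, Finset.card_univ, Fintype.card_fin]
    split_ifs <;> simp
  simp only [h1]
  rw [Finset.sum_ite_mem, Finset.univ_inter, ← Finset.mul_sum, Finset.sum_comm]
  have h2 : ∀ i : Fin d, (∑ S ∈ Finset.powersetCard k (Finset.univ : Finset (Fin d)),
      if i ∈ S then 0 else v i ^ 2) = (d - 1).choose k * v i ^ 2 := by
    intro i
    rw [← card_powersetCard_filter_notMem k i, ← nsmul_eq_mul, ← Finset.sum_const,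
      Finset.sum_filter]
    exact Finset.sum_congr rfl fun S _ => by split_ifs <;> simp_all
  simp only [h2]
  rw [← Finset.mul_sum, ← EuclideanSpace.real_norm_sq_eq, ← mul_assoc]
  congr 1
  have h3 : ((d - 1).choose k : ℝ) * d = d.choose k * (d - k) := by
    have := Nat.choose_mul_succ_eq (d - 1) k
    rw [Nat.sub_add_cancel hd] at this
    rw [← Nat.cast_sub hk]
    exact_mod_cast this
  have h4 : (d.choose k : ℝ) ≠ 0 := by positivity
  field_simp
  linarith

end Compressor

/-! ### Second moment of a vector plus a centred perturbation. -/

section Centred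

lemma lintegral_norm_add_sq_le {Ω E : Type*} [MeasurableSpace Ω] {P : Measure Ω}
    [IsProbabilityMeasure P] [NormedAddCommGroup E] [InnerProductSpace ℝ E] [CompleteSpace E]
    {X : Ω → E} (hX : Integrable X P) (h0 : ∫ ω, X ω ∂P = 0) {s : ℝ} (hs : 0 ≤ s)
    (hs' : ∫⁻ ω, ENNReal.ofReal (‖X ω‖ ^ 2) ∂P ≤ ENNReal.ofReal s) (u : E) :
    ∫⁻ ω, ENNReal.ofReal (‖u + X ω‖ ^ 2) ∂P ≤ ENNReal.ofReal (‖u‖ ^ 2 + s) := by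
  have hX2 : Integrable (fun ω => ‖X ω‖ ^ 2) P := by
    refine ⟨hX.1.norm.pow 2, ?_⟩
    rw [hasFiniteIntegral_iff_ofReal (ae_of_all _ fun _ => by positivity)]
    exact hs'.trans_lt ENNReal.ofReal_lt_top
  have hin : Integrable (fun ω => inner ℝ u (X ω)) P := hX.const_inner u
  have h1 : ∀ ω, ‖u + X ω‖ ^ 2 = (‖u‖ ^ 2 + 2 * inner ℝ u (X ω)) + ‖X ω‖ ^ 2 := fun ω =>
    norm_add_sq_real _ _
  have hi1 : Integrable (fun ω => ‖u‖ ^ 2 + 2 * inner ℝ u (X ω)) P :=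
    (integrable_const _).add (hin.const_mul 2)
  have hi : Integrable (fun ω => ‖u + X ω‖ ^ 2) P := by
    simp only [h1]; exact hi1.add hX2
  rw [← ofReal_integral_eq_lintegral_ofReal hi (ae_of_all _ fun _ => by positivity)]
  refine ENNReal.ofReal_le_ofReal ?_
  simp only [h1]
  rw [integral_add hi1 hX2, integral_add (integrable_const _) (hin.const_mul 2),
    integral_const_mul, integral_inner hX, h0]
  rw [← ofReal_integral_eq_lintegral_ofReal hX2 (ae_of_all _ fun _ => by positivity),
    ENNReal.ofReal_le_ofReal_iff hs] at hs'
  simpa using hs'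

end Centred

/-! ### One iteration: measurability and second moments. -/

section OneStep

variable {d : ℕ} {Θ : Type u} [MeasurableSpace Θ]

/-- The law of the randomness of one iteration. -/
def stepLaw (D : Measure Θ) (r : ℝ) (ν : PMF (Finset (Fin d))) :
    Measure (Θ × Vec d × Finset (Fin d)) :=
  D.prod ((noiseLaw d r).prod ν.toMeasure)

/-- One iteration of compressed SGD on the pair of the iterate and the compression error. -/
def sgdStep (G : Vec d → Θ → Vec d) (η : ℝ) (s : Vec d × Vec d) (z : Θ × Vec d × Finset (Fin d)) :
    Vec d × Vec d :=
  (s.1 - η • keep z.2.2 (s.2 + G s.1 z.1 + z.2.1),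
    s.2 + G s.1 z.1 + z.2.1 - keep z.2.2 (s.2 + G s.1 z.1 + z.2.1))

variable {D : Measure Θ} {r : ℝ} {ν : PMF (Finset (Fin d))}
  {G : Vec d → Θ → Vec d} {η μ : ℝ}

instance [IsProbabilityMeasure D] : IsProbabilityMeasure (stepLaw D r ν) := by
  unfold stepLaw; infer_instance

lemma measurable_keep : Measurable fun p : Finset (Fin d) × Vec d => keep p.1 p.2 := by
  refine measurable_from_prod_countable_right fun S => ?_
  have : Measurable fun x : Vec d => (fun i => if i ∈ S then x i else 0) := by
    refine measurable_pi_lambda _ fun i => ?_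
    by_cases h : i ∈ S <;> simp only [h, if_true, if_false] <;> fun_prop
  exact (PiLp.continuous_toLp 2 _).measurable.comp this

lemma measurable_keep_comp {X : Type*} [MeasurableSpace X] {S : X → Finset (Fin d)}
    {v : X → Vec d} (hS : Measurable S) (hv : Measurable v) :
    Measurable fun x => keep (S x) (v x) :=
  measurable_keep.comp (hS.prodMk hv)

lemma measurable_sgdStep (hG : Measurable (Function.uncurry G)) :
    Measurable (Function.uncurry (sgdStep G η)) := by
  have h1 : Measurable fun p : (Vec d × Vec d) × Θ × Vec d × Finset (Fin d) =>
      p.1.2 + G p.1.1 p.2.1 + p.2.2.1 := by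
    have : Measurable fun p : (Vec d × Vec d) × Θ × Vec d × Finset (Fin d) => G p.1.1 p.2.1 :=
      hG.comp (measurable_fst.fst.prodMk measurable_snd.fst)
    fun_prop
  have h2 := measurable_keep_comp (S := fun p : (Vec d × Vec d) × Θ × Vec d × Finset (Fin d) =>
    p.2.2.2) (by fun_prop) h1
  exact Measurable.prodMk (by fun_prop) (h1.sub h2)

lemma lintegral_stepLaw_sq_le [IsProbabilityMeasure D] {N : Θ → Vec d} {Ξ : Vec d → Vec d}
    (hN : Measurable N)
    (hΞ : Measurable Ξ) (hNi : Integrable N D) (hN0 : ∫ θ, N θ ∂D = 0)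
    (hΞi : Integrable Ξ (noiseLaw d r)) (hΞ0 : ∫ ξ, Ξ ξ ∂(noiseLaw d r) = 0) {s₁ s₂ : ℝ}
    (hs₁ : 0 ≤ s₁) (hs₂ : 0 ≤ s₂)
    (hNs : ∫⁻ θ, ENNReal.ofReal (‖N θ‖ ^ 2) ∂D ≤ ENNReal.ofReal s₁)
    (hΞs : ∫⁻ ξ, ENNReal.ofReal (‖Ξ ξ‖ ^ 2) ∂(noiseLaw d r) ≤ ENNReal.ofReal s₂) (u : Vec d) :
    ∫⁻ z, ENNReal.ofReal (‖u + N z.1 + Ξ z.2.1‖ ^ 2) ∂(stepLaw D r ν) ≤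
      ENNReal.ofReal (‖u‖ ^ 2 + s₁ + s₂) := by
  rw [stepLaw, lintegral_prod _ (by fun_prop)]
  calc ∫⁻ θ, ∫⁻ w, ENNReal.ofReal (‖u + N θ + Ξ w.1‖ ^ 2) ∂((noiseLaw d r).prod ν.toMeasure) ∂D
      ≤ ∫⁻ θ, ENNReal.ofReal (‖u + N θ‖ ^ 2 + s₂) ∂D := by
        refine lintegral_mono fun θ => ?_
        rw [lintegral_prod _ (by fun_prop)]
        simpa using lintegral_norm_add_sq_le hΞi hΞ0 hs₂ hΞs (u + N θ)
    _ = ∫⁻ θ, ENNReal.ofReal (‖u + N θ‖ ^ 2) ∂D + ENNReal.ofReal s₂ := by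
        simp only [ENNReal.ofReal_add (sq_nonneg _) hs₂]
        rw [lintegral_add_right _ measurable_const]
        simp
    _ ≤ ENNReal.ofReal (‖u‖ ^ 2 + s₁) + ENNReal.ofReal s₂ := by
        gcongr
        exact lintegral_norm_add_sq_le hNi hN0 hs₁ hNs u
    _ = _ := by rw [← ENNReal.ofReal_add (by positivity) hs₂]

/-- The set `S` is independent of the vector that it compresses, so the compressor inequality
applies with the sample and the noise held fixed. -/
lemma lintegral_stepLaw_compress_le (hν : IsCompressor ν μ) (hμ : μ ≤ 1)
    {v : Θ → Vec d → Vec d} (hv : Measurable (Function.uncurry v)) :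
    ∫⁻ z, ENNReal.ofReal (‖v z.1 z.2.1 - keep z.2.2 (v z.1 z.2.1)‖ ^ 2) ∂(stepLaw D r ν) ≤
      ENNReal.ofReal (1 - μ) *
        ∫⁻ z, ENNReal.ofReal (‖v z.1 z.2.1‖ ^ 2) ∂(stepLaw D r ν) := by
  have hv' : Measurable fun z : Θ × Vec d × Finset (Fin d) => v z.1 z.2.1 :=
    hv.comp (measurable_fst.prodMk measurable_snd.fst)
  have hk : Measurable fun z : Θ × Vec d × Finset (Fin d) => keep z.2.2 (v z.1 z.2.1) :=
    measurable_keep_comp measurable_snd.snd hv'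
  have h1 : Measurable fun z : Θ × Vec d × Finset (Fin d) =>
      ENNReal.ofReal (‖v z.1 z.2.1 - keep z.2.2 (v z.1 z.2.1)‖ ^ 2) := by fun_prop
  have h2 : Measurable fun z : Θ × Vec d × Finset (Fin d) =>
      ENNReal.ofReal (‖v z.1 z.2.1‖ ^ 2) := by fun_prop
  rw [← lintegral_const_mul _ h2, stepLaw, lintegral_prod _ h1.aemeasurable,
    lintegral_prod _ (h2.const_mul _).aemeasurable]
  refine lintegral_mono fun θ => ?_
  refine (lintegral_prod _ (h1.comp measurable_prodMk_left).aemeasurable).trans_le ?_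
  refine le_trans ?_
    (lintegral_prod _ ((h2.const_mul _).comp measurable_prodMk_left).aemeasurable).ge
  refine lintegral_mono fun ξ => ?_
  refine (hν (v θ ξ)).trans ?_
  rw [ENNReal.ofReal_mul (by linarith)]
  simp

end OneStep

/-! ### Taylor estimates, the Hessian and its least eigenvalue. -/

section Objective

variable {d : ℕ} {f : Vec d → ℝ} {fmax L ρ : ℝ}

namespace SmoothObjective

lemma hasFDerivAt (hf : SmoothObjective f fmax L ρ) (x : Vec d) :
    HasFDerivAt f (InnerProductSpace.toDual ℝ (Vec d) (∇ f x)) x :=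
  (hf.differentiable x).hasGradientAt

lemma hasFDerivAt_gradient (hf : SmoothObjective f fmax L ρ) (x : Vec d) :
    HasFDerivAt (∇ f) (hessian f x) x :=
  (hf.twice_differentiable x).hasFDerivAt

lemma continuous_gradient (hf : SmoothObjective f fmax L ρ) : Continuous (∇ f) :=
  hf.twice_differentiable.continuous

lemma continuous_hessian (hf : SmoothObjective f fmax L ρ) : Continuous (hessian f) := by
  have : LipschitzWith ρ.toNNReal (hessian f) :=
    LipschitzWith.of_dist_le_mul fun x y => by
      rw [dist_eq_norm, dist_eq_norm]
      exact (hf.hessian_lipschitz x y).trans (by gcongr; exact Real.le_coe_toNNReal ρ)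
  exact this.continuous

/-- This is the mean value inequality on a ball; it gives the constant `L` rather than the sharp `L
/ 2`, which suffices. -/
lemma taylor_one (hf : SmoothObjective f fmax L ρ) (hL : 0 ≤ L) (y u : Vec d) :
    |f (y + u) - f y - inner ℝ (∇ f y) u| ≤ L * ‖u‖ ^ 2 := by
  have h := (convex_closedBall y ‖u‖).norm_image_sub_le_of_norm_hasFDerivWithin_le'
    (f := f) (φ := InnerProductSpace.toDual ℝ (Vec d) (∇ f y)) (C := L * ‖u‖) (x := y) (y := y + u)
    (fun x _ => (hf.hasFDerivAt x).hasFDerivWithinAt) (fun x hx => ?_) (by simp) (by simp)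
  · simpa [pow_two, mul_assoc] using h
  · rw [← map_sub, LinearIsometryEquiv.norm_map]
    refine (hf.smooth x y).trans ?_
    gcongr
    rwa [mem_closedBall_iff_norm] at hx

lemma norm_gradient_sub_hessian_le (hf : SmoothObjective f fmax L ρ) (hρ : 0 ≤ ρ) {R : ℝ}
    {x₀ x x' : Vec d} (hx : ‖x - x₀‖ ≤ R) (hx' : ‖x' - x₀‖ ≤ R) :
    ‖∇ f x - ∇ f x' - hessian f x₀ (x - x')‖ ≤ ρ * R * ‖x - x'‖ := by
  refine (convex_closedBall x₀ R).norm_image_sub_le_of_norm_hasFDerivWithin_le'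
    (fun y _ => (hf.hasFDerivAt_gradient y).hasFDerivWithinAt) (fun y hy => ?_)
    (by rwa [mem_closedBall_iff_norm]) (by rwa [mem_closedBall_iff_norm])
  refine (hf.hessian_lipschitz y x₀).trans ?_
  gcongr
  rwa [mem_closedBall_iff_norm] at hy

lemma norm_hessian_le (hf : SmoothObjective f fmax L ρ) (hL : 0 ≤ L) (x : Vec d) :
    ‖hessian f x‖ ≤ L := by
  have : LipschitzWith L.toNNReal (∇ f) :=
    LipschitzWith.of_dist_le_mul fun x y => by
      rw [dist_eq_norm, dist_eq_norm, Real.coe_toNNReal _ hL]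
      exact hf.smooth x y
  simpa [hessian, Real.coe_toNNReal _ hL] using norm_fderiv_le_of_lipschitz ℝ this (x₀ := x)

lemma isSymmetric_hessian (hf : SmoothObjective f fmax L ρ) (x : Vec d) :
    (hessian f x : Vec d →ₗ[ℝ] Vec d).IsSymmetric := by
  intro v w
  have h2 : HasFDerivAt (fun y => InnerProductSpace.toDual ℝ (Vec d) (∇ f y))
      ((InnerProductSpace.toDual ℝ (Vec d)).toContinuousLinearEquiv.toContinuousLinearMap.comp
        (hessian f x)) x :=
    (InnerProductSpace.toDual ℝ
      (Vec d)).toContinuousLinearEquiv.toContinuousLinearMap.hasFDerivAt.comp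
      x (hf.hasFDerivAt_gradient x)
  have h := second_derivative_symmetric hf.hasFDerivAt h2 v w
  simp only [ContinuousLinearMap.comp_apply] at h
  rw [ContinuousLinearMap.coe_coe, real_inner_comm]
  rw [real_inner_comm]
  simpa [real_inner_comm] using h

end SmoothObjective

/-- A symmetric operator with an eigenvalue has a minimal one, which controls its quadratic form
and the norm of a gradient step on it. -/
lemma exists_min_eigenvalue {H : Vec d →L[ℝ] Vec d} (hH : (H : Vec d →ₗ[ℝ] Vec d).IsSymmetric)
    {lam : ℝ} (hlam : Module.End.HasEigenvalue (H : Vec d →ₗ[ℝ] Vec d) lam) :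
    ∃ (m : ℝ) (u : Vec d), m ≤ lam ∧ ‖u‖ = 1 ∧ H u = m • u ∧
      (∀ v, m * ‖v‖ ^ 2 ≤ inner ℝ v (H v)) ∧
      ∀ η, 0 ≤ η → η * ‖H‖ ≤ 1 → ∀ v, ‖v - η • H v‖ ≤ (1 - η * m) * ‖v‖ := by
  have hn : Module.finrank ℝ (Vec d) = d := by simp
  obtain ⟨j, hj⟩ := hH.exists_eigenvalues_eq hn hlam
  simp only [RCLike.ofReal_real_eq_id, id] at hj
  obtain ⟨i, -, hi⟩ := Finset.exists_min_image Finset.univ (hH.eigenvalues hn) ⟨j, by simp⟩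
  set b := hH.eigenvectorBasis hn
  set l := hH.eigenvalues hn
  have hb : ∀ k, H (b k) = l k • b k := fun k => hH.apply_eigenvectorBasis hn k
  have hrepr : ∀ v k, b.repr (H v) k = l k * b.repr v k := fun v k =>
    hH.eigenvectorBasis_apply_self_apply hn v k
  have hnorm : ∀ v, ‖v‖ ^ 2 = ∑ k, b.repr v k ^ 2 := fun v => by
    rw [← b.repr.norm_map v, EuclideanSpace.real_norm_sq_eq]
  refine ⟨l i, b i, hj ▸ hi j (by simp), b.norm_eq_one i, hb i, fun v => ?_, fun η h0 h1 v => ?_⟩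
  · rw [← b.repr.inner_map_map, hnorm, PiLp.inner_apply, Finset.mul_sum]
    refine Finset.sum_le_sum fun k _ => ?_
    rw [hrepr]
    have := mul_le_mul_of_nonneg_right (hi k (by simp)) (sq_nonneg (b.repr v k))
    simp only [RCLike.inner_apply, conj_trivial]
    linarith
  · have hl : ∀ k, l k ≤ ‖H‖ := fun k => by
      have := H.le_opNorm (b k)
      rw [hb, norm_smul, b.norm_eq_one, mul_one, mul_one] at this
      exact (le_abs_self _).trans this
    have h2 : ∀ k, 0 ≤ 1 - η * l k := fun k => by
      nlinarith [mul_le_mul_of_nonneg_left (hl k) h0]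
    refine abs_le_of_sq_le_sq' ?_ (mul_nonneg (h2 i) (norm_nonneg v)) |>.2
    rw [mul_pow, hnorm, hnorm, Finset.mul_sum]
    refine Finset.sum_le_sum fun k _ => ?_
    have : b.repr (v - η • H v) k = (1 - η * l k) * b.repr v k := by
      simp only [map_sub, map_smul, PiLp.sub_apply, PiLp.smul_apply, hrepr, smul_eq_mul]
      ring
    rw [this, mul_pow]
    refine mul_le_mul_of_nonneg_right (pow_le_pow_left₀ (h2 k) ?_ 2) (sq_nonneg _)
    nlinarith [mul_le_mul_of_nonneg_left (hi k (by simp)) h0]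

/-- In terms of the quadratic form, second-order stationarity is an intersection of closed
conditions, from which measurability follows. -/
lemma isSOSP_iff (hf : SmoothObjective f fmax L ρ) {ε : ℝ} {x : Vec d} :
    IsSOSP f ρ ε x ↔
      ‖∇ f x‖ ≤ ε ∧ ∀ v, -√(ρ * ε) * ‖v‖ ^ 2 ≤ inner ℝ v (hessian f x v) := by
  refine and_congr_right fun _ => ⟨fun h v => ?_, fun h lam hlam => ?_⟩
  · rcases eq_or_ne v 0 with rfl | hv
    · simp
    have : Nontrivial (Vec d) := ⟨v, 0, hv⟩
    obtain ⟨m, u, -, hu, hmu, hm, -⟩ := exists_min_eigenvalue (hf.isSymmetric_hessian x)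
      (hf.isSymmetric_hessian x).hasEigenvalue_iInf_of_finiteDimensional
    have hm' : Module.End.HasEigenvalue (hessian f x : Vec d →ₗ[ℝ] Vec d) m :=
      Module.End.hasEigenvalue_of_hasEigenvector (x := u)
        (Module.End.hasEigenvector_iff.2
          ⟨Module.End.mem_eigenspace_iff.2 hmu, by rintro rfl; simp at hu⟩)
    exact (mul_le_mul_of_nonneg_right (h m hm') (sq_nonneg _)).trans (hm v)
  · obtain ⟨u, hu⟩ := hlam.exists_hasEigenvector
    have h1 := h u
    have h2 : hessian f x u = lam • u := hu.apply_eq_smul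
    rw [h2, inner_smul_right, real_inner_self_eq_norm_sq] at h1
    exact le_of_mul_le_mul_right h1 (by have := norm_pos_iff.2 hu.2; positivity)

lemma measurableSet_isSOSP (hf : SmoothObjective f fmax L ρ) (ε : ℝ) :
    MeasurableSet {x | IsSOSP f ρ ε x} := by
  simp only [isSOSP_iff hf]
  have h1 : IsClosed {x | ‖∇ f x‖ ≤ ε} :=
    isClosed_le hf.continuous_gradient.norm continuous_const
  have h2 : IsClosed {x | ∀ v, -√(ρ * ε) * ‖v‖ ^ 2 ≤ inner ℝ v (hessian f x v)} := by
    simp only [Set.ofPred_forall]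
    refine isClosed_iInter fun v => isClosed_le continuous_const ?_
    exact continuous_const.inner (hf.continuous_hessian.clm_apply continuous_const)
  exact (h1.inter h2).measurableSet

/-- At a point with a small gradient that is not an `ε`-SOSP, the Hessian has a most negative
eigenvalue `-γ` below `-√(ρ ε)`. -/
lemma exists_negative_curvature (hf : SmoothObjective f fmax L ρ) (hL : 0 ≤ L) {ε : ℝ} {x : Vec d}
    (hx : ¬ IsSOSP f ρ ε x) (hg : ‖∇ f x‖ ≤ ε) :
    ∃ (γ : ℝ) (u : Vec d), √(ρ * ε) < γ ∧ γ ≤ L ∧ ‖u‖ = 1 ∧ hessian f x u = -γ • u ∧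
      ∀ η, 0 ≤ η → η * L ≤ 1 → ∀ v, ‖v - η • hessian f x v‖ ≤ (1 + η * γ) * ‖v‖ := by
  simp only [IsSOSP, hg, true_and, not_forall, not_le] at hx
  obtain ⟨lam, hlam, hlt⟩ := hx
  obtain ⟨m, u, hm, hu, hmu, -, h⟩ := exists_min_eigenvalue (hf.isSymmetric_hessian x) hlam
  have hH := hf.norm_hessian_le hL x
  refine ⟨-m, u, by linarith, ?_, hu, by simpa using hmu, fun η h0 h1 v => ?_⟩
  · have := (hessian f x).le_opNorm u
    rw [hmu, norm_smul, hu, mul_one, mul_one] at this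
    exact (neg_le_abs m).trans (this.trans hH)
  · have := h η h0 ((mul_le_mul_of_nonneg_left hH h0).trans h1) v
    rwa [mul_neg, ← sub_eq_add_neg]

end Objective

/-! ### The corrected iterate, the error recursion and the descent inequality. -/

section Energy

lemma norm_add_sq_le_young {E : Type*} [SeminormedAddCommGroup E] (A B : E) {τ : ℝ}
    (hτ : 0 < τ) :
    ‖A + B‖ ^ 2 ≤ (1 + τ) * ‖A‖ ^ 2 + (1 + τ⁻¹) * ‖B‖ ^ 2 := by
  have h1 : ‖A + B‖ ^ 2 ≤ (‖A‖ + ‖B‖) ^ 2 := by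
    gcongr; exact norm_add_le A B
  have h2 : 0 ≤ τ⁻¹ * (τ * ‖A‖ - ‖B‖) ^ 2 := by positivity
  have h3 : τ⁻¹ * (τ * ‖A‖ - ‖B‖) ^ 2 = τ * ‖A‖ ^ 2 - 2 * ‖A‖ * ‖B‖ + τ⁻¹ * ‖B‖ ^ 2 := by
    field_simp
    ring
  nlinarith

lemma norm_add_sq_le_two {E : Type*} [SeminormedAddCommGroup E] (A B : E) :
    ‖A + B‖ ^ 2 ≤ 2 * ‖A‖ ^ 2 + 2 * ‖B‖ ^ 2 := by
  have := norm_add_sq_le_young A B one_pos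
  norm_num at this
  exact this

lemma norm_add_add_sq_le {E : Type*} [SeminormedAddCommGroup E] (A B C : E) :
    ‖A + B + C‖ ^ 2 ≤ 3 * (‖A‖ ^ 2 + ‖B‖ ^ 2 + ‖C‖ ^ 2) := by
  have h : ‖A + B + C‖ ^ 2 ≤ (‖A‖ + ‖B‖ + ‖C‖) ^ 2 := by
    gcongr; exact norm_add₃_le
  nlinarith [sq_nonneg (‖A‖ - ‖B‖), sq_nonneg (‖B‖ - ‖C‖), sq_nonneg (‖A‖ - ‖C‖)]

/-- Young's inequality for a vector that has been compressed, with `B` entering unscaled. -/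
lemma one_sub_mul_norm_add_sq_le {E : Type*} [SeminormedAddCommGroup E] (A B : E) {μ : ℝ}
    (hμ0 : 0 < μ) (hμ1 : μ ≤ 1) :
    (1 - μ) * ‖A + B‖ ^ 2 ≤ (1 - μ / 2) * ‖A‖ ^ 2 + 3 / μ * ‖B‖ ^ 2 := by
  have h := mul_le_mul_of_nonneg_left (norm_add_sq_le_young A B (half_pos hμ0)) (sub_nonneg.2 hμ1)
  have h1 : (1 - μ) * (1 + μ / 2) ≤ 1 - μ / 2 := by nlinarith
  have h2 : (1 - μ) * (1 + (μ / 2)⁻¹) ≤ 3 / μ := by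
    rw [inv_div, le_div_iff₀ hμ0]
    have : (1 - μ) * (1 + 2 / μ) * μ = (1 - μ) * (μ + 2) := by field_simp
    rw [this]; nlinarith
  nlinarith [mul_le_mul_of_nonneg_right h1 (sq_nonneg ‖A‖),
    mul_le_mul_of_nonneg_right h2 (sq_nonneg ‖B‖)]

variable {d : ℕ} {Θ : Type u} [MeasurableSpace Θ] {D : Measure Θ}
  {r : ℝ} {ν : PMF (Finset (Fin d))} {f : Vec d → ℝ} {G : Vec d → Θ → Vec d}
  {η μ σ fmax L ρ : ℝ}

/-- The iterate corrected by the accumulated compression error, which follows uncompressed SGD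
with gradients taken at the uncorrected iterate. -/
def corrected (η : ℝ) (s : Vec d × Vec d) : Vec d := s.1 - η • s.2

/-- What the compressor withholds from the iterate it adds to the error, so it cancels in `x - η •
e`. -/
lemma corrected_sgdStep {Θ : Type*} (G : Vec d → Θ → Vec d) (η : ℝ) (s : Vec d × Vec d)
    (z : Θ × Vec d × Finset (Fin d)) :
    corrected η (sgdStep G η s z) = corrected η s - η • (G s.1 z.1 + z.2.1) := by
  simp only [corrected, sgdStep]
  module

lemma measurable_corrected (η : ℝ) : Measurable (corrected (d := d) η) := by
  unfold corrected; fun_prop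

namespace StochasticOracle

lemma measurable_apply (hG : StochasticOracle D f G σ) (x : Vec d) : Measurable (G x) :=
  hG.measurable.comp measurable_prodMk_left

lemma integrable_sub [IsProbabilityMeasure D] (hG : StochasticOracle D f G σ) (x : Vec d) :
    Integrable (fun θ => G x θ - ∇ f x) D :=
  (hG.unbiased x).1.sub (integrable_const _)

lemma integral_sub_eq_zero [IsProbabilityMeasure D] (hG : StochasticOracle D f G σ) (x : Vec d) :
    ∫ θ, (G x θ - ∇ f x) ∂D = 0 := by
  rw [integral_sub (hG.unbiased x).1 (integrable_const _), (hG.unbiased x).2]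
  simp

lemma lintegral_sub_sq_le (hG : StochasticOracle D f G σ) (x : Vec d) :
    ∫⁻ θ, ENNReal.ofReal (‖G x θ - ∇ f x‖ ^ 2) ∂D ≤ ENNReal.ofReal (σ ^ 2) := by
  simpa [ENNReal.ofReal_pow, ofReal_norm] using hG.variance_le x

end StochasticOracle

lemma integral_smul_noise_eq_zero (c : ℝ) : ∫ ξ, c • ξ ∂(noiseLaw d r) = 0 := by
  rw [integral_smul, integral_noiseLaw, smul_zero]

lemma integrable_noise : Integrable (fun ξ => ξ) (noiseLaw d r) :=
  (memLp_noiseLaw r).integrable (by norm_num)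

lemma lintegral_smul_sq_le {Ω E : Type*} [MeasurableSpace Ω] {P : Measure Ω}
    [NormedAddCommGroup E] [NormedSpace ℝ E]
    {X : Ω → E} {s : ℝ} (c : ℝ)
    (hs' : ∫⁻ ω, ENNReal.ofReal (‖X ω‖ ^ 2) ∂P ≤ ENNReal.ofReal s) :
    ∫⁻ ω, ENNReal.ofReal (‖c • X ω‖ ^ 2) ∂P ≤ ENNReal.ofReal (c ^ 2 * s) := by
  simp only [norm_smul, mul_pow, ENNReal.ofReal_mul (sq_nonneg _), Real.norm_eq_abs, sq_abs]
  rw [lintegral_const_mul' _ _ ENNReal.ofReal_ne_top]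
  gcongr

/-- Second moment of a vector to which a multiple of the noise of one iteration is added. -/
lemma lintegral_add_smul_noise_sq_le [IsProbabilityMeasure D] (hd : 0 < d)
    (hG : StochasticOracle D f G σ) (x u : Vec d)
    (c : ℝ) :
    ∫⁻ z, ENNReal.ofReal (‖u + c • (G x z.1 - ∇ f x) + c • z.2.1‖ ^ 2) ∂(stepLaw D r ν) ≤
      ENNReal.ofReal (‖u‖ ^ 2 + c ^ 2 * σ ^ 2 + c ^ 2 * r ^ 2) := by
  have hm := hG.measurable_apply x
  refine lintegral_stepLaw_sq_le (N := fun θ => c • (G x θ - ∇ f x)) (Ξ := fun ξ => c • ξ)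
    (by fun_prop) (by fun_prop) ((hG.integrable_sub x).smul c) ?_ (integrable_noise.smul c)
    (integral_smul_noise_eq_zero c) (by positivity) (by positivity)
    (lintegral_smul_sq_le c (hG.lintegral_sub_sq_le x))
    (lintegral_smul_sq_le c (lintegral_norm_sq_noiseLaw hd r).le) u
  rw [integral_smul, hG.integral_sub_eq_zero, smul_zero]

lemma lintegral_corrected_sub_sq_le [IsProbabilityMeasure D] (hd : 0 < d)
    (hG : StochasticOracle D f G σ)
    (s : Vec d × Vec d) (y₀ : Vec d) {τ : ℝ} (hτ : 0 < τ) :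
    ∫⁻ z, ENNReal.ofReal (‖corrected η (sgdStep G η s z) - y₀‖ ^ 2) ∂(stepLaw D r ν) ≤
      ENNReal.ofReal ((1 + τ) * ‖corrected η s - y₀‖ ^ 2 + (1 + τ⁻¹) * η ^ 2 * ‖∇ f s.1‖ ^ 2 +
        η ^ 2 * (σ ^ 2 + r ^ 2)) := by
  have h := lintegral_add_smul_noise_sq_le (r := r) (ν := ν) hd hG s.1
    (corrected η s - y₀ + (-η) • ∇ f s.1) (-η)
  refine le_trans (le_of_eq ?_) (h.trans (ENNReal.ofReal_le_ofReal ?_))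
  · refine lintegral_congr fun z => ?_
    rw [corrected_sgdStep]
    congr 3
    module
  · have := norm_add_sq_le_young (corrected η s - y₀) ((-η) • ∇ f s.1) hτ
    rw [norm_smul, mul_pow, Real.norm_eq_abs, sq_abs] at this
    nlinarith

/-- Half of the contraction by `1 - μ` is spent on Young's inequality, which puts the factor `3 / μ`
on the gradient. The centred noises have no cross terms and enter without such a factor. -/
lemma lintegral_error_sq_le [IsProbabilityMeasure D] (hd : 0 < d)
    (hG : StochasticOracle D f G σ) (hν : IsCompressor ν μ)
    (hμ0 : 0 < μ) (hμ1 : μ ≤ 1) (s : Vec d × Vec d) :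
    ∫⁻ z, ENNReal.ofReal (‖(sgdStep G η s z).2‖ ^ 2) ∂(stepLaw D r ν) ≤
      ENNReal.ofReal ((1 - μ / 2) * ‖s.2‖ ^ 2 + 3 / μ * ‖∇ f s.1‖ ^ 2 + (σ ^ 2 + r ^ 2)) := by
  have hm := hG.measurable_apply s.1
  have h := lintegral_stepLaw_compress_le (D := D) (r := r) (v := fun θ ξ => s.2 + G s.1 θ + ξ) hν
    hμ1 (by unfold Function.uncurry; fun_prop)
  refine h.trans ?_
  have h2 := lintegral_add_smul_noise_sq_le (r := r) (ν := ν) hd hG s.1 (s.2 + ∇ f s.1) 1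
  have h3 : ∀ z : Θ × Vec d × Finset (Fin d), s.2 + ∇ f s.1 + (1 : ℝ) • (G s.1 z.1 - ∇ f s.1) +
      (1 : ℝ) • z.2.1 = s.2 + G s.1 z.1 + z.2.1 := fun z => by module
  simp only [h3] at h2
  refine (mul_le_mul_right h2 _).trans ?_
  rw [← ENNReal.ofReal_mul (by linarith)]
  refine ENNReal.ofReal_le_ofReal ?_
  have h4 := one_sub_mul_norm_add_sq_le s.2 (∇ f s.1) hμ0 hμ1
  nlinarith [mul_nonneg hμ0.le (add_nonneg (sq_nonneg σ) (sq_nonneg r))]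

/-- Expected decrease of the objective at the corrected iterate. -/
lemma lintegral_descent_le [IsProbabilityMeasure D] (hd : 0 < d)
    (hf : SmoothObjective f fmax L ρ) (hL : 0 ≤ L)
    (hG : StochasticOracle D f G σ) (hη : 0 ≤ η) (hηL : 4 * (η * L) ≤ 1) {c : ℝ}
    (hc : ∀ x, c ≤ f x) (s : Vec d × Vec d) :
    ∫⁻ z, ENNReal.ofReal (f (corrected η (sgdStep G η s z)) - c) ∂(stepLaw D r ν) +
        ENNReal.ofReal (η / 4 * ‖∇ f s.1‖ ^ 2) ≤
      ENNReal.ofReal (f (corrected η s) - c + η / 2 * (L ^ 2 * η ^ 2 * ‖s.2‖ ^ 2) +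
        L * η ^ 2 * (σ ^ 2 + r ^ 2)) := by
  set y := corrected η s with hy
  set g := ∇ f s.1 with hg
  set u : Θ × Vec d × Finset (Fin d) → Vec d := fun z => G s.1 z.1 + z.2.1 with hu
  have hm := hG.measurable_apply s.1
  have hum : Measurable u := by fun_prop
  have h1i : Integrable (fun z : Θ × Vec d × Finset (Fin d) => G s.1 z.1) (stepLaw D r ν) :=
    (hG.unbiased s.1).1.comp_fst _
  have h2i' : Integrable (fun w : Vec d × Finset (Fin d) => w.1)
    ((noiseLaw d r).prod ν.toMeasure) := integrable_noise.comp_fst _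
  have h2i : Integrable (fun z : Θ × Vec d × Finset (Fin d) => z.2.1) (stepLaw D r ν) :=
    h2i'.comp_snd _
  have hui : Integrable u (stepLaw D r ν) := h1i.add h2i
  have hu0 : ∫ z, u z ∂(stepLaw D r ν) = g := by
    rw [hu, integral_add h1i h2i, stepLaw, integral_fun_fst, (hG.unbiased s.1).2,
      integral_fun_snd fun w : Vec d × Finset (Fin d) => w.1, integral_fun_fst fun ξ : Vec d => ξ,
      integral_noiseLaw]
    simp [hg]
  have hsq : ∫⁻ z, ENNReal.ofReal (‖u z‖ ^ 2) ∂(stepLaw D r ν) ≤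
      ENNReal.ofReal (‖g‖ ^ 2 + σ ^ 2 + r ^ 2) := by
    have h2 := lintegral_add_smul_noise_sq_le (r := r) (ν := ν) hd hG s.1 g 1
    have h3 : ∀ z : Θ × Vec d × Finset (Fin d), g + (1 : ℝ) • (G s.1 z.1 - ∇ f s.1) +
        (1 : ℝ) • z.2.1 = u z := fun z => by simp only [hu, hg]; module
    simp only [h3] at h2
    simpa using h2
  have hsi : Integrable (fun z => ‖u z‖ ^ 2) (stepLaw D r ν) := by
    refine ⟨by fun_prop, ?_⟩
    rw [hasFiniteIntegral_iff_ofReal (ae_of_all _ fun _ => by positivity)]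
    exact hsq.trans_lt ENNReal.ofReal_lt_top
  rw [← ofReal_integral_eq_lintegral_ofReal hsi (ae_of_all _ fun _ => by positivity),
    ENNReal.ofReal_le_ofReal_iff (by positivity)] at hsq
  have hin : Integrable (fun z => inner ℝ (∇ f y) (u z)) (stepLaw D r ν) := hui.const_inner _
  set B : Θ × Vec d × Finset (Fin d) → ℝ := fun z =>
    f y - c - η * inner ℝ (∇ f y) (u z) + L * η ^ 2 * ‖u z‖ ^ 2 with hB
  have hBi1 : Integrable (fun z => f y - c - η * inner ℝ (∇ f y) (u z)) (stepLaw D r ν) :=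
    (integrable_const _).sub (hin.const_mul η)
  have hBi : Integrable B (stepLaw D r ν) := hBi1.add (hsi.const_mul _)
  have hFB : ∀ z, f (corrected η (sgdStep G η s z)) - c ≤ B z := fun z => by
    rw [corrected_sgdStep, sub_eq_add_neg (corrected η s)]
    have h := (abs_le.1 (hf.taylor_one hL y (-(η • u z)))).2
    rw [norm_neg, norm_smul, inner_neg_right, inner_smul_right, mul_pow, Real.norm_eq_abs,
      sq_abs] at h
    simp only [hB]
    linarith
  have hB0 : ∀ z, 0 ≤ B z := fun z => (sub_nonneg.2 (hc _)).trans (hFB z)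
  have hint : ∫ z, B z ∂(stepLaw D r ν) =
      f y - c - η * inner ℝ (∇ f y) g + L * η ^ 2 * ∫ z, ‖u z‖ ^ 2 ∂(stepLaw D r ν) := by
    rw [hB, integral_add hBi1 (hsi.const_mul _),
      integral_sub (integrable_const _) (hin.const_mul η), integral_const_mul, integral_const_mul,
      integral_inner hui, hu0]
    simp
  have hle : ∫⁻ z, ENNReal.ofReal (f (corrected η (sgdStep G η s z)) - c) ∂(stepLaw D r ν) ≤
      ENNReal.ofReal (∫ z, B z ∂(stepLaw D r ν)) := by
    rw [ofReal_integral_eq_lintegral_ofReal hBi (ae_of_all _ hB0)]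
    exact lintegral_mono fun z => ENNReal.ofReal_le_ofReal (hFB z)
  refine (add_le_add_left hle _).trans ?_
  rw [← ENNReal.ofReal_add (integral_nonneg hB0) (by positivity)]
  refine ENNReal.ofReal_le_ofReal ?_
  rw [hint]
  have hyg : ‖∇ f y - g‖ ≤ L * (η * ‖s.2‖) := by
    have := hf.smooth y s.1
    rwa [hy, corrected, sub_sub_cancel_left, norm_neg, norm_smul, Real.norm_of_nonneg hη] at this
  -- The gradient step is taken at `x`, not at `y`; by smoothness the two gradients differ by at
  -- most `L η ‖e‖`, so half of `‖g‖²` survives in the descent term.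
  have hin2 : ‖g‖ ^ 2 - inner ℝ (∇ f y) g ≤ ‖g‖ ^ 2 / 2 + (L * (η * ‖s.2‖)) ^ 2 / 2 := by
    have h := neg_le_of_abs_le (abs_real_inner_le_norm (∇ f y - g) g)
    rw [inner_sub_left, real_inner_self_eq_norm_sq] at h
    nlinarith [mul_le_mul_of_nonneg_right hyg (norm_nonneg g),
      sq_nonneg (‖g‖ - L * (η * ‖s.2‖))]
  have h5 : L * η ^ 2 * ∫ z, ‖u z‖ ^ 2 ∂(stepLaw D r ν) ≤
      L * η ^ 2 * (‖g‖ ^ 2 + σ ^ 2 + r ^ 2) := by gcongr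
  have h6 : L * η ^ 2 * ‖g‖ ^ 2 ≤ η / 4 * ‖g‖ ^ 2 := by
    refine mul_le_mul_of_nonneg_right ?_ (sq_nonneg _)
    nlinarith
  have h7 := mul_le_mul_of_nonneg_left hin2 hη
  nlinarith

end Energy

/-! ### Average squared gradient and compression error. -/

section FirstOrder

variable {d : ℕ} {Θ : Type u} [MeasurableSpace Θ] {D : Measure Θ}
  {r : ℝ} {ν : PMF (Finset (Fin d))} {f : Vec d → ℝ} {G : Vec d → Θ → Vec d}
  {η μ σ fmax L ρ : ℝ}

/-- The law of the iterate and the compression error after `t` iterations from the state `s`. -/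
def sgdLaw (D : Measure Θ) (r : ℝ) (ν : PMF (Finset (Fin d))) (G : Vec d → Θ → Vec d) (η : ℝ)
    (s : Vec d × Vec d) (t : ℕ) : Measure (Vec d × Vec d) :=
  chainLaw (stepLaw D r ν) (sgdStep G η) (Measure.dirac s) t

/-- The Foster–Lyapunov argument: integrated along the chain, the drift condition telescopes. It is
stated with sums only, since subtraction in `ℝ≥0∞` truncates. -/
lemma sum_lintegral_le_of_drift {X Z : Type*} [MeasurableSpace X] [MeasurableSpace Z]
    {P : Measure Z} [IsProbabilityMeasure P] {step : X → Z → X} {m : Measure X}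
    [IsProbabilityMeasure m]
    (hstep : Measurable (Function.uncurry step)) {W h : X → ℝ≥0∞} (hW : Measurable W)
    (hh : Measurable h) {c : ℝ≥0∞} (hdrift : ∀ x, ∫⁻ z, W (step x z) ∂P + h x ≤ W x + c) (n : ℕ) :
    ∫⁻ x, W x ∂(chainLaw P step m n) + ∑ t ∈ Finset.range n, ∫⁻ x, h x ∂(chainLaw P step m t) ≤
      ∫⁻ x, W x ∂m + n * c := by
  induction n with
  | zero => simp [chainLaw]
  | succ n ih =>
    have := chainLaw_isProbabilityMeasure (μ := P) (m := m) hstep n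
    rw [lintegral_chainLaw_succ hstep n hW, Finset.sum_range_succ]
    calc ∫⁻ x, ∫⁻ z, W (step x z) ∂P ∂(chainLaw P step m n) +
          (∑ t ∈ Finset.range n, ∫⁻ x, h x ∂(chainLaw P step m t) +
            ∫⁻ x, h x ∂(chainLaw P step m n))
        = ∫⁻ x, (∫⁻ z, W (step x z) ∂P + h x) ∂(chainLaw P step m n) +
          ∑ t ∈ Finset.range n, ∫⁻ x, h x ∂(chainLaw P step m t) := by
          rw [lintegral_add_right _ hh]; ring
      _ ≤ ∫⁻ x, (W x + c) ∂(chainLaw P step m n) +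
          ∑ t ∈ Finset.range n, ∫⁻ x, h x ∂(chainLaw P step m t) := by
          exact add_le_add (lintegral_mono fun x => hdrift x) le_rfl
      _ = (∫⁻ x, W x ∂(chainLaw P step m n) +
          ∑ t ∈ Finset.range n, ∫⁻ x, h x ∂(chainLaw P step m t)) + c := by
          rw [lintegral_add_right _ measurable_const]; simp; ring
      _ ≤ _ := by
          grw [ih]; push_cast; rw [add_mul, one_mul, add_assoc]

/-- The average squared gradient norm and the average squared compression error. -/
lemma sum_lintegral_gradient_le [IsProbabilityMeasure D] (hd : 0 < d)
    (hf : SmoothObjective f fmax L ρ) (hfmax : 0 ≤ fmax)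
    (hL : 0 ≤ L) (hG : StochasticOracle D f G σ) (hν : IsCompressor ν μ) (hμ0 : 0 < μ)
    (hμ1 : μ ≤ 1) (hη : 0 < η) (hηL : 4 * (η * L) ≤ 1) {κ : ℝ} (hκ : L ^ 2 * η ^ 2 ≤ κ)
    (hκμ : 48 * κ ≤ μ ^ 2) (x₀ : Vec d) (T : ℕ) :
    ∑ t ∈ Finset.range T, ∫⁻ s, ENNReal.ofReal (‖∇ f s.1‖ ^ 2 + 4 * κ * ‖s.2‖ ^ 2)
        ∂(sgdLaw D r ν G η (x₀, 0) t) ≤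
      ENNReal.ofReal (8 * (fmax / η + T * ((σ ^ 2 + r ^ 2) * (L * η + 2 * κ / μ)))) := by
  have hκ0 : 0 ≤ κ := le_trans (by positivity) hκ
  set c := f x₀ - fmax with hc
  have hc' : ∀ x, c ≤ f x := fun x => by
    have := (abs_le.1 (hf.bounded x₀ x)).2; simp only [hc]; linarith
  -- With this weight, the contraction of the error by `μ / 2` yields `η κ ‖e‖²`: one half pays for
  -- the error term of the descent inequality, the other half is the `4 κ ‖e‖²` of the claim. The
  -- price on the gradient, `β · 3 / μ = 6 κ / μ²`, is at most `1 / 8` because `48 κ ≤ μ²`.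
  set β := 2 * κ / μ with hβ
  have hβ0 : 0 ≤ β := by positivity
  have hβμ : β * μ = 2 * κ := by rw [hβ]; field_simp
  have hfm : Measurable f := hf.differentiable.continuous.measurable
  have hgm : Measurable (∇ f) := hf.continuous_gradient.measurable
  have hym := measurable_corrected (d := d) η
  have hstep := measurable_sgdStep (η := η) hG.measurable
  set V := σ ^ 2 + r ^ 2 with hV
  set W : Vec d × Vec d → ℝ≥0∞ := fun s =>
    ENNReal.ofReal (f (corrected η s) - c) + ENNReal.ofReal (η * β) * ENNReal.ofReal (‖s.2‖ ^ 2)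
    with hW
  have hWm : Measurable W := by fun_prop
  have hdrift : ∀ s, ∫⁻ z, W (sgdStep G η s z) ∂(stepLaw D r ν) +
      ENNReal.ofReal (η / 8 * (‖∇ f s.1‖ ^ 2 + 4 * κ * ‖s.2‖ ^ 2)) ≤
      W s + ENNReal.ofReal (η * (V * (L * η + β))) := by
    intro s
    have h1 := lintegral_descent_le (r := r) (ν := ν) hd hf hL hG hη.le hηL hc' s
    have h2 := lintegral_error_sq_le (r := r) (η := η) hd hG hν hμ0 hμ1 s
    have hzm : Measurable fun z => sgdStep G η s z := hstep.comp measurable_prodMk_left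
    simp only [hW]
    have hzf : Measurable fun z => ENNReal.ofReal (f (corrected η (sgdStep G η s z)) - c) :=
      ((hfm.comp (hym.comp hzm)).sub_const c).ennreal_ofReal
    rw [lintegral_add_left hzf, lintegral_const_mul _ (hzm.snd.norm.pow_const 2).ennreal_ofReal]
    rw [← ENNReal.ofReal_mul (by positivity), ← ENNReal.ofReal_add
      (sub_nonneg.2 (hc' _)) (by positivity), ← ENNReal.ofReal_add
      (add_nonneg (sub_nonneg.2 (hc' _)) (by positivity)) (by positivity)]
    have h3 : 0 ≤ (1 - μ / 2) * ‖s.2‖ ^ 2 + 3 / μ * ‖∇ f s.1‖ ^ 2 + V := by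
      have : 0 ≤ 1 - μ / 2 := by linarith
      positivity
    -- Adding `η / 8 · ‖∇f‖²` to both sides replaces the subtraction by which the gradient cost of
    -- the error recursion is absorbed into the descent.
    have hsplit : ENNReal.ofReal (η / 8 * (‖∇ f s.1‖ ^ 2 + 4 * κ * ‖s.2‖ ^ 2)) +
        ENNReal.ofReal (η / 8 * ‖∇ f s.1‖ ^ 2) =
        ENNReal.ofReal (η / 4 * ‖∇ f s.1‖ ^ 2) + ENNReal.ofReal (η / 2 * (κ * ‖s.2‖ ^ 2)) := by
      rw [← ENNReal.ofReal_add (by positivity) (by positivity),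
        ← ENNReal.ofReal_add (by positivity) (by positivity)]
      congr 1; ring
    have hfin : ENNReal.ofReal (η / 8 * ‖∇ f s.1‖ ^ 2) ≠ ∞ := ENNReal.ofReal_ne_top
    refine (ENNReal.add_le_add_iff_right hfin).1 ?_
    rw [add_assoc, hsplit, ← add_assoc, add_right_comm (∫⁻ _, _ ∂_) _ (ENNReal.ofReal (η / 4 * _))]
    grw [h1, h2]
    have hpos : 0 ≤ f (corrected η s) - c := sub_nonneg.2 (hc' _)
    rw [← ENNReal.ofReal_mul (by positivity), ← ENNReal.ofReal_add (by positivity) (by positivity),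
      ← ENNReal.ofReal_add (by positivity) (by positivity),
      ← ENNReal.ofReal_add (by positivity) (by positivity)]
    refine ENNReal.ofReal_le_ofReal ?_
    have h4 : β * (3 / μ) ≤ 1 / 8 := by
      rw [hβ, div_mul_div_comm, div_le_iff₀ (by positivity)]
      linarith
    have h5 := mul_le_mul_of_nonneg_left h4 (show 0 ≤ η * ‖∇ f s.1‖ ^ 2 by positivity)
    have h6 := mul_le_mul_of_nonneg_left hκ (show 0 ≤ η / 2 * ‖s.2‖ ^ 2 by positivity)
    have h7 : η * β * (μ / 2) * ‖s.2‖ ^ 2 = η * κ * ‖s.2‖ ^ 2 := by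
      rw [show η * β * (μ / 2) = η * (β * μ) / 2 by ring, hβμ]; ring
    nlinarith
  have h := sum_lintegral_le_of_drift (m := Measure.dirac (x₀, (0 : Vec d))) hstep hWm
    (by fun_prop) hdrift T
  have h0 : ∫⁻ s, W s ∂(Measure.dirac (x₀, (0 : Vec d))) = ENNReal.ofReal fmax := by
    rw [lintegral_dirac' _ hWm]
    simp [hW, corrected, hc]
  rw [h0] at h
  have h' := le_trans (le_add_self) h
  have hη8 : ∀ t, ∫⁻ s, ENNReal.ofReal (η / 8 * (‖∇ f s.1‖ ^ 2 + 4 * κ * ‖s.2‖ ^ 2))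
      ∂(chainLaw (stepLaw D r ν) (sgdStep G η) (Measure.dirac (x₀, (0 : Vec d))) t) =
      ENNReal.ofReal (η / 8) * ∫⁻ s, ENNReal.ofReal (‖∇ f s.1‖ ^ 2 + 4 * κ * ‖s.2‖ ^ 2)
        ∂(sgdLaw D r ν G η (x₀, 0) t) := fun t => by
    rw [← lintegral_const_mul _ (by fun_prop), sgdLaw]
    simp only [ENNReal.ofReal_mul (show 0 ≤ η / 8 by positivity)]
  simp only [hη8] at h'
  rw [← Finset.mul_sum] at h'
  have hη80 : ENNReal.ofReal (η / 8) ≠ 0 := by simpa using hη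
  rw [← ENNReal.mul_le_mul_iff_right hη80 ENNReal.ofReal_ne_top]
  refine h'.trans ?_
  rw [← ENNReal.ofReal_mul (by positivity), ← ENNReal.ofReal_natCast, ← ENNReal.ofReal_mul
    (by positivity), ← ENNReal.ofReal_add (by positivity) (by positivity)]
  refine ENNReal.ofReal_le_ofReal (le_of_eq ?_)
  field_simp

end FirstOrder

/-! ### Two runs coupled by reflecting the artificial noise. -/

section Coupling

variable {d : ℕ}

/-- The reflection in the hyperplane orthogonal to `u`. -/
def mirror (u : Vec d) : Vec d ≃ₗᵢ[ℝ] Vec d := (ℝ ∙ u)ᗮ.reflection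

lemma mirror_apply {u : Vec d} (hu : ‖u‖ = 1) (ξ : Vec d) :
    mirror u ξ = ξ - (2 * inner ℝ u ξ) • u := by
  rw [mirror, Submodule.reflection_orthogonal_apply, Submodule.reflection_singleton_apply]
  simp only [hu]
  norm_num
  module

lemma lintegral_inner_sq_noiseLaw (r : ℝ) {u : Vec d} (hu : ‖u‖ = 1) :
    ∫⁻ ξ, ENNReal.ofReal (inner ℝ u ξ ^ 2) ∂(noiseLaw d r) = ENNReal.ofReal (r ^ 2 / d) := by
  have hU : Measurable fun ξ : Vec d => inner ℝ u ξ := by fun_prop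
  rw [← lintegral_map (f := fun x : ℝ => ENNReal.ofReal (x ^ 2)) (by fun_prop) hU,
    map_inner_noiseLaw r hu]
  have hi : Integrable (fun x : ℝ => x ^ 2) (gaussianReal 0 (r ^ 2 / d).toNNReal) :=
    (memLp_id_gaussianReal 2).integrable_sq
  rw [← ofReal_integral_eq_lintegral_ofReal hi (ae_of_all _ fun _ => sq_nonneg _)]
  have := variance_fun_id_gaussianReal (μ := 0) (v := (r ^ 2 / d).toNNReal)
  rw [variance_of_integral_eq_zero (by fun_prop) integral_id_gaussianReal] at this
  rw [this, Real.coe_toNNReal _ (by positivity)]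

lemma integrable_inner_noiseLaw (r : ℝ) (u : Vec d) :
    Integrable (fun ξ => inner ℝ u ξ) (noiseLaw d r) :=
  integrable_noise.const_inner u

lemma integral_inner_noiseLaw (r : ℝ) (u : Vec d) :
    ∫ ξ, inner ℝ u ξ ∂(noiseLaw d r) = 0 := by
  rw [integral_inner integrable_noise, integral_noiseLaw, inner_zero_right]

variable {Θ : Type u} [MeasurableSpace Θ] {D : Measure Θ}
  {r : ℝ} {ν : PMF (Finset (Fin d))} {f : Vec d → ℝ} {G : Vec d → Θ → Vec d}

/-- The randomness of one iteration with its artificial noise reflected along `u`. -/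
def mirrorNoise (u : Vec d) (z : Θ × Vec d × Finset (Fin d)) : Θ × Vec d × Finset (Fin d) :=
  (z.1, mirror u z.2.1, z.2.2)

lemma measurePreserving_mirrorNoise [IsProbabilityMeasure D] (u : Vec d) :
    MeasurePreserving (mirrorNoise u) (stepLaw D r ν) (stepLaw D r ν) :=
  (MeasurePreserving.id D).prod
    ((measurePreserving_noiseLaw r (mirror u)).prod (MeasurePreserving.id _))

/-- The states of two coupled runs and a scalar which follows the linear part of the difference of
their corrected iterates in the direction of the reflection. -/
abbrev Coupled (d : ℕ) : Type := (Vec d × Vec d) × (Vec d × Vec d) × ℝ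

/-- One iteration of two runs whose artificial noises are reflections of each other. -/
def coupledStep (G : Vec d → Θ → Vec d) (η a : ℝ) (u : Vec d) (p : Coupled d)
    (z : Θ × Vec d × Finset (Fin d)) : Coupled d :=
  (sgdStep G η p.1 z, sgdStep G η p.2.1 (mirrorNoise u z), a * p.2.2 - 2 * η * inner ℝ u z.2.1)

lemma measurable_coupledStep (hG : Measurable (Function.uncurry G))
    (η a : ℝ) (u : Vec d) : Measurable (Function.uncurry (coupledStep G η a u)) := by
  have h := measurable_sgdStep (η := η) hG
  have hm : Measurable (mirrorNoise (Θ := Θ) u) := by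
    have := (mirror u).continuous.measurable
    unfold mirrorNoise; fun_prop
  refine Measurable.prodMk (h.comp (measurable_fst.fst.prodMk measurable_snd))
    (Measurable.prodMk (h.comp (measurable_fst.snd.fst.prodMk (hm.comp measurable_snd))) ?_)
  fun_prop

/-- The difference of the corrected iterates of two coupled runs. -/
def gap (η : ℝ) (p : Coupled d) : Vec d := corrected η p.1 - corrected η p.2.1

/-- The difference of the compression errors of two coupled runs, times the step size. -/
def errorGap (η : ℝ) (p : Coupled d) : Vec d := η • (p.1.2 - p.2.1.2)

/-- The difference between the gap and its linear part. -/
def deviation (η : ℝ) (u : Vec d) (p : Coupled d) : Vec d := gap η p - p.2.2 • u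

/-- The energy of the difference of two coupled runs. -/
def gapEnergy (η : ℝ) (u : Vec d) (p : Coupled d) : ℝ :=
  ‖deviation η u p‖ ^ 2 + p.2.2 ^ 2 + ‖errorGap η p‖ ^ 2

lemma iterate_sub_eq (η : ℝ) (u : Vec d) (p : Coupled d) :
    p.1.1 - p.2.1.1 = deviation η u p + p.2.2 • u + errorGap η p := by
  simp only [deviation, gap, errorGap, corrected]
  module

lemma norm_iterate_sub_sq_le (η : ℝ) {u : Vec d} (hu : ‖u‖ = 1) (p : Coupled d) :
    ‖p.1.1 - p.2.1.1‖ ^ 2 ≤ 3 * gapEnergy η u p := by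
  rw [iterate_sub_eq η u, gapEnergy]
  have := norm_add_add_sq_le (deviation η u p) (p.2.2 • u) (errorGap η p)
  rwa [norm_smul, hu, mul_one, Real.norm_eq_abs, sq_abs] at this

lemma gapEnergy_nonneg (η : ℝ) (u : Vec d) (p : Coupled d) : 0 ≤ gapEnergy η u p := by
  unfold gapEnergy; positivity

/-- The two artificial noises differ by `2⟨u, ξ⟩ u`, which the scalar component absorbs exactly;
since `u` is an eigenvector, the factor `1 + η γ` of that component also matches the linear
dynamics. The deviation is thus driven only by the Taylor remainder, the error gap and the
difference of the oracle noises. -/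
lemma deviation_coupledStep {Θ : Type*} (G : Vec d → Θ → Vec d) (η : ℝ) {u : Vec d} (hu : ‖u‖ = 1)
    {γ : ℝ} {H : Vec d →L[ℝ] Vec d} (hH : H u = -γ • u) (p : Coupled d)
    (z : Θ × Vec d × Finset (Fin d)) :
    deviation η u (coupledStep G η (1 + η * γ) u p z) =
      (deviation η u p - η • H (deviation η u p)) +
      (-η) • ((∇ f p.1.1 - ∇ f p.2.1.1 - H (p.1.1 - p.2.1.1)) + H (errorGap η p)) +
      (-η) • ((G p.1.1 z.1 - ∇ f p.1.1) - (G p.2.1.1 z.1 - ∇ f p.2.1.1)) := by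
  rw [iterate_sub_eq η u]
  conv_lhs => rw [deviation, gap]
  simp only [coupledStep, corrected_sgdStep, mirrorNoise, mirror_apply hu, map_add, map_smul, hH]
  conv_lhs => rw [show corrected η p.1 = deviation η u p + p.2.2 • u + corrected η p.2.1 by
    simp only [deviation, gap]; module]
  module

/-- Both runs select the same coordinates and `keep S` is linear, so the difference of their errors
is the compression error of the difference of the compressed vectors. -/
lemma errorGap_coupledStep {Θ : Type*} (G : Vec d → Θ → Vec d) (η : ℝ) {u : Vec d} (hu : ‖u‖ = 1)
    (a : ℝ) (p : Coupled d)
    (z : Θ × Vec d × Finset (Fin d)) :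
    errorGap η (coupledStep G η a u p z) =
      η • ((p.1.2 - p.2.1.2 + (G p.1.1 z.1 - G p.2.1.1 z.1) + (2 * inner ℝ u z.2.1) • u) -
        keep z.2.2 (p.1.2 - p.2.1.2 + (G p.1.1 z.1 - G p.2.1.1 z.1) +
          (2 * inner ℝ u z.2.1) • u)) := by
  have hk : ∀ (S : Finset (Fin d)) (v w : Vec d), keep S (v - w) = keep S v - keep S w := by
    intro S v w
    ext i
    by_cases h : i ∈ S <;> simp [keep, h]
  have h1 : p.1.2 - p.2.1.2 + (G p.1.1 z.1 - G p.2.1.1 z.1) + (2 * inner ℝ u z.2.1) • u =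
      (p.1.2 + G p.1.1 z.1 + z.2.1) -
        (p.2.1.2 + G p.2.1.1 z.1 + (z.2.1 - (2 * inner ℝ u z.2.1) • u)) := by module
  rw [h1, hk]
  simp only [errorGap, coupledStep, sgdStep, mirrorNoise, mirror_apply hu]
  module

end Coupling

/-! ### One-step second moments of the coupled difference. -/

section CoupledEnergy

variable {d : ℕ} {Θ : Type u} [MeasurableSpace Θ] {D : Measure Θ}
  {r : ℝ} {ν : PMF (Finset (Fin d))} {f : Vec d → ℝ} {G : Vec d → Θ → Vec d}
  {η μ σ fmax L ρ ℓ s : ℝ}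

/-- The second moment of the difference of the gradient noises at two points is at most
`ℓ² ‖x - x'‖² + s²`. -/
def NoiseDifferenceBound (D : Measure Θ) (f : Vec d → ℝ) (G : Vec d → Θ → Vec d) (ℓ s : ℝ) : Prop :=
  ∀ x x', ∫⁻ θ, ENNReal.ofReal (‖(G x θ - ∇ f x) - (G x' θ - ∇ f x')‖ ^ 2) ∂D ≤
    ENNReal.ofReal (ℓ ^ 2 * ‖x - x'‖ ^ 2 + s ^ 2)

/-- Without a Lipschitz oracle the noise difference need not vanish as the points merge. The
artificial noise has to dominate it in the single direction `u`, which is why `r²` must then be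
proportional to `d`. -/
lemma StochasticOracle.noiseDifferenceBound [IsProbabilityMeasure D]
    (hG : StochasticOracle D f G σ) : NoiseDifferenceBound D f G 0 (2 * σ) := by
  intro x x'
  have hm := hG.measurable_apply x
  have hm' := hG.measurable_apply x'
  have h1 := lintegral_smul_sq_le 1 (hG.lintegral_sub_sq_le x)
  calc ∫⁻ θ, ENNReal.ofReal (‖(G x θ - ∇ f x) - (G x' θ - ∇ f x')‖ ^ 2) ∂D
      ≤ ∫⁻ θ, (ENNReal.ofReal 2 * ENNReal.ofReal (‖G x θ - ∇ f x‖ ^ 2) +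
          ENNReal.ofReal 2 * ENNReal.ofReal (‖G x' θ - ∇ f x'‖ ^ 2)) ∂D := by
        refine lintegral_mono fun θ => ?_
        rw [← ENNReal.ofReal_mul (by positivity), ← ENNReal.ofReal_mul (by positivity),
          ← ENNReal.ofReal_add (by positivity) (by positivity)]
        refine ENNReal.ofReal_le_ofReal ?_
        rw [sub_eq_add_neg (G x θ - ∇ f x)]
        have := norm_add_sq_le_two (G x θ - ∇ f x) (-(G x' θ - ∇ f x'))
        rwa [norm_neg] at this
    _ ≤ ENNReal.ofReal 2 * ENNReal.ofReal (σ ^ 2) + ENNReal.ofReal 2 * ENNReal.ofReal (σ ^ 2) := by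
        rw [lintegral_add_left (by fun_prop), lintegral_const_mul _ (by fun_prop),
          lintegral_const_mul _ (by fun_prop)]
        gcongr
        · exact hG.lintegral_sub_sq_le x
        · exact hG.lintegral_sub_sq_le x'
    _ = _ := by
        rw [← ENNReal.ofReal_mul (by positivity), ← ENNReal.ofReal_add (by positivity)
          (by positivity)]
        congr 1; ring

/-- Centring does not increase the second moment, so the Lipschitz bound on `G x θ - G x' θ` is
inherited. -/
lemma LipschitzOracle.noiseDifferenceBound [IsProbabilityMeasure D]
    (hG : StochasticOracle D f G σ) (hℓ : 0 ≤ ℓ) (h : LipschitzOracle G (ENNReal.ofReal ℓ)) :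
    NoiseDifferenceBound D f G ℓ 0 := by
  intro x x'
  have hm := hG.measurable_apply x
  have hm' := hG.measurable_apply x'
  set X : Θ → Vec d := fun θ => G x θ - G x' θ with hX
  have hXi : Integrable X D := (hG.unbiased x).1.sub (hG.unbiased x').1
  have hX0 : ∫ θ, X θ ∂D = ∇ f x - ∇ f x' := by
    rw [hX, integral_sub (hG.unbiased x).1 (hG.unbiased x').1, (hG.unbiased x).2,
      (hG.unbiased x').2]
  have hXl : ∀ θ, ‖X θ‖ ≤ ℓ * ‖x - x'‖ := fun θ => by
    have := h θ x x'
    rw [edist_dist, edist_dist, ← ENNReal.ofReal_mul hℓ,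
      ENNReal.ofReal_le_ofReal_iff (by positivity)] at this
    simpa [dist_eq_norm] using this
  have hsq : Integrable (fun θ => ‖X θ‖ ^ 2) D :=
    Integrable.of_bound (by fun_prop) ((ℓ * ‖x - x'‖) ^ 2) (ae_of_all _ fun θ => by
      rw [Real.norm_of_nonneg (by positivity)]
      exact pow_le_pow_left₀ (norm_nonneg _) (hXl θ) 2)
  set m := ∇ f x - ∇ f x' with hm
  have he : ∀ θ, ‖(G x θ - ∇ f x) - (G x' θ - ∇ f x')‖ ^ 2 =
      ‖X θ‖ ^ 2 - 2 * inner ℝ m (X θ) + ‖m‖ ^ 2 := fun θ => by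
    rw [show (G x θ - ∇ f x) - (G x' θ - ∇ f x') = X θ - m by simp only [hX, hm]; abel,
      norm_sub_sq_real, real_inner_comm]
  have hin : Integrable (fun θ => inner ℝ m (X θ)) D := hXi.const_inner m
  have hi1 : Integrable (fun θ => ‖X θ‖ ^ 2 - 2 * inner ℝ m (X θ)) D := hsq.sub (hin.const_mul 2)
  have hi : Integrable (fun θ => ‖(G x θ - ∇ f x) - (G x' θ - ∇ f x')‖ ^ 2) D := by
    simp only [he]; exact hi1.add (integrable_const _)
  rw [← ofReal_integral_eq_lintegral_ofReal hi (ae_of_all _ fun _ => by positivity)]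
  refine ENNReal.ofReal_le_ofReal ?_
  simp only [he]
  rw [integral_add hi1 (integrable_const _), integral_sub hsq (hin.const_mul 2),
    integral_const_mul, integral_inner hXi, hX0, real_inner_self_eq_norm_sq]
  have : ∫ θ, ‖X θ‖ ^ 2 ∂D ≤ ∫ _, (ℓ * ‖x - x'‖) ^ 2 ∂D :=
    integral_mono hsq (integrable_const _) fun θ => pow_le_pow_left₀ (norm_nonneg _) (hXl θ) 2
  simp only [integral_const, probReal_univ, one_smul] at this ⊢
  nlinarith [sq_nonneg ‖m‖]

variable [IsProbabilityMeasure D]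

lemma integrable_noise_sub (hG : StochasticOracle D f G σ) (x x' : Vec d) :
    Integrable (fun θ => (G x θ - ∇ f x) - (G x' θ - ∇ f x')) D :=
  (hG.integrable_sub x).sub (hG.integrable_sub x')

lemma integral_noise_sub (hG : StochasticOracle D f G σ) (x x' : Vec d) :
    ∫ θ, ((G x θ - ∇ f x) - (G x' θ - ∇ f x')) ∂D = 0 := by
  rw [integral_sub (hG.integrable_sub x) (hG.integrable_sub x'), hG.integral_sub_eq_zero,
    hG.integral_sub_eq_zero, sub_zero]

/-- The linear part expands by at most `1 + η γ`, as `-γ` is the least eigenvalue. It is separated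
by Young's inequality from the Taylor remainder, bounded by `ρ R` times the distance of the runs,
and from the Hessian applied to the error gap, which appears because gradients are taken at the
uncorrected iterates. -/
lemma lintegral_deviation_sq_le (hf : SmoothObjective f fmax L ρ) (hL : 0 ≤ L) (hρ : 0 ≤ ρ)
    (hG : StochasticOracle D f G σ) (hdiff : NoiseDifferenceBound D f G ℓ s) {u x₀ : Vec d}
    (hu : ‖u‖ = 1) {γ : ℝ} (hHu : hessian f x₀ u = -γ • u)
    (hH : ∀ v, ‖v - η • hessian f x₀ v‖ ≤ (1 + η * γ) * ‖v‖) {τ R : ℝ} (hτ : 0 < τ)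
    (p : Coupled d) (hp : ‖p.1.1 - x₀‖ ≤ R) (hp' : ‖p.2.1.1 - x₀‖ ≤ R) :
    ∫⁻ z, ENNReal.ofReal (‖deviation η u (coupledStep G η (1 + η * γ) u p z)‖ ^ 2)
        ∂(stepLaw D r ν) ≤
      ENNReal.ofReal ((1 + τ) * (1 + η * γ) ^ 2 * ‖deviation η u p‖ ^ 2 +
        (1 + τ⁻¹) * η ^ 2 * (6 * (ρ * R) ^ 2 * gapEnergy η u p + 2 * L ^ 2 * ‖errorGap η p‖ ^ 2) +
        η ^ 2 * (3 * ℓ ^ 2 * gapEnergy η u p + s ^ 2)) := by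
  set H := hessian f x₀ with hHdef
  set Δ := p.1.1 - p.2.1.1 with hΔ
  set A := deviation η u p - η • H (deviation η u p) with hA
  set B := (∇ f p.1.1 - ∇ f p.2.1.1 - H Δ) + H (errorGap η p) with hB
  have hm := hG.measurable_apply p.1.1
  have hm' := hG.measurable_apply p.2.1.1
  have hE := gapEnergy_nonneg η u p
  have hEΔ := norm_iterate_sub_sq_le η hu p
  have h := lintegral_stepLaw_sq_le (r := r) (ν := ν)
    (N := fun θ => (-η) • ((G p.1.1 θ - ∇ f p.1.1) - (G p.2.1.1 θ - ∇ f p.2.1.1)))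
    (Ξ := fun _ => 0) (s₂ := 0) (by fun_prop) (by fun_prop)
    ((integrable_noise_sub hG p.1.1 p.2.1.1).smul (-η))
    (by rw [integral_smul, integral_noise_sub hG, smul_zero]) (by simp) (by simp)
    (show 0 ≤ (-η) ^ 2 * (ℓ ^ 2 * ‖Δ‖ ^ 2 + s ^ 2) by positivity) le_rfl
    (lintegral_smul_sq_le (-η) (hdiff p.1.1 p.2.1.1)) (by simp) (A + (-η) • B)
  simp only [add_zero] at h
  refine (lintegral_congr fun z => ?_).trans_le (h.trans (ENNReal.ofReal_le_ofReal ?_))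
  · rw [deviation_coupledStep G η hu hHu]
  have h1 := norm_add_sq_le_young A ((-η) • B) hτ
  have h2 : ‖A‖ ^ 2 ≤ (1 + η * γ) ^ 2 * ‖deviation η u p‖ ^ 2 := by
    rw [← mul_pow]; exact pow_le_pow_left₀ (norm_nonneg _) (hH _) 2
  have h3 : ‖B‖ ^ 2 ≤ 6 * (ρ * R) ^ 2 * gapEnergy η u p + 2 * L ^ 2 * ‖errorGap η p‖ ^ 2 := by
    have h4 := hf.norm_gradient_sub_hessian_le hρ hp hp'
    have h5 : ‖H (errorGap η p)‖ ≤ L * ‖errorGap η p‖ :=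
      (H.le_opNorm _).trans (by gcongr; exact hf.norm_hessian_le hL x₀)
    have h6 := norm_add_sq_le_two (∇ f p.1.1 - ∇ f p.2.1.1 - H Δ) (H (errorGap η p))
    have h7 := pow_le_pow_left₀ (norm_nonneg _) h4 2
    have h8 := pow_le_pow_left₀ (norm_nonneg _) h5 2
    rw [mul_pow] at h7 h8
    have h9 := mul_le_mul_of_nonneg_left hEΔ (sq_nonneg (ρ * R))
    rw [← hB] at h6
    rw [← hΔ, ← hHdef] at h7
    linarith
  rw [norm_smul, mul_pow, norm_neg, Real.norm_eq_abs, sq_abs] at h1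
  have h4 : (1 + τ) * ‖A‖ ^ 2 ≤ (1 + τ) * ((1 + η * γ) ^ 2 * ‖deviation η u p‖ ^ 2) := by gcongr
  have h5 := mul_le_mul_of_nonneg_left h3 (show 0 ≤ (1 + τ⁻¹) * η ^ 2 by positivity)
  have h6 := mul_le_mul_of_nonneg_left hEΔ (show 0 ≤ η ^ 2 * ℓ ^ 2 by positivity)
  rw [← hΔ] at h6
  linarith

/-- The reflected noises differ only along `u`, so the artificial noise contributes its variance in
one direction, `r² / d`, and not `r²`. -/
lemma lintegral_errorGap_sq_le (hf : SmoothObjective f fmax L ρ)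
    (hG : StochasticOracle D f G σ) (hdiff : NoiseDifferenceBound D f G ℓ s)
    (hν : IsCompressor ν μ) (hμ0 : 0 < μ) (hμ1 : μ ≤ 1) {u : Vec d} (hu : ‖u‖ = 1) (a : ℝ)
    (p : Coupled d) :
    ∫⁻ z, ENNReal.ofReal (‖errorGap η (coupledStep G η a u p z)‖ ^ 2) ∂(stepLaw D r ν) ≤
      ENNReal.ofReal ((1 - μ / 2) * ‖errorGap η p‖ ^ 2 +
        η ^ 2 * (9 * L ^ 2 / μ + 3 * ℓ ^ 2) * gapEnergy η u p + η ^ 2 * s ^ 2 +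
        4 * η ^ 2 * (r ^ 2 / d)) := by
  set Δ := p.1.1 - p.2.1.1 with hΔ
  set h := ∇ f p.1.1 - ∇ f p.2.1.1 with hh
  have hm := hG.measurable_apply p.1.1
  have hm' := hG.measurable_apply p.2.1.1
  have hE := gapEnergy_nonneg η u p
  have hEΔ := norm_iterate_sub_sq_le η hu p
  simp only [errorGap_coupledStep G η hu, norm_smul η, mul_pow]
  have h1 := lintegral_stepLaw_compress_le (D := D) (r := r) (v := fun θ ξ =>
    p.1.2 - p.2.1.2 + (G p.1.1 θ - G p.2.1.1 θ) + (2 * inner ℝ u ξ) • u) hν hμ1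
    (by unfold Function.uncurry; fun_prop)
  have h2 := lintegral_stepLaw_sq_le (D := D) (r := r) (ν := ν)
    (N := fun θ => (G p.1.1 θ - ∇ f p.1.1) - (G p.2.1.1 θ - ∇ f p.2.1.1))
    (Ξ := fun ξ => (2 * inner ℝ u ξ) • u) (s₂ := 4 * (r ^ 2 / d)) (by fun_prop) (by fun_prop)
    (integrable_noise_sub hG p.1.1 p.2.1.1) (integral_noise_sub hG _ _)
    (((integrable_inner_noiseLaw r u).const_mul 2).smul_const u)
    (by rw [integral_smul_const, integral_const_mul, integral_inner_noiseLaw]; simp)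
    (show 0 ≤ ℓ ^ 2 * ‖Δ‖ ^ 2 + s ^ 2 by positivity) (by positivity)
    (hdiff p.1.1 p.2.1.1) (by
      simp only [norm_smul, hu, mul_one, norm_mul, Real.norm_ofNat, mul_pow, Real.norm_eq_abs,
        sq_abs]
      simp only [ENNReal.ofReal_mul (show (0 : ℝ) ≤ 2 ^ 2 by norm_num)]
      rw [lintegral_const_mul _ (by fun_prop), lintegral_inner_sq_noiseLaw r hu,
        ← ENNReal.ofReal_mul (by norm_num)]
      norm_num) (p.1.2 - p.2.1.2 + h)
  have h3 : ∀ z : Θ × Vec d × Finset (Fin d), p.1.2 - p.2.1.2 + h +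
      ((G p.1.1 z.1 - ∇ f p.1.1) - (G p.2.1.1 z.1 - ∇ f p.2.1.1)) +
      (2 * inner ℝ u z.2.1) • u =
      p.1.2 - p.2.1.2 + (G p.1.1 z.1 - G p.2.1.1 z.1) + (2 * inner ℝ u z.2.1) • u := fun z => by
    simp only [hh]; module
  simp only [h3] at h2
  simp only [Real.norm_eq_abs, sq_abs, ENNReal.ofReal_mul (sq_nonneg η)]
  rw [lintegral_const_mul' _ _ ENNReal.ofReal_ne_top]
  refine (mul_le_mul_right (h1.trans (mul_le_mul_right h2 _)) _).trans ?_
  rw [← ENNReal.ofReal_mul (by linarith), ← ENNReal.ofReal_mul (sq_nonneg η)]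
  refine ENNReal.ofReal_le_ofReal ?_
  have h4 := one_sub_mul_norm_add_sq_le (p.1.2 - p.2.1.2) h hμ0 hμ1
  have h5 : ‖h‖ ^ 2 ≤ L ^ 2 * (3 * gapEnergy η u p) := by
    have := pow_le_pow_left₀ (norm_nonneg _) (hf.smooth p.1.1 p.2.1.1) 2
    rw [mul_pow] at this
    exact this.trans (by gcongr)
  have h6 : ‖errorGap η p‖ ^ 2 = η ^ 2 * ‖p.1.2 - p.2.1.2‖ ^ 2 := by
    rw [errorGap, norm_smul, mul_pow, Real.norm_eq_abs, sq_abs]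
  have h7 : 3 / μ * ‖h‖ ^ 2 ≤ 9 * L ^ 2 / μ * gapEnergy η u p := by
    calc 3 / μ * ‖h‖ ^ 2 ≤ 3 / μ * (L ^ 2 * (3 * gapEnergy η u p)) := by gcongr
      _ = _ := by ring
  have h8 : (1 - μ) * (ℓ ^ 2 * ‖Δ‖ ^ 2 + s ^ 2 + 4 * (r ^ 2 / d)) ≤
      ℓ ^ 2 * (3 * gapEnergy η u p) + s ^ 2 + 4 * (r ^ 2 / d) := by
    have h9 : ℓ ^ 2 * ‖Δ‖ ^ 2 ≤ ℓ ^ 2 * (3 * gapEnergy η u p) := by gcongr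
    have h10 : 0 ≤ ℓ ^ 2 * ‖Δ‖ ^ 2 + s ^ 2 + 4 * (r ^ 2 / d) := by positivity
    nlinarith
  rw [h6]
  have h9 : (1 - μ) * (‖p.1.2 - p.2.1.2 + h‖ ^ 2 + (ℓ ^ 2 * ‖Δ‖ ^ 2 + s ^ 2) + 4 * (r ^ 2 / d)) ≤
      (1 - μ / 2) * ‖p.1.2 - p.2.1.2‖ ^ 2 + 9 * L ^ 2 / μ * gapEnergy η u p +
      (ℓ ^ 2 * (3 * gapEnergy η u p) + s ^ 2 + 4 * (r ^ 2 / d)) := by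
    linarith
  refine (mul_le_mul_of_nonneg_left h9 (sq_nonneg η)).trans (le_of_eq ?_)
  ring

lemma lintegral_linear_sq_le {u : Vec d} (hu : ‖u‖ = 1) (a : ℝ) (p : Coupled d) :
    ∫⁻ z, ENNReal.ofReal ((coupledStep G η a u p z).2.2 ^ 2) ∂(stepLaw D r ν) ≤
      ENNReal.ofReal (a ^ 2 * p.2.2 ^ 2 + 4 * η ^ 2 * (r ^ 2 / d)) := by
  have h : ∀ z : Θ × Vec d × Finset (Fin d), ENNReal.ofReal ((coupledStep G η a u p z).2.2 ^ 2) =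
      ENNReal.ofReal (‖a * p.2.2 + (-(2 * η)) * inner ℝ u z.2.1‖ ^ 2) := fun z => by
    rw [Real.norm_eq_abs, sq_abs]; simp only [coupledStep]; congr 2; ring
  simp only [h]
  rw [stepLaw, lintegral_prod _ (by fun_prop)]
  simp only
  rw [lintegral_const, measure_univ, mul_one, lintegral_prod _ (by fun_prop)]
  simp only [lintegral_const, measure_univ, mul_one]
  have h2 := lintegral_norm_add_sq_le (X := fun ξ : Vec d => (-(2 * η)) * inner ℝ u ξ)
    (P := noiseLaw d r) ((integrable_inner_noiseLaw r u).const_mul _)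
    (by rw [integral_const_mul, integral_inner_noiseLaw, mul_zero])
    (s := 4 * η ^ 2 * (r ^ 2 / d)) (by positivity) (by
      simp only [norm_mul, mul_pow, Real.norm_eq_abs, sq_abs]
      simp only [ENNReal.ofReal_mul (sq_nonneg _)]
      rw [lintegral_const_mul _ (by fun_prop), lintegral_inner_sq_noiseLaw r hu,
        ← ENNReal.ofReal_mul (sq_nonneg _)]
      exact ENNReal.ofReal_le_ofReal (le_of_eq (by ring))) (a * p.2.2)
  rwa [Real.norm_eq_abs, sq_abs, mul_pow] at h2

end CoupledEnergy

/-! ### The exact Gaussian law of the linear part, and the killed coupling. -/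

section Growth

/-- The interval has length `√v` and the density is at most `1 / √(2πv)`; the product `1 / √(2π)` is
below 2/5. -/
lemma gaussianReal_setOf_sq_lt_le {v : ℝ} (hv : 0 < v) :
    gaussianReal 0 v.toNNReal {x | x ^ 2 < v / 4} ≤ ENNReal.ofReal (2 / 5) := by
  have hv0 : v.toNNReal ≠ 0 := by simpa using hv
  have hvv : (v.toNNReal : ℝ) = v := Real.coe_toNNReal _ hv.le
  have hset : {x : ℝ | x ^ 2 < v / 4} ⊆ Set.Ioo (-(√v / 2)) (√v / 2) := by
    intro x hx
    have : x ^ 2 < (√v / 2) ^ 2 := by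
      rw [div_pow, Real.sq_sqrt hv.le]; norm_num; exact hx
    exact abs_lt.1 (abs_lt_of_sq_lt_sq this (by positivity))
  rw [gaussianReal_apply 0 hv0]
  calc ∫⁻ x in {x | x ^ 2 < v / 4}, gaussianPDF 0 v.toNNReal x
      ≤ ∫⁻ x in Set.Ioo (-(√v / 2)) (√v / 2), gaussianPDF 0 v.toNNReal x :=
        lintegral_mono_set hset
    _ ≤ ∫⁻ x in Set.Ioo (-(√v / 2)) (√v / 2), ENNReal.ofReal (√(2 * Real.pi * v))⁻¹ := by
        refine lintegral_mono fun x => ENNReal.ofReal_le_ofReal ?_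
        rw [gaussianPDFReal, hvv]
        refine mul_le_of_le_one_right (by positivity) (Real.exp_le_one_iff.2 ?_)
        exact div_nonpos_of_nonpos_of_nonneg (by nlinarith [sq_nonneg (x - 0)]) (by positivity)
    _ = ENNReal.ofReal ((√(2 * Real.pi * v))⁻¹ * √v) := by
        rw [setLIntegral_const, Real.volume_Ioo, ← ENNReal.ofReal_mul (by positivity)]
        congr 1; ring
    _ ≤ ENNReal.ofReal (2 / 5) := by
        refine ENNReal.ofReal_le_ofReal ?_
        rw [Real.sqrt_mul (by positivity), mul_inv, mul_assoc,
          inv_mul_cancel₀ (Real.sqrt_ne_zero'.2 hv), mul_one]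
        rw [inv_le_comm₀ (by positivity) (by norm_num)]
        refine Real.le_sqrt_of_sq_le ?_
        have := Real.pi_gt_d2
        norm_num
        linarith

variable {d : ℕ} {Θ : Type u} [MeasurableSpace Θ] {D : Measure Θ}
  {r : ℝ} {ν : PMF (Finset (Fin d))} {f : Vec d → ℝ} {G : Vec d → Θ → Vec d}
  {η μ σ fmax L ρ ℓ s : ℝ}

/-- The law of two coupled runs from the same state. -/
def coupledLaw (D : Measure Θ) (r : ℝ) (ν : PMF (Finset (Fin d))) (G : Vec d → Θ → Vec d)
    (η a : ℝ) (u : Vec d) (s₀ : Vec d × Vec d) (n : ℕ) : Measure (Coupled d) :=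
  chainLaw (stepLaw D r ν) (coupledStep G η a u) (Measure.dirac (s₀, s₀, 0)) n

lemma isProbabilityMeasure_coupledLaw [IsProbabilityMeasure D]
    (hG : Measurable (Function.uncurry G)) (a : ℝ) (u : Vec d) (s₀ : Vec d × Vec d) (n : ℕ) :
    IsProbabilityMeasure (coupledLaw D r ν G η a u s₀ n) :=
  chainLaw_isProbabilityMeasure (measurable_coupledStep hG η a u) n

lemma coupledLaw_map_fst [IsProbabilityMeasure D] (hG : Measurable (Function.uncurry G))
    (a : ℝ) (u : Vec d) (s₀ : Vec d × Vec d) (n : ℕ) :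
    (coupledLaw D r ν G η a u s₀ n).map Prod.fst = sgdLaw D r ν G η s₀ n := by
  rw [coupledLaw, sgdLaw, chainLaw_map measurable_fst (MeasurePreserving.id _)
    (measurable_coupledStep hG η a u) (measurable_sgdStep hG) fun _ _ => rfl,
    Measure.map_dirac' measurable_fst]

lemma coupledLaw_map_snd_fst [IsProbabilityMeasure D] (hG : Measurable (Function.uncurry G))
    (a : ℝ) (u : Vec d) (s₀ : Vec d × Vec d) (n : ℕ) :
    (coupledLaw D r ν G η a u s₀ n).map (fun p => p.2.1) = sgdLaw D r ν G η s₀ n := by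
  rw [coupledLaw, sgdLaw, chainLaw_map measurable_snd.fst (measurePreserving_mirrorNoise u)
    (measurable_coupledStep hG η a u) (measurable_sgdStep hG) fun _ _ => rfl,
    Measure.map_dirac' measurable_snd.fst]

/-- The scalar component is a Gaussian autoregression started at 0. Its variance satisfies `V ↦ a² V
+ 4 η² r² / d`, whose solution is the geometric sum in the statement. -/
lemma coupledLaw_map_linear [IsProbabilityMeasure D] (hG : Measurable (Function.uncurry G))
    {a : ℝ} (ha : 1 < a) {u : Vec d} (hu : ‖u‖ = 1) (s₀ : Vec d × Vec d) (n : ℕ) :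
    (coupledLaw D r ν G η a u s₀ n).map (fun p => p.2.2) =
      gaussianReal 0 ((a ^ (2 * n) - 1) * (4 * η ^ 2 * (r ^ 2 / d) / (a ^ 2 - 1))).toNNReal := by
  have ha2 : 0 < a ^ 2 - 1 := by nlinarith
  have ha2n : ∀ n, 0 ≤ a ^ (2 * n) - 1 := fun n => sub_nonneg.2 (one_le_pow₀ ha.le)
  set v := 4 * η ^ 2 * (r ^ 2 / d) / (a ^ 2 - 1) with hv
  have hv0 : 0 ≤ v := by positivity
  have hg : MeasurePreserving (fun z : Θ × Vec d × Finset (Fin d) => inner ℝ u z.2.1)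
      (stepLaw D r ν) (gaussianReal 0 (r ^ 2 / d).toNNReal) := by
    refine MeasurePreserving.comp (g := fun ξ : Vec d => inner ℝ u ξ) (μb := noiseLaw d r)
      ⟨by fun_prop, map_inner_noiseLaw r hu⟩ ?_
    exact (measurePreserving_fst (μ := noiseLaw d r) (ν := ν.toMeasure)).comp
      (measurePreserving_snd (μ := D))
  rw [coupledLaw, chainLaw_map (step' := fun l x : ℝ => a * l - 2 * η * x) measurable_snd.snd hg
    (measurable_coupledStep hG η a u) (by unfold Function.uncurry; fun_prop) fun _ _ => rfl,
    Measure.map_dirac' measurable_snd.snd]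
  induction n with
  | zero => simp [chainLaw]
  | succ n ih =>
    rw [chainLaw, ih]
    have h1 : (Function.uncurry fun l x : ℝ => a * l - 2 * η * x) =
        (fun p : ℝ × ℝ => p.1 + p.2) ∘ (Prod.map (fun l => a * l) fun x => (-(2 * η)) * x) := by
      ext p; simp [Function.uncurry]; ring
    rw [h1, ← Measure.map_map (by fun_prop) (by fun_prop),
      ← Measure.map_prod_map _ _ (by fun_prop) (by fun_prop), gaussianReal_map_const_mul,
      gaussianReal_map_const_mul, ← Measure.conv, gaussianReal_conv_gaussianReal]
    congr 1
    · simp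
    · apply NNReal.coe_injective
      simp only [NNReal.coe_add, NNReal.coe_mul, NNReal.coe_mk]
      rw [Real.coe_toNNReal _ (mul_nonneg (ha2n _) hv0),
        Real.coe_toNNReal _ (mul_nonneg (ha2n _) hv0), Real.coe_toNNReal _ (by positivity)]
      have : 4 * η ^ 2 * (r ^ 2 / d) = v * (a ^ 2 - 1) := by rw [hv]; field_simp
      rw [show (-(2 * η)) ^ 2 * (r ^ 2 / d) = 4 * η ^ 2 * (r ^ 2 / d) by ring, this]
      ring

/-- The coupled states at which both runs are within distance `R` of `x₀`. -/
def localRegion (x₀ : Vec d) (R : ℝ) : Set (Coupled d) :=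
  {p | ‖p.1.1 - x₀‖ ≤ R ∧ ‖p.2.1.1 - x₀‖ ≤ R}

lemma measurableSet_localRegion (x₀ : Vec d) (R : ℝ) : MeasurableSet (localRegion x₀ R) := by
  have h1 : Measurable fun p : Coupled d => ‖p.1.1 - x₀‖ := by fun_prop
  have h2 : Measurable fun p : Coupled d => ‖p.2.1.1 - x₀‖ := by fun_prop
  exact (measurableSet_le h1 measurable_const).inter (measurableSet_le h2 measurable_const)

/-- The law of two coupled runs from the same state, killed when one of them leaves the ball of
radius `R` around the starting point. -/
def localLaw (D : Measure Θ) (r : ℝ) (ν : PMF (Finset (Fin d))) (G : Vec d → Θ → Vec d)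
    (η a : ℝ) (u : Vec d) (s₀ : Vec d × Vec d) (R : ℝ) (n : ℕ) : Measure (Coupled d) :=
  killedLaw (stepLaw D r ν) (coupledStep G η a u) (localRegion s₀.1 R)
    (Measure.dirac (s₀, s₀, 0)) n

lemma localLaw_le_coupledLaw [IsProbabilityMeasure D] (hG : Measurable (Function.uncurry G))
    (a : ℝ) (u : Vec d) (s₀ : Vec d × Vec d) (R : ℝ) (n : ℕ) :
    localLaw D r ν G η a u s₀ R n ≤ coupledLaw D r ν G η a u s₀ n :=
  killedLaw_le_chainLaw (measurable_coupledStep hG η a u) n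

lemma localLaw_univ_le_one [IsProbabilityMeasure D] (hG : Measurable (Function.uncurry G))
    (a : ℝ) (u : Vec d) (s₀ : Vec d × Vec d) (R : ℝ) (n : ℕ) :
    localLaw D r ν G η a u s₀ R n Set.univ ≤ 1 := by
  have := isProbabilityMeasure_coupledLaw (r := r) (ν := ν) (η := η) (D := D) hG a u s₀ n
  exact (localLaw_le_coupledLaw hG a u s₀ R n _).trans prob_le_one

end Growth

/-! ### Moment recursions for the killed coupling. -/

section Recursion

lemma lintegral_le_ofReal_of_le_quadratic {X : Type*} [MeasurableSpace X] {m : Measure X}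
    (hm : m Set.univ ≤ 1) {A : Set X} (hA : MeasurableSet A) {h : X → ℝ≥0∞} {F₁ F₂ F₃ : X → ℝ}
    (hF₁ : Measurable F₁) (hF₂ : Measurable F₂) (hF₁0 : ∀ x, 0 ≤ F₁ x)
    (hF₂0 : ∀ x, 0 ≤ F₂ x) (hF₃0 : ∀ x, 0 ≤ F₃ x) {c₁ c₂ c₃ c₄ b₁ b₂ b₃ : ℝ} (hc₁ : 0 ≤ c₁)
    (hc₂ : 0 ≤ c₂) (hc₃ : 0 ≤ c₃) (hc₄ : 0 ≤ c₄) (hb₁ : 0 ≤ b₁) (hb₂ : 0 ≤ b₂) (hb₃ : 0 ≤ b₃)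
    (h₁ : ∫⁻ x, ENNReal.ofReal (F₁ x) ∂m ≤ ENNReal.ofReal b₁)
    (h₂ : ∫⁻ x, ENNReal.ofReal (F₂ x) ∂m ≤ ENNReal.ofReal b₂)
    (h₃ : ∫⁻ x, ENNReal.ofReal (F₃ x) ∂m ≤ ENNReal.ofReal b₃)
    (hh : ∀ x ∈ A, h x ≤ ENNReal.ofReal (c₁ * F₁ x + c₂ * F₂ x + c₃ * F₃ x + c₄)) :
    ∫⁻ x in A, h x ∂m ≤ ENNReal.ofReal (c₁ * b₁ + c₂ * b₂ + c₃ * b₃ + c₄) := by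
  calc ∫⁻ x in A, h x ∂m
      ≤ ∫⁻ x in A, ENNReal.ofReal (c₁ * F₁ x + c₂ * F₂ x + c₃ * F₃ x + c₄) ∂m :=
        setLIntegral_mono' hA hh
    _ ≤ ∫⁻ x, ENNReal.ofReal (c₁ * F₁ x + c₂ * F₂ x + c₃ * F₃ x + c₄) ∂m :=
        setLIntegral_le_lintegral _ _
    _ = ∫⁻ x, (ENNReal.ofReal c₁ * ENNReal.ofReal (F₁ x) + ENNReal.ofReal c₂ * ENNReal.ofReal (F₂ x)
          + ENNReal.ofReal c₃ * ENNReal.ofReal (F₃ x) + ENNReal.ofReal c₄) ∂m := by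
        refine lintegral_congr fun x => ?_
        have := hF₁0 x
        have := hF₂0 x
        have := hF₃0 x
        rw [ENNReal.ofReal_add (by positivity) hc₄, ENNReal.ofReal_add (by positivity)
          (by positivity), ENNReal.ofReal_add (by positivity) (by positivity),
          ENNReal.ofReal_mul hc₁, ENNReal.ofReal_mul hc₂, ENNReal.ofReal_mul hc₃]
    _ = ENNReal.ofReal c₁ * ∫⁻ x, ENNReal.ofReal (F₁ x) ∂m
          + ENNReal.ofReal c₂ * ∫⁻ x, ENNReal.ofReal (F₂ x) ∂m
          + ENNReal.ofReal c₃ * ∫⁻ x, ENNReal.ofReal (F₃ x) ∂m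
          + ENNReal.ofReal c₄ * m Set.univ := by
        rw [lintegral_add_right _ measurable_const, lintegral_add_left (by fun_prop),
          lintegral_add_left (by fun_prop), lintegral_const, lintegral_const_mul _ (by fun_prop),
          lintegral_const_mul _ (by fun_prop), lintegral_const_mul' _ _ ENNReal.ofReal_ne_top]
    _ ≤ ENNReal.ofReal c₁ * ENNReal.ofReal b₁ + ENNReal.ofReal c₂ * ENNReal.ofReal b₂
          + ENNReal.ofReal c₃ * ENNReal.ofReal b₃ + ENNReal.ofReal c₄ * 1 := by gcongr
    _ = _ := by
        rw [mul_one, ← ENNReal.ofReal_mul hc₁, ← ENNReal.ofReal_mul hc₂, ← ENNReal.ofReal_mul hc₃,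
          ← ENNReal.ofReal_add (by positivity) (by positivity),
          ← ENNReal.ofReal_add (by positivity) (by positivity),
          ← ENNReal.ofReal_add (by positivity) hc₄]

variable {d : ℕ} {Θ : Type u} [MeasurableSpace Θ] {D : Measure Θ}
  {r : ℝ} {ν : PMF (Finset (Fin d))} {f : Vec d → ℝ} {G : Vec d → Θ → Vec d}
  {η μ σ fmax L ρ ℓ s : ℝ}

lemma measurable_deviation (η : ℝ) (u : Vec d) : Measurable (deviation η u) := by
  unfold deviation gap corrected; fun_prop

lemma measurable_errorGap (η : ℝ) : Measurable (errorGap (d := d) η) := by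
  unfold errorGap; fun_prop

/-- Young's inequality with weight `1 / n` may be applied `n` times at the cost of a factor of at
most 3. -/
lemma one_add_inv_pow_le {n m : ℕ} (hn : 0 < n) (hm : m ≤ n) : (1 + (n : ℝ)⁻¹) ^ m ≤ 3 := by
  have h1 : (1 : ℝ) ≤ 1 + (n : ℝ)⁻¹ := by simp
  calc (1 + (n : ℝ)⁻¹) ^ m ≤ (1 + (n : ℝ)⁻¹) ^ n := pow_le_pow_right₀ h1 hm
    _ ≤ Real.exp ((n : ℝ)⁻¹) ^ n := by
        gcongr
        linarith [Real.add_one_le_exp ((n : ℝ)⁻¹)]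
    _ = Real.exp 1 := by
        rw [← Real.exp_nat_mul, mul_inv_cancel₀ (by positivity)]
    _ ≤ 3 := Real.exp_one_lt_three.le

/-- While both runs stay in the local region, the linear part dominates the difference of the
coupled runs. -/
lemma coupled_moments_le [IsProbabilityMeasure D] (hf : SmoothObjective f fmax L ρ) (hL : 0 ≤ L)
    (hρ : 0 ≤ ρ) (hG : StochasticOracle D f G σ) (hdiff : NoiseDifferenceBound D f G ℓ s)
    (hν : IsCompressor ν μ) (hμ0 : 0 < μ) (hμ1 : μ ≤ 1) {s₀ : Vec d × Vec d}
    {u : Vec d}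
    (hu : ‖u‖ = 1) {γ : ℝ} (hηγ : 0 < η * γ) (hHu : hessian f s₀.1 u = -γ • u)
    (hH : ∀ v, ‖v - η • hessian f s₀.1 v‖ ≤ (1 + η * γ) * ‖v‖) {R v q ω : ℝ} (hv : 0 < v)
    (hvr : 4 * η ^ 2 * (r ^ 2 / d) = v * ((1 + η * γ) ^ 2 - 1)) {n : ℕ} (hn : 0 < n)
    (hω : (1 + n) * η ^ 2 * (18 * (ρ * R) ^ 2 + 2 * L ^ 2 * q) + 9 * η ^ 2 * ℓ ^ 2 +
      η ^ 2 * s ^ 2 / v ≤ ω) (hωn : 3 * n * ω ≤ 1 / 100) (hq1 : q ≤ 1 / 100)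
    (hq : 3 * η ^ 2 * (9 * L ^ 2 / μ + 3 * ℓ ^ 2) + η ^ 2 * s ^ 2 / v + ((1 + η * γ) ^ 2 - 1) ≤
      μ / 2 * q) (m : ℕ) (hm : m ≤ n) :
    ∫⁻ p, ENNReal.ofReal (‖deviation η u p‖ ^ 2) ∂(localLaw D r ν G η (1 + η * γ) u s₀ R m) ≤
        ENNReal.ofReal ((1 + (n : ℝ)⁻¹) ^ m * m * ω * ((1 + η * γ) ^ (2 * m) * v)) ∧
      ∫⁻ p, ENNReal.ofReal (p.2.2 ^ 2) ∂(localLaw D r ν G η (1 + η * γ) u s₀ R m) ≤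
        ENNReal.ofReal ((1 + η * γ) ^ (2 * m) * v - v) ∧
      ∫⁻ p, ENNReal.ofReal (‖errorGap η p‖ ^ 2) ∂(localLaw D r ν G η (1 + η * γ) u s₀ R m) ≤
        ENNReal.ofReal (q * ((1 + η * γ) ^ (2 * m) * v)) := by
  set a := 1 + η * γ with ha
  have ha1 : 1 ≤ a := by linarith
  have ha2 : 0 ≤ a ^ 2 - 1 := by nlinarith
  have hn0 : (0 : ℝ) < n := by exact_mod_cast hn
  have hq0 : 0 ≤ q := by
    have : 0 ≤ μ / 2 * q := le_trans (by positivity) hq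
    exact nonneg_of_mul_nonneg_right this (by positivity)
  have hω0 : 0 ≤ ω := le_trans (by positivity) hω
  have hstep := measurable_coupledStep hG.measurable η a u
  have hdm := measurable_deviation η u
  have hem := measurable_errorGap (d := d) η
  induction m with
  | zero =>
    simp only [localLaw, killedLaw]
    refine ⟨?_, ?_, ?_⟩ <;> rw [lintegral_dirac' _ (by fun_prop)] <;>
      simp [deviation, gap, errorGap]
  | succ m ih =>
    obtain ⟨hP, hJ, hQ⟩ := ih (by lia)
    set X := a ^ (2 * m) * v with hX
    have hXv : v ≤ X := le_mul_of_one_le_left hv.le (one_le_pow₀ ha1)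
    have hX0 : 0 < X := hv.trans_le hXv
    have hXs : a ^ (2 * (m + 1)) * v = a ^ 2 * X := by rw [hX]; ring
    set b := (1 + (n : ℝ)⁻¹) ^ m * m * ω with hb
    have hb0 : 0 ≤ b := by positivity
    have hb1 : b ≤ 1 := by
      have h1 := one_add_inv_pow_le hn (show m ≤ n by lia)
      have h2 : (m : ℝ) ≤ n := by exact_mod_cast (show m ≤ n by lia)
      calc b ≤ 3 * n * ω := by rw [hb]; gcongr
        _ ≤ 1 := by linarith
    have hsX : η ^ 2 * s ^ 2 ≤ η ^ 2 * s ^ 2 / v * X := by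
      rw [div_mul_eq_mul_div, le_div_iff₀ hv]; gcongr
    have hmass := localLaw_univ_le_one (D := D) (r := r) (ν := ν) (η := η) hG.measurable a u s₀ R m
    have hA := measurableSet_localRegion s₀.1 R
    have hfin := fun {h : Coupled d → ℝ≥0∞} (c₁ c₂ c₃ c₄ : ℝ) hc₁ hc₂ hc₃ hc₄ hh =>
      lintegral_le_ofReal_of_le_quadratic (h := h) (c₁ := c₁) (c₂ := c₂) (c₃ := c₃) (c₄ := c₄)
      hmass hA
      (show Measurable fun p : Coupled d => ‖deviation η u p‖ ^ 2 by fun_prop)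
      (show Measurable fun p : Coupled d => p.2.2 ^ 2 by fun_prop)
      (F₃ := fun p : Coupled d => ‖errorGap η p‖ ^ 2)
      (fun _ => by positivity) (fun _ => by positivity) (fun _ => by positivity)
      hc₁ hc₂ hc₃ hc₄ (by positivity) (sub_nonneg.2 hXv) (by positivity) hP hJ hQ hh
    have hmono := fun {x y : ℝ} (h : x ≤ y) => ENNReal.ofReal_le_ofReal h
    have hlocal : ∀ {h : Coupled d → ℝ≥0∞}, Measurable h →
        ∫⁻ p, h p ∂(localLaw D r ν G η a u s₀ R (m + 1)) =
          ∫⁻ p in localRegion s₀.1 R, ∫⁻ z, h (coupledStep G η a u p z) ∂(stepLaw D r ν)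
            ∂(localLaw D r ν G η a u s₀ R m) := fun hh => lintegral_killedLaw_succ hstep m hh
    rw [hXs, hlocal (by fun_prop), hlocal (by fun_prop), hlocal (by fun_prop)]
    have hE : b * X + (X - v) + q * X ≤ 3 * X := by nlinarith
    refine ⟨?_, ?_, ?_⟩
    -- Young's inequality has weight `1 / n`, so the nonlinear terms carry a factor `1 + n`. By
    -- `hω`, one step injects at most `ω X`; as `X` itself grows by `a²` in each step, these
    -- injections add up linearly relative to `X`, which gives the factor `m * ω`.
    · set k := (1 + (n : ℝ)) * η ^ 2 * (6 * (ρ * R) ^ 2) + 3 * η ^ 2 * ℓ ^ 2 with hk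
      refine (hfin ((1 + (n : ℝ)⁻¹) * a ^ 2 + k) k (k + (1 + (n : ℝ)) * η ^ 2 * (2 * L ^ 2))
        (η ^ 2 * s ^ 2) (by positivity) (by positivity) (by positivity) (by positivity)
        fun p hp => ?_).trans (hmono ?_)
      · refine (lintegral_deviation_sq_le hf hL hρ hG hdiff hu hHu hH
          (inv_pos.2 hn0) p hp.1 hp.2).trans (hmono (le_of_eq ?_))
        rw [gapEnergy, inv_inv, hk]
        ring
      · have h1 : k * (3 * X) + (1 + (n : ℝ)) * η ^ 2 * (2 * L ^ 2) * (q * X) + η ^ 2 * s ^ 2 ≤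
            ω * X := by
          refine le_trans ?_ (mul_le_mul_of_nonneg_right hω hX0.le)
          rw [hk]
          linarith
        have h2 : k * (b * X + (X - v) + q * X) ≤ k * (3 * X) := by gcongr
        have h3 : ω * X ≤ (1 + (n : ℝ)⁻¹) ^ (m + 1) * ω * (a ^ 2 * X) := by
          have h4 : 1 ≤ (1 + (n : ℝ)⁻¹) ^ (m + 1) := one_le_pow₀ (by simp)
          have h5 : X ≤ a ^ 2 * X := le_mul_of_one_le_left hX0.le (one_le_pow₀ ha1)
          calc ω * X = 1 * ω * X := by ring
            _ ≤ _ := by gcongr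
        have h6 : (1 + (n : ℝ)⁻¹) * a ^ 2 * (b * X) =
            (1 + (n : ℝ)⁻¹) ^ (m + 1) * m * ω * (a ^ 2 * X) := by rw [hb]; ring
        push_cast
        linarith
    -- By `hvr`, `a ^ (2 * m) * v - v` solves the variance recursion exactly.
    · refine (hfin 0 (a ^ 2) 0 (4 * η ^ 2 * (r ^ 2 / d)) le_rfl (by positivity) le_rfl
        (by positivity) fun p _ => ?_).trans (hmono (le_of_eq ?_))
      · refine (lintegral_linear_sq_le hu a p).trans (hmono (le_of_eq ?_))
        ring
      · rw [hvr]; ring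
    -- `hq` makes `q` a stationary ratio: what is injected per step, relative to `X`, is at most
    -- what the contraction by `μ / 2` removes.
    · set k := η ^ 2 * (9 * L ^ 2 / μ + 3 * ℓ ^ 2) with hk
      refine (hfin k k (1 - μ / 2 + k) (η ^ 2 * s ^ 2 + 4 * η ^ 2 * (r ^ 2 / d))
        (by positivity) (by positivity)
        (add_nonneg (by linarith) (by positivity)) (by positivity)
        fun p _ => ?_).trans (hmono ?_)
      · refine (lintegral_errorGap_sq_le hf hG hdiff hν hμ0 hμ1 hu a p).trans (hmono (le_of_eq ?_))
        rw [gapEnergy, hk]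
        ring
      · have h2 : k * (b * X + (X - v) + q * X) ≤ k * (3 * X) := by gcongr
        have h3 : v * (a ^ 2 - 1) ≤ X * (a ^ 2 - 1) := by gcongr
        have h4 := mul_le_mul_of_nonneg_right hq hX0.le
        have h5 : q * X ≤ q * (a ^ 2 * X) := by
          have := le_mul_of_one_le_left hX0.le (one_le_pow₀ (n := 2) ha1)
          gcongr
        rw [hvr]
        linarith

end Recursion

/-! ### Both runs staying near the saddle contradicts the Gaussian growth. -/

section Escape

variable {d : ℕ} {Θ : Type u} [MeasurableSpace Θ] {D : Measure Θ}
  {r : ℝ} {ν : PMF (Finset (Fin d))} {f : Vec d → ℝ} {G : Vec d → Θ → Vec d}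
  {η μ σ fmax L ρ ℓ s : ℝ}

/-- Two coupled runs from a point of negative curvature cannot both stay in the local region with
a probability close to one. -/
lemma localLaw_region_le [IsProbabilityMeasure D] (hf : SmoothObjective f fmax L ρ) (hL : 0 ≤ L)
    (hρ : 0 ≤ ρ) (hG : StochasticOracle D f G σ) (hdiff : NoiseDifferenceBound D f G ℓ s)
    (hν : IsCompressor ν μ) (hμ0 : 0 < μ) (hμ1 : μ ≤ 1) {s₀ : Vec d × Vec d} {u : Vec d}
    (hu : ‖u‖ = 1) {γ : ℝ} (hηγ : 0 < η * γ) (hHu : hessian f s₀.1 u = -γ • u)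
    (hH : ∀ v, ‖v - η • hessian f s₀.1 v‖ ≤ (1 + η * γ) * ‖v‖) {R v q ω : ℝ} (hv : 0 < v)
    (hvr : 4 * η ^ 2 * (r ^ 2 / d) = v * ((1 + η * γ) ^ 2 - 1)) {n : ℕ} (hn : 0 < n)
    (hω : (1 + n) * η ^ 2 * (18 * (ρ * R) ^ 2 + 2 * L ^ 2 * q) + 9 * η ^ 2 * ℓ ^ 2 +
      η ^ 2 * s ^ 2 / v ≤ ω) (hωn : 3 * n * ω ≤ 1 / 100) (hq1 : q ≤ 1 / 100)
    (hq : 3 * η ^ 2 * (9 * L ^ 2 / μ + 3 * ℓ ^ 2) + η ^ 2 * s ^ 2 / v + ((1 + η * γ) ^ 2 - 1) ≤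
      μ / 2 * q) (hR : 240 * R ^ 2 < (1 + η * γ) ^ (2 * n) * v)
    (h10 : 10 ≤ (1 + η * γ) ^ (2 * n)) :
    localLaw D r ν G η (1 + η * γ) u s₀ R n (localRegion s₀.1 R) ≤ ENNReal.ofReal (11 / 12) := by
  obtain ⟨hP, hJ, hQ⟩ := coupled_moments_le hf hL hρ hG hdiff hν hμ0 hμ1 hu hηγ hHu hH hv hvr hn
    hω hωn hq1 hq n le_rfl
  set a := 1 + η * γ with ha
  set X := a ^ (2 * n) * v with hX
  set k := localLaw D r ν G η a u s₀ R n with hk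
  set A := localRegion s₀.1 R with hAdef
  have ha1 : 1 < a := by linarith
  have hX0 : 0 < X := by positivity
  have hXv : 10 * v ≤ X := by rw [hX]; gcongr
  have hA : MeasurableSet A := measurableSet_localRegion s₀.1 R
  have hdm := measurable_deviation η u
  have hem := measurable_errorGap (d := d) η
  have hω0 : 0 ≤ ω := le_trans (by
    have : 0 ≤ μ / 2 * q := le_trans (by
      have : 0 ≤ a ^ 2 - 1 := by nlinarith
      positivity) hq
    have : 0 ≤ q := nonneg_of_mul_nonneg_right this (by positivity)
    positivity) hω
  have hP' : ∫⁻ p, ENNReal.ofReal (‖deviation η u p‖ ^ 2) ∂k ≤ ENNReal.ofReal (X / 100) := by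
    refine hP.trans (ENNReal.ofReal_le_ofReal ?_)
    have h1 := one_add_inv_pow_le hn (le_refl n)
    calc (1 + (n : ℝ)⁻¹) ^ n * n * ω * X ≤ 3 * n * ω * X := by gcongr
      _ ≤ 1 / 100 * X := by gcongr
      _ = X / 100 := by ring
  have hQ' : ∫⁻ p, ENNReal.ofReal (‖errorGap η p‖ ^ 2) ∂k ≤ ENNReal.ofReal (X / 100) :=
    hQ.trans (ENNReal.ofReal_le_ofReal (by nlinarith))
  have hl : ∫⁻ p in A, ENNReal.ofReal (p.2.2 ^ 2) ∂k ≤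
      ENNReal.ofReal (3 * (X / 100) + 0 * (X - v) + 3 * (X / 100) + 12 * R ^ 2) := by
    refine lintegral_le_ofReal_of_le_quadratic (localLaw_univ_le_one hG.measurable a u s₀ R n) hA
      (show Measurable fun p : Coupled d => ‖deviation η u p‖ ^ 2 by fun_prop)
      (show Measurable fun p : Coupled d => p.2.2 ^ 2 by fun_prop)
      (F₃ := fun p : Coupled d => ‖errorGap η p‖ ^ 2)
      (fun _ => by positivity) (fun _ => by positivity) (fun _ => by positivity)
      (by norm_num) le_rfl (by norm_num) (by positivity) (by positivity) (by linarith)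
      (by positivity) hP' hJ hQ' fun p hp => ENNReal.ofReal_le_ofReal ?_
    have h1 : p.2.2 • u = (p.1.1 - p.2.1.1) + -deviation η u p + -errorGap η p := by
      rw [iterate_sub_eq η u]; abel
    have h2 := norm_add_add_sq_le (p.1.1 - p.2.1.1) (-deviation η u p) (-errorGap η p)
    rw [← h1, norm_smul, hu, mul_one, Real.norm_eq_abs, sq_abs, norm_neg, norm_neg] at h2
    have h3 : ‖p.1.1 - p.2.1.1‖ ≤ 2 * R := by
      rw [← sub_sub_sub_cancel_right _ _ s₀.1]
      exact (norm_sub_le _ _).trans (by linarith [hp.1, hp.2])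
    have h4 := pow_le_pow_left₀ (norm_nonneg _) h3 2
    linarith
  -- If the region kept mass above 11/12, the linear part would have square at least `w / 4` on a
  -- mass of at least 11/12 - 2/5 > 1/2 inside it, where `w` is its variance. As `X ≥ 10 v`, this
  -- gives a second moment of at least `w / 8 ≥ 0.1125 X`, whereas `hl` and `240 R² < X` bound it by
  -- less than `0.11 X`.
  by_contra! hcon
  set w := X - v with hw
  have hw0 : 0 < w := by linarith
  set B : Set (Coupled d) := {p | w / 4 ≤ p.2.2 ^ 2} with hB
  have hBm : MeasurableSet B := measurableSet_le measurable_const (by fun_prop)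
  -- The law is Gaussian only for the coupling without killing. The killed law is dominated by it,
  -- so the event to be bounded is that the linear part is small.
  have hBc : k Bᶜ ≤ ENNReal.ofReal (2 / 5) := by
    refine (localLaw_le_coupledLaw hG.measurable a u s₀ R n _).trans ?_
    have h1 := gaussianReal_setOf_sq_lt_le hw0
    have h2 := coupledLaw_map_linear (D := D) (r := r) (ν := ν) (η := η) hG.measurable ha1 hu s₀ n
    have h3 : 4 * η ^ 2 * (r ^ 2 / d) / (a ^ 2 - 1) = v := by
      rw [hvr]; exact mul_div_cancel_right₀ _ (by nlinarith)
    rw [h3, show (a ^ (2 * n) - 1) * v = w by rw [hw, hX]; ring] at h2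
    rw [← h2, Measure.map_apply measurable_snd.snd
      (measurableSet_lt (by fun_prop) measurable_const)] at h1
    refine le_trans (le_of_eq ?_) h1
    congr 1
    ext p
    simp [hB]
  have hAB : ENNReal.ofReal (1 / 2) ≤ (k.restrict A) B := by
    rw [Measure.restrict_apply hBm, Set.inter_comm]
    have h1 : k A ≤ k (A ∩ B) + k Bᶜ := by
      refine (measure_mono fun p hp => ?_).trans (measure_union_le _ _)
      by_cases h : p ∈ B
      · exact Or.inl ⟨hp, h⟩
      · exact Or.inr h
    have h2 : ENNReal.ofReal (1 / 2) + ENNReal.ofReal (2 / 5) ≤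
        k (A ∩ B) + ENNReal.ofReal (2 / 5) := by
      rw [← ENNReal.ofReal_add (by norm_num) (by norm_num)]
      calc ENNReal.ofReal (1 / 2 + 2 / 5) ≤ ENNReal.ofReal (11 / 12) :=
            ENNReal.ofReal_le_ofReal (by norm_num)
        _ ≤ k A := hcon.le
        _ ≤ _ := h1
        _ ≤ _ := by gcongr
    exact (ENNReal.add_le_add_iff_right ENNReal.ofReal_ne_top).1 h2
  have hM := mul_meas_ge_le_lintegral (μ := k.restrict A)
    (f := fun p : Coupled d => ENNReal.ofReal (p.2.2 ^ 2)) (by fun_prop) (ENNReal.ofReal (w / 4))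
  have hB' : {p : Coupled d | ENNReal.ofReal (w / 4) ≤ ENNReal.ofReal (p.2.2 ^ 2)} = B := by
    ext p
    simp only [hB, Set.mem_ofPred_eq]
    exact ENNReal.ofReal_le_ofReal_iff (sq_nonneg _)
  rw [hB'] at hM
  have h5 := (mul_le_mul_right hAB (ENNReal.ofReal (w / 4))).trans (hM.trans hl)
  rw [← ENNReal.ofReal_mul (by positivity), ENNReal.ofReal_le_ofReal_iff (by positivity)] at h5
  linarith

end Escape

/-! ### Leaving the ball requires large gradients. -/

section Exit

variable {d : ℕ} {Θ : Type u} [MeasurableSpace Θ] {D : Measure Θ}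
  {r : ℝ} {ν : PMF (Finset (Fin d))} {f : Vec d → ℝ} {G : Vec d → Θ → Vec d}
  {η μ σ fmax L ρ : ℝ}

/-- Potential which bounds the distance of an iterate from the starting point. -/
def displacement (η : ℝ) (s₀ s : Vec d × Vec d) : ℝ :=
  ‖corrected η s - corrected η s₀‖ ^ 2 + η ^ 2 * ‖s.2‖ ^ 2 + η ^ 2 * ‖s₀.2‖ ^ 2

lemma displacement_nonneg (η : ℝ) (s₀ s : Vec d × Vec d) : 0 ≤ displacement η s₀ s := by
  unfold displacement; positivity

lemma measurable_displacement (η : ℝ) (s₀ : Vec d × Vec d) : Measurable (displacement η s₀) := by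
  unfold displacement corrected; fun_prop

lemma norm_sub_sq_le_displacement (η : ℝ) (s₀ s : Vec d × Vec d) :
    ‖s.1 - s₀.1‖ ^ 2 ≤ 3 * displacement η s₀ s := by
  have h : s.1 - s₀.1 = (corrected η s - corrected η s₀) + η • s.2 + -(η • s₀.2) := by
    simp only [corrected]; module
  have := norm_add_add_sq_le (corrected η s - corrected η s₀) (η • s.2) (-(η • s₀.2))
  rw [← h, norm_neg, norm_smul, norm_smul, mul_pow, mul_pow, Real.norm_eq_abs, sq_abs] at this
  exact this

/-- Young's inequality with weight `1 / n` again; the gradient gets `1 + n` from the corrected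
iterate and `3 / μ` from the compression error. -/
lemma lintegral_displacement_le [IsProbabilityMeasure D] (hd : 0 < d)
    (hG : StochasticOracle D f G σ) (hν : IsCompressor ν μ) (hμ0 : 0 < μ) (hμ1 : μ ≤ 1)
    (s₀ s : Vec d × Vec d) {n : ℕ} (hn : 0 < n) :
    ∫⁻ z, ENNReal.ofReal (displacement η s₀ (sgdStep G η s z)) ∂(stepLaw D r ν) ≤
      ENNReal.ofReal (1 + (n : ℝ)⁻¹) * ENNReal.ofReal (displacement η s₀ s) +
      (ENNReal.ofReal ((1 + n + 3 / μ) * η ^ 2) * ENNReal.ofReal (‖∇ f s.1‖ ^ 2) +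
        ENNReal.ofReal (2 * η ^ 2 * (σ ^ 2 + r ^ 2))) := by
  have hn0 : (0 : ℝ) < n := by exact_mod_cast hn
  have h1 := lintegral_corrected_sub_sq_le (r := r) (ν := ν) (η := η) hd hG s (corrected η s₀)
    (inv_pos.2 hn0)
  have h2 := lintegral_error_sq_le (r := r) (η := η) hd hG hν hμ0 hμ1 s
  have hzm : Measurable fun z => sgdStep G η s z :=
    (measurable_sgdStep hG.measurable).comp measurable_prodMk_left
  have hzc := (measurable_corrected (d := d) η).comp hzm
  have hm1 : Measurable fun z => ENNReal.ofReal
      (‖corrected η (sgdStep G η s z) - corrected η s₀‖ ^ 2) :=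
    ((hzc.sub_const _).norm.pow_const 2).ennreal_ofReal
  have hm2 : Measurable fun z => ENNReal.ofReal (‖(sgdStep G η s z).2‖ ^ 2) :=
    (hzm.snd.norm.pow_const 2).ennreal_ofReal
  have h3 : ∀ z, ENNReal.ofReal (displacement η s₀ (sgdStep G η s z)) =
      ENNReal.ofReal (‖corrected η (sgdStep G η s z) - corrected η s₀‖ ^ 2) +
        ENNReal.ofReal (η ^ 2) * ENNReal.ofReal (‖(sgdStep G η s z).2‖ ^ 2) +
        ENNReal.ofReal (η ^ 2 * ‖s₀.2‖ ^ 2) := fun z => by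
    rw [displacement, ENNReal.ofReal_add (by positivity) (by positivity),
      ENNReal.ofReal_add (by positivity) (by positivity), ENNReal.ofReal_mul (sq_nonneg η)]
  simp only [h3]
  rw [lintegral_add_right _ measurable_const, lintegral_add_left hm1, lintegral_const_mul _ hm2,
    lintegral_const, measure_univ, mul_one]
  grw [h1, h2]
  have hpos : 0 ≤ (1 - μ / 2) * ‖s.2‖ ^ 2 :=
    mul_nonneg (by linarith) (sq_nonneg _)
  have hd0 := displacement_nonneg η s₀ s
  rw [← ENNReal.ofReal_mul (sq_nonneg _), ← ENNReal.ofReal_add (by positivity) (by positivity),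
    ← ENNReal.ofReal_add (by positivity) (by positivity), ← ENNReal.ofReal_mul (by positivity),
    ← ENNReal.ofReal_mul (by positivity), ← ENNReal.ofReal_add (by positivity) (by positivity),
    ← ENNReal.ofReal_add (by positivity) (by positivity)]
  refine ENNReal.ofReal_le_ofReal ?_
  rw [displacement, inv_inv]
  have h4 : 0 ≤ (n : ℝ)⁻¹ * (η ^ 2 * ‖s.2‖ ^ 2 + η ^ 2 * ‖s₀.2‖ ^ 2) := by positivity
  have h5 : 0 ≤ η ^ 2 * (μ / 2 * ‖s.2‖ ^ 2) := by positivity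
  linarith

/-- Two coupled runs leave the local region only if the gradients on the way are large. -/
lemma exit_probability_le [IsProbabilityMeasure D] (hd : 0 < d)
    (hf : SmoothObjective f fmax L ρ)
    (hG : StochasticOracle D f G σ) (hν : IsCompressor ν μ) (hμ0 : 0 < μ) (hμ1 : μ ≤ 1)
    (s₀ : Vec d × Vec d) (a : ℝ) (u : Vec d) {R : ℝ} (hR : 0 ≤ R) {n : ℕ} (hn : 0 < n) :
    ENNReal.ofReal (R ^ 2 / 3) * (1 - localLaw D r ν G η a u s₀ R n (localRegion s₀.1 R)) ≤
      3 * (ENNReal.ofReal (4 * η ^ 2 * ‖s₀.2‖ ^ 2) +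
        ∑ j ∈ Finset.range n, (2 * (ENNReal.ofReal ((1 + n + 3 / μ) * η ^ 2) *
          ∫⁻ s, ENNReal.ofReal (‖∇ f s.1‖ ^ 2) ∂(sgdLaw D r ν G η s₀ j)) +
          2 * ENNReal.ofReal (2 * η ^ 2 * (σ ^ 2 + r ^ 2)))) := by
  set A := localRegion s₀.1 R with hAdef
  have hA : MeasurableSet A := measurableSet_localRegion s₀.1 R
  set k := localLaw D r ν G η a u s₀ R with hk
  have hstep := measurable_coupledStep hG.measurable η a u
  have hdm := measurable_displacement (d := d) η s₀
  have hgm : Measurable (∇ f) := hf.continuous_gradient.measurable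
  set K := ENNReal.ofReal ((1 + n + 3 / μ) * η ^ 2) with hK
  set c := ENNReal.ofReal (2 * η ^ 2 * (σ ^ 2 + r ^ 2)) with hc
  set g : Vec d × Vec d → ℝ≥0∞ := fun s => ENNReal.ofReal (‖∇ f s.1‖ ^ 2) with hg
  have hgm' : Measurable g := by fun_prop
  set U : Coupled d → ℝ≥0∞ := fun p =>
    ENNReal.ofReal (displacement η s₀ p.1) + ENNReal.ofReal (displacement η s₀ p.2.1) with hU
  have hUm : Measurable U := by fun_prop
  set t := ENNReal.ofReal (1 + (n : ℝ)⁻¹) with ht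
  have ht1 : 1 ≤ t := by
    rw [ht, ← ENNReal.ofReal_one]; exact ENNReal.ofReal_le_ofReal (by simp)
  set C : ℕ → ℝ≥0∞ := fun j => 2 * (K * ∫⁻ s, g s ∂(sgdLaw D r ν G η s₀ j)) + 2 * c with hC
  have hmass : ∀ m, k m Set.univ ≤ 1 := localLaw_univ_le_one hG.measurable a u s₀ R
  have hdrift : ∀ p, ∫⁻ z, U (coupledStep G η a u p z) ∂(stepLaw D r ν) ≤
      t * U p + ((K * g p.1 + K * g p.2.1) + 2 * c) := by
    intro p
    have h1 := lintegral_displacement_le (r := r) (η := η) hd hG hν hμ0 hμ1 s₀ p.1 hn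
    have h2 := lintegral_displacement_le (r := r) (η := η) hd hG hν hμ0 hμ1 s₀ p.2.1 hn
    have hzm : Measurable fun z => sgdStep G η p.1 z :=
      (measurable_sgdStep hG.measurable).comp measurable_prodMk_left
    have hzm' : Measurable fun z => sgdStep G η p.2.1 z :=
      (measurable_sgdStep hG.measurable).comp measurable_prodMk_left
    have hmir := measurePreserving_mirrorNoise (D := D) (r := r) (ν := ν) u
    have h3 : ∫⁻ z, ENNReal.ofReal (displacement η s₀ (sgdStep G η p.2.1 (mirrorNoise u z)))
        ∂(stepLaw D r ν) =
        ∫⁻ z, ENNReal.ofReal (displacement η s₀ (sgdStep G η p.2.1 z)) ∂(stepLaw D r ν) :=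
      hmir.lintegral_comp (f := fun z => ENNReal.ofReal (displacement η s₀ (sgdStep G η p.2.1 z)))
        (hdm.comp hzm').ennreal_ofReal
    simp only [hU, coupledStep]
    have hm1 : Measurable fun z => ENNReal.ofReal (displacement η s₀ (sgdStep G η p.1 z)) :=
      (hdm.comp hzm).ennreal_ofReal
    rw [lintegral_add_left hm1, h3]
    refine (add_le_add h1 h2).trans (le_of_eq ?_)
    ring
  have hsucc : ∀ m, ∫⁻ p, U p ∂(k (m + 1)) ≤ t * ∫⁻ p in A, U p ∂(k m) + C m := by
    intro m
    -- The killed coupling is dominated by the full one, whose two marginals are both the law of a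
    -- genuine run; this brings in the gradients of a single uncoupled run.
    have hle : k m ≤ coupledLaw D r ν G η a u s₀ m :=
      localLaw_le_coupledLaw hG.measurable a u s₀ R m
    have hg1 : ∫⁻ p, g p.1 ∂(k m) ≤ ∫⁻ s, g s ∂(sgdLaw D r ν G η s₀ m) := by
      rw [← coupledLaw_map_fst hG.measurable a u, lintegral_map hgm' measurable_fst]
      exact lintegral_mono' hle le_rfl
    have hg2 : ∫⁻ p, g p.2.1 ∂(k m) ≤ ∫⁻ s, g s ∂(sgdLaw D r ν G η s₀ m) := by
      rw [← coupledLaw_map_snd_fst hG.measurable a u, lintegral_map hgm' measurable_snd.fst]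
      exact lintegral_mono' hle le_rfl
    calc ∫⁻ p, U p ∂(k (m + 1))
        = ∫⁻ p in A, ∫⁻ z, U (coupledStep G η a u p z) ∂(stepLaw D r ν) ∂(k m) :=
          lintegral_killedLaw_succ hstep m hUm
      _ ≤ ∫⁻ p in A, (t * U p + ((K * g p.1 + K * g p.2.1) + 2 * c)) ∂(k m) :=
          lintegral_mono fun p => hdrift p
      _ = t * ∫⁻ p in A, U p ∂(k m) +
            ∫⁻ p in A, ((K * g p.1 + K * g p.2.1) + 2 * c) ∂(k m) := by
          rw [lintegral_add_left (hUm.const_mul t), lintegral_const_mul t hUm]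
      _ ≤ t * ∫⁻ p in A, U p ∂(k m) +
            ∫⁻ p, ((K * g p.1 + K * g p.2.1) + 2 * c) ∂(k m) := by
          gcongr; exact Measure.restrict_le_self
      _ = t * ∫⁻ p in A, U p ∂(k m) +
            (K * ∫⁻ p, g p.1 ∂(k m) + K * ∫⁻ p, g p.2.1 ∂(k m) + 2 * c * k m Set.univ) := by
          have h1 : Measurable fun p : Coupled d => g p.1 := by fun_prop
          have h2 : Measurable fun p : Coupled d => g p.2.1 := by fun_prop
          rw [lintegral_add_right (fun p : Coupled d => K * g p.1 + K * g p.2.1) measurable_const,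
            lintegral_add_left (h1.const_mul K), lintegral_const_mul K h1,
            lintegral_const_mul K h2, lintegral_const]
      _ ≤ t * ∫⁻ p in A, U p ∂(k m) +
            (K * ∫⁻ s, g s ∂(sgdLaw D r ν G η s₀ m) + K * ∫⁻ s, g s ∂(sgdLaw D r ν G η s₀ m) +
              2 * c * 1) := by
          gcongr; exact hmass m
      _ = _ := by simp only [hC]; ring
  have hexit : ∀ m, ENNReal.ofReal (R ^ 2 / 3) * k m Aᶜ + ∫⁻ p in A, U p ∂(k m) ≤
      ∫⁻ p, U p ∂(k m) := by
    intro m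
    refine le_of_le_of_eq ?_ ((add_comm _ _).trans (lintegral_add_compl (μ := k m) U hA))
    refine add_le_add ?_ le_rfl
    rw [← setLIntegral_const]
    refine setLIntegral_mono' hA.compl fun p hp => ?_
    simp only [hAdef, localRegion, Set.mem_compl_iff, Set.mem_ofPred_eq, not_and_or, not_le] at hp
    rcases hp with hp | hp
    · refine le_trans (ENNReal.ofReal_le_ofReal ?_) le_self_add
      have h1 := norm_sub_sq_le_displacement η s₀ p.1
      have h2 := pow_le_pow_left₀ hR hp.le 2
      linarith
    · refine le_trans (ENNReal.ofReal_le_ofReal ?_) le_add_self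
      have h1 := norm_sub_sq_le_displacement η s₀ p.2.1
      have h2 := pow_le_pow_left₀ hR hp.le 2
      linarith
  have hsplit : ∀ m, 1 - k m A = (1 - k m Set.univ) + k m Aᶜ := by
    intro m
    have h1 : k m Set.univ = k m A + k m Aᶜ := (measure_add_measure_compl hA).symm
    have h2 := hmass m
    rw [h1] at h2 ⊢
    have h3 : k m Aᶜ ≤ 1 - k m A :=
      ENNReal.le_sub_of_add_le_left ((le_self_add.trans h2).trans_lt ENNReal.one_lt_top).ne h2
    rw [← tsub_tsub, tsub_add_cancel_of_le h3]
  have key : ∀ m, ∫⁻ p, U p ∂(k m) + ENNReal.ofReal (R ^ 2 / 3) * (1 - k m Set.univ) ≤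
      t ^ m * (ENNReal.ofReal (4 * η ^ 2 * ‖s₀.2‖ ^ 2) + ∑ j ∈ Finset.range m, C j) := by
    intro m
    induction m with
    | zero =>
      simp only [hk, localLaw, killedLaw]
      rw [lintegral_dirac' _ hUm]
      simp only [hU, displacement, sub_self, norm_zero, measure_univ, tsub_self]
      rw [← ENNReal.ofReal_add (by positivity) (by positivity)]
      simp only [mul_zero, add_zero, pow_zero, one_mul, Finset.range_zero, Finset.sum_empty]
      exact ENNReal.ofReal_le_ofReal (by linarith)
    | succ m ih =>
      have h1 : k (m + 1) Set.univ = k m A := killedLaw_univ_succ hstep m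
      rw [h1, hsplit, Finset.sum_range_succ, ← add_assoc, mul_add, mul_add]
      set q := ENNReal.ofReal (R ^ 2 / 3)
      calc ∫⁻ p, U p ∂(k (m + 1)) + (q * (1 - k m Set.univ) + q * k m Aᶜ)
          ≤ (t * ∫⁻ p in A, U p ∂(k m) + C m) +
              (t * (q * (1 - k m Set.univ)) + t * (q * k m Aᶜ)) := by
            exact add_le_add (hsucc m) (add_le_add (le_mul_of_one_le_left zero_le ht1)
              (le_mul_of_one_le_left zero_le ht1))
        _ = t * ((q * k m Aᶜ + ∫⁻ p in A, U p ∂(k m)) + q * (1 - k m Set.univ)) + C m := by ring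
        _ ≤ t * (∫⁻ p, U p ∂(k m) + q * (1 - k m Set.univ)) + C m := by
            gcongr; exact hexit m
        _ ≤ t * (t ^ m * (ENNReal.ofReal (4 * η ^ 2 * ‖s₀.2‖ ^ 2) + ∑ j ∈ Finset.range m, C j)) +
              t ^ (m + 1) * C m := by
            gcongr
            exact le_mul_of_one_le_left zero_le (one_le_pow₀ ht1)
        _ = _ := by ring
  have ht3 : t ^ n ≤ 3 := by
    rw [ht, ← ENNReal.ofReal_pow (by positivity)]
    calc _ ≤ ENNReal.ofReal 3 := ENNReal.ofReal_le_ofReal (one_add_inv_pow_le hn le_rfl)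
      _ = 3 := by norm_num
  calc ENNReal.ofReal (R ^ 2 / 3) * (1 - k n A)
      = ENNReal.ofReal (R ^ 2 / 3) * k n Aᶜ + ENNReal.ofReal (R ^ 2 / 3) * (1 - k n Set.univ) := by
        rw [hsplit, mul_add, add_comm]
    _ ≤ ∫⁻ p, U p ∂(k n) + ENNReal.ofReal (R ^ 2 / 3) * (1 - k n Set.univ) := by
        gcongr; exact le_self_add.trans (hexit n)
    _ ≤ _ := key n
    _ ≤ _ := by gcongr

end Exit

/-! ### Orders of magnitude of the parameters. -/

section Parameters

lemma two_mul_le_one_add_sq_sub_one {x : ℝ} (hx : 0 ≤ x) (hx1 : x ≤ 1) :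
    2 * x ≤ (1 + x) ^ 2 - 1 ∧ (1 + x) ^ 2 - 1 ≤ 3 * x := by
  constructor <;> nlinarith

/-- For `0 ≤ x ≤ 1` one has `exp x ≤ 1 + x + x² ≤ (1 + x)²`. -/
lemma exp_le_one_add_pow {x : ℝ} (hx : 0 ≤ x) (hx1 : x ≤ 1) (n : ℕ) :
    Real.exp (n * x) ≤ (1 + x) ^ (2 * n) := by
  rw [Real.exp_nat_mul, pow_mul]
  gcongr
  have := Real.abs_exp_sub_one_sub_id_le (x := x) (by rwa [abs_of_nonneg hx])
  have := (abs_le.1 this).2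
  nlinarith

/-- Standing assumptions on the parameters: `N` dominates all the constants of the problem class and
`w = ε ^ (1 / 4)`. -/
structure ParameterBounds (N w α μ η r R L ρ σ ℓ : ℝ) : Prop where
  hN : 10 ^ 31 ≤ N
  hw0 : 0 < w
  hw1 : w ≤ 1
  hα : 1 ≤ α
  hμ0 : 0 < μ
  hμ1 : μ ≤ 1
  -- In terms of `ε = w⁴` and up to powers of `N`: `μ = ε^(3/4) / √α`, `η = ε² / α`, `r² = α` and `R
  -- = √ε`.
  hμα : μ * √α = w ^ 3
  hη : η = w ^ 8 / (α * N ^ 20)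
  hr : r ^ 2 = α * N ^ 5
  hR : R = w ^ 2 / N ^ 4
  hL0 : 0 ≤ L
  hL : L ≤ N
  hρ0 : 0 ≤ ρ
  hρ : ρ ≤ N
  hρN : N⁻¹ ≤ ρ
  hσ0 : 0 ≤ σ
  hσ : σ ≤ N
  hℓ0 : 0 ≤ ℓ
  hℓ : ℓ ≤ N

namespace ParameterBounds

variable {N w α μ η r R L ρ σ ℓ : ℝ}

lemma N_pos (h : ParameterBounds N w α μ η r R L ρ σ ℓ) : 0 < N :=
  lt_of_lt_of_le (by norm_num) h.hN

lemma one_le_N (h : ParameterBounds N w α μ η r R L ρ σ ℓ) : 1 ≤ N :=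
  le_trans (by norm_num) h.hN

lemma η_pos (h : ParameterBounds N w α μ η r R L ρ σ ℓ) : 0 < η := by
  have := h.hα
  have := h.hw0
  have := h.N_pos
  rw [h.hη]; positivity

lemma R_pos (h : ParameterBounds N w α μ η r R L ρ σ ℓ) : 0 < R := by
  have := h.hw0
  have := h.N_pos
  rw [h.hR]; positivity

lemma η_le (h : ParameterBounds N w α μ η r R L ρ σ ℓ) : η ≤ w ^ 8 / N ^ 20 := by
  have := h.hα
  have := h.hw0
  have := h.N_pos
  rw [h.hη]
  gcongr
  exact le_mul_of_one_le_left (by positivity) h.hα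

/-- This ratio measures the effect of compression: it controls both the stationary error ratio `q`
and the weight of the error in the Lyapunov function. -/
lemma η_div_μ_le (h : ParameterBounds N w α μ η r R L ρ σ ℓ) : η / μ ≤ w ^ 5 / N ^ 20 := by
  have hα := h.hα
  have hw := h.hw0
  have hN := h.N_pos
  have hμ := h.hμ0
  have hs : 1 ≤ √α := Real.one_le_sqrt.2 hα
  have hsα : √α * √α = α := Real.mul_self_sqrt (by linarith)
  rw [div_le_iff₀ hμ, h.hη, div_mul_eq_mul_div]
  rw [div_le_div_iff₀ (by positivity) (by positivity)]
  have h1 : w ^ 8 = w ^ 5 * (μ * √α) := by rw [h.hμα]; ring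
  calc w ^ 8 * N ^ 20 = w ^ 5 * μ * (√α * 1) * N ^ 20 := by rw [h1]; ring
    _ ≤ w ^ 5 * μ * (√α * √α) * N ^ 20 := by gcongr
    _ = _ := by rw [hsα]; ring

lemma pow_w_le_one (h : ParameterBounds N w α μ η r R L ρ σ ℓ) (k : ℕ) : w ^ k ≤ 1 :=
  pow_le_one₀ h.hw0.le h.hw1

lemma div_N_pow_le (h : ParameterBounds N w α μ η r R L ρ σ ℓ) {c : ℝ} (hc : 0 ≤ c) {k : ℕ}
    (hk : k ≠ 0) : c / N ^ k ≤ c / 10 ^ 31 := by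
  gcongr
  exact h.hN.trans (le_self_pow₀ h.one_le_N hk)

lemma η_le_one (h : ParameterBounds N w α μ η r R L ρ σ ℓ) : η ≤ 1 := by
  have hN := h.N_pos
  have := h.pow_w_le_one 8
  calc η ≤ w ^ 8 / N ^ 20 := h.η_le
    _ ≤ 1 / N ^ 20 := by gcongr
    _ ≤ 1 / 10 ^ 31 := h.div_N_pow_le (by norm_num) (by norm_num)
    _ ≤ 1 := by norm_num

lemma η_mul_N_le (h : ParameterBounds N w α μ η r R L ρ σ ℓ) : η * N ≤ 1 / 10 ^ 31 := by
  have hN := h.N_pos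
  have := h.pow_w_le_one 8
  calc η * N ≤ w ^ 8 / N ^ 20 * N := by gcongr; exact h.η_le
    _ ≤ 1 / N ^ 20 * N := by gcongr
    _ = 1 / N ^ 19 := by field_simp
    _ ≤ 1 / 10 ^ 31 := h.div_N_pow_le (by norm_num) (by norm_num)

variable {γ : ℝ}

/-- `q` and `ω` are taken to satisfy their defining inequalities with equality; what needs proof is
that they are small over an escape time, for which `n η ≤ 2 N² / w²`. -/
lemma exists_moment_parameters (h : ParameterBounds N w α μ η r R L ρ σ ℓ) {d : ℕ} (hd : 0 < d)
    {s : ℝ} (hs : s ^ 2 * d * N ^ 2 ≤ r ^ 2) (hγ : w ^ 2 / N ≤ γ) (hγL : γ ≤ L) {n : ℕ}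
    (hn : n * (η * γ) ≤ 2 * N) (hn1 : 1 ≤ n) :
    let v := 4 * η ^ 2 * (r ^ 2 / d) / ((1 + η * γ) ^ 2 - 1)
    ∃ q ω : ℝ,
      (1 + n) * η ^ 2 * (18 * (ρ * R) ^ 2 + 2 * L ^ 2 * q) + 9 * η ^ 2 * ℓ ^ 2 +
        η ^ 2 * s ^ 2 / v ≤ ω ∧ 3 * n * ω ≤ 1 / 100 ∧ q ≤ 1 / 100 ∧
      3 * η ^ 2 * (9 * L ^ 2 / μ + 3 * ℓ ^ 2) + η ^ 2 * s ^ 2 / v + ((1 + η * γ) ^ 2 - 1) ≤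
        μ / 2 * q := by
  intro v
  have hN := h.N_pos
  have hN1 := h.one_le_N
  have hw := h.hw0
  have hη := h.η_pos
  have hμ := h.hμ0
  have hα := h.hα
  have hL0 := h.hL0
  have hℓ0 := h.hℓ0
  have hρ0 := h.hρ0
  have hR0 := h.R_pos
  have hd' : (0 : ℝ) < d := by exact_mod_cast hd
  have hγ0 : 0 < γ := lt_of_lt_of_le (by positivity) hγ
  have hγN : γ ≤ N := hγL.trans h.hL
  have hr0 : 0 < r ^ 2 := by rw [h.hr]; positivity
  have hx1 : η * γ ≤ 1 := by
    calc η * γ ≤ η * N := by gcongr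
      _ ≤ 1 / 10 ^ 31 := h.η_mul_N_le
      _ ≤ 1 := by norm_num
  obtain ⟨hb1, hb2⟩ := two_mul_le_one_add_sq_sub_one (by positivity : 0 ≤ η * γ) hx1
  set b := (1 + η * γ) ^ 2 - 1 with hb
  have hb0 : 0 < b := lt_of_lt_of_le (by positivity) hb1
  -- The part of the oracle noise that does not shrink with the distance is negligible against the
  -- artificial noise in one direction, by `hs`. Over `n` steps it contributes only `O(1 / N)`.
  have hsv : η ^ 2 * s ^ 2 / v ≤ η * γ / N ^ 2 := by
    have h1 : η ^ 2 * s ^ 2 / v = b * (s ^ 2 * d) / (4 * r ^ 2) := by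
      change η ^ 2 * s ^ 2 / (4 * η ^ 2 * (r ^ 2 / d) / b) = _
      field_simp
    rw [h1, div_le_div_iff₀ (by positivity) (by positivity)]
    calc b * (s ^ 2 * d) * N ^ 2 = b * (s ^ 2 * d * N ^ 2) := by ring
      _ ≤ (3 * (η * γ)) * r ^ 2 := by gcongr
      _ ≤ η * γ * (4 * r ^ 2) := by nlinarith [mul_pos (mul_pos hη hγ0) hr0]
  have hz := h.η_div_μ_le
  set z := η / μ with hzdef
  have hz0 : 0 < z := by positivity
  have hw5 := h.pow_w_le_one 5
  set q := 2 / μ * (3 * η ^ 2 * (9 * L ^ 2 / μ + 3 * ℓ ^ 2) + η ^ 2 * s ^ 2 / v + b) with hq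
  have hqle : q ≤ 100 * w ^ 5 / N ^ 18 := by
    have h1 : q = 54 * L ^ 2 * (z * z) + 18 * ℓ ^ 2 * (η * z) +
        2 / μ * (η ^ 2 * s ^ 2 / v) + 2 / μ * b := by
      rw [hq, hzdef]; field_simp; ring
    have hz1 : z ≤ 1 := by
      calc z ≤ w ^ 5 / N ^ 20 := hz
        _ ≤ 1 / N ^ 20 := by gcongr
        _ ≤ 1 / 10 ^ 31 := h.div_N_pow_le (by norm_num) (by norm_num)
        _ ≤ 1 := by norm_num
    have hzN : N ^ 2 * z ≤ w ^ 5 / N ^ 18 := by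
      calc N ^ 2 * z ≤ N ^ 2 * (w ^ 5 / N ^ 20) := by gcongr
        _ = w ^ 5 / N ^ 18 := by field_simp
    have h2 : 54 * L ^ 2 * (z * z) ≤ 54 * (N ^ 2 * z) := by
      calc 54 * L ^ 2 * (z * z) ≤ 54 * N ^ 2 * (z * 1) := by gcongr; exact h.hL
        _ = _ := by ring
    have h3 : 18 * ℓ ^ 2 * (η * z) ≤ 18 * (N ^ 2 * z) := by
      calc 18 * ℓ ^ 2 * (η * z) ≤ 18 * N ^ 2 * (1 * z) := by
            gcongr; exacts [h.hℓ, h.η_le_one]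
        _ = _ := by ring
    have hγN2 : γ ≤ N ^ 2 := hγN.trans (le_self_pow₀ hN1 (by norm_num))
    have h4 : 2 / μ * (η ^ 2 * s ^ 2 / v) ≤ 2 * (N ^ 2 * z) := by
      calc 2 / μ * (η ^ 2 * s ^ 2 / v) ≤ 2 / μ * (η * γ / N ^ 2) := by gcongr
        _ ≤ 2 / μ * (η * N ^ 2 / 1) := by
            gcongr; exact one_le_pow₀ hN1
        _ = _ := by rw [hzdef]; field_simp
    have h5 : 2 / μ * b ≤ 6 * (N ^ 2 * z) := by
      calc 2 / μ * b ≤ 2 / μ * (3 * (η * N ^ 2)) := by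
            gcongr; exact hb2.trans (by gcongr)
        _ = _ := by rw [hzdef]; field_simp; ring
    calc q ≤ 80 * (N ^ 2 * z) := by rw [h1]; linarith
      _ ≤ 100 * (w ^ 5 / N ^ 18) := by gcongr; norm_num
      _ = _ := by ring
  have hsv0 : 0 ≤ η ^ 2 * s ^ 2 / v := by
    have : 0 < v := by simp only [v]; positivity
    positivity
  have hq0 : 0 ≤ q := by positivity
  refine ⟨q, _, le_rfl, ?_, ?_, ?_⟩
  · have hnη : n * η ≤ 2 * N ^ 2 / w ^ 2 := by
      have h1 : n * η = n * (η * γ) / γ := by field_simp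
      rw [h1]
      calc n * (η * γ) / γ ≤ 2 * N / (w ^ 2 / N) := by gcongr
        _ = _ := by field_simp
    have hn1' : (1 : ℝ) ≤ n := by exact_mod_cast hn1
    set P := n * η with hP
    have hP0 : 0 < P := by positivity
    have e1 : 3 * n * ((1 + n) * η ^ 2 * (18 * (ρ * R) ^ 2 + 2 * L ^ 2 * q) + 9 * η ^ 2 * ℓ ^ 2 +
        η ^ 2 * s ^ 2 / v) ≤ 108 * P ^ 2 * (ρ * R) ^ 2 + 12 * P ^ 2 * (L ^ 2 * q) +
        27 * P * (η * ℓ ^ 2) + 3 * n * (η ^ 2 * s ^ 2 / v) := by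
      have h2 : (1 + n) * η ^ 2 * (18 * (ρ * R) ^ 2 + 2 * L ^ 2 * q) ≤
          (n + n) * η ^ 2 * (18 * (ρ * R) ^ 2 + 2 * L ^ 2 * q) := by gcongr
      have h3 := mul_le_mul_of_nonneg_left h2 (show (0 : ℝ) ≤ 3 * n by positivity)
      rw [hP]
      linarith
    -- The choice of `R` is made here: over the escape time, `n η ρ R` is `O(1 / N)`, so the Hessian
    -- at the saddle describes the whole window.
    have t1 : 108 * P ^ 2 * (ρ * R) ^ 2 ≤ 432 / 10 ^ 31 := by
      calc 108 * P ^ 2 * (ρ * R) ^ 2 ≤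
            108 * (2 * N ^ 2 / w ^ 2) ^ 2 * (N * (w ^ 2 / N ^ 4)) ^ 2 := by
            rw [h.hR]; gcongr; exact h.hρ
        _ = 432 / N ^ 2 := by field_simp; norm_num
        _ ≤ 432 / 10 ^ 31 := h.div_N_pow_le (by norm_num) (by norm_num)
    -- The effect of compression: `q = O(w⁵)` against the squared escape time `O(w⁻⁴)`, with a power
    -- of `w` to spare.
    have t2 : 12 * P ^ 2 * (L ^ 2 * q) ≤ 4800 / 10 ^ 31 := by
      calc 12 * P ^ 2 * (L ^ 2 * q) ≤
            12 * (2 * N ^ 2 / w ^ 2) ^ 2 * (N ^ 2 * (100 * w ^ 5 / N ^ 18)) := by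
            gcongr; exact h.hL
        _ = 4800 * w / N ^ 12 := by field_simp; norm_num
        _ ≤ 4800 * 1 / N ^ 12 := by gcongr; exact h.hw1
        _ = 4800 / N ^ 12 := by norm_num
        _ ≤ 4800 / 10 ^ 31 := h.div_N_pow_le (by norm_num) (by norm_num)
    have t3 : 27 * P * (η * ℓ ^ 2) ≤ 54 / 10 ^ 31 := by
      have := h.pow_w_le_one 6
      calc 27 * P * (η * ℓ ^ 2) ≤ 27 * (2 * N ^ 2 / w ^ 2) * (w ^ 8 / N ^ 20 * N ^ 2) := by
            gcongr; exacts [h.η_le, h.hℓ]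
        _ = 54 * w ^ 6 / N ^ 16 := by field_simp; norm_num
        _ ≤ 54 * 1 / N ^ 16 := by gcongr
        _ = 54 / N ^ 16 := by norm_num
        _ ≤ 54 / 10 ^ 31 := h.div_N_pow_le (by norm_num) (by norm_num)
    have t4 : 3 * n * (η ^ 2 * s ^ 2 / v) ≤ 6 / 10 ^ 31 := by
      calc 3 * n * (η ^ 2 * s ^ 2 / v) ≤ 3 * n * (η * γ / N ^ 2) := by gcongr
        _ = 3 * (n * (η * γ)) / N ^ 2 := by ring
        _ ≤ 3 * (2 * N) / N ^ 2 := by gcongr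
        _ = 6 / N ^ 1 := by field_simp; norm_num
        _ ≤ 6 / 10 ^ 31 := h.div_N_pow_le (by norm_num) (by norm_num)
    refine e1.trans ?_
    refine (add_le_add (add_le_add (add_le_add t1 t2) t3) t4).trans (by norm_num)
  · calc q ≤ 100 * w ^ 5 / N ^ 18 := hqle
      _ ≤ 100 * 1 / N ^ 18 := by gcongr
      _ ≤ 100 * 1 / 10 ^ 31 := h.div_N_pow_le (by norm_num) (by norm_num)
      _ ≤ 1 / 100 := by norm_num
  · rw [hq]
    refine le_of_eq ?_
    field_simp

end ParameterBounds

end Parameters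

/-! ### Escape from a strict saddle within one window. -/

section Window

variable {d : ℕ} {Θ : Type u} [MeasurableSpace Θ] {D : Measure Θ}
  {r : ℝ} {ν : PMF (Finset (Fin d))} {f : Vec d → ℝ} {G : Vec d → Θ → Vec d}
  {η μ σ fmax L ρ ℓ s N w α R : ℝ}

/-- From a strict saddle point, the iterates leave the ball of radius `R` within `I` iterations with
probability at least `1 / 12`. -/
lemma exists_exit_time [IsProbabilityMeasure D]
    (h : ParameterBounds N w α μ η r R L ρ σ ℓ) (hd : 0 < d) (hf : SmoothObjective f fmax L ρ)
    (hG : StochasticOracle D f G σ) (hdiff : NoiseDifferenceBound D f G ℓ s)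
    (hν : IsCompressor ν μ) (hs : s ^ 2 * d * N ^ 2 ≤ r ^ 2)
    (hgrow : 241 * d * N ^ 21 ≤ Real.exp N * w ^ 8) {s₀ : Vec d × Vec d}
    (hsaddle : ¬ IsSOSP f ρ (w ^ 4) s₀.1) (hgrad : ‖∇ f s₀.1‖ ≤ w ^ 4) {I : ℕ}
    (hI : N ^ 2 / (η * w ^ 2) + 1 ≤ I) :
    ∃ (γ : ℝ) (u : Vec d) (n : ℕ), 0 < n ∧ n ≤ I ∧ N ≤ n * (η * N) ∧ n * η ≤ 2 * N ^ 2 / w ^ 2 ∧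
      ENNReal.ofReal (1 / 12) ≤
        1 - localLaw D r ν G η (1 + η * γ) u s₀ R n (localRegion s₀.1 R) := by
  have hN := h.N_pos
  have hN1 := h.one_le_N
  have hw := h.hw0
  have hη := h.η_pos
  have hμ := h.hμ0
  have hα := h.hα
  have hR0 := h.R_pos
  have hd' : (0 : ℝ) < d := by exact_mod_cast hd
  obtain ⟨γ, u, hγ, hγL, hu, hHu, hH⟩ := exists_negative_curvature hf h.hL0 hsaddle hgrad
  have hηN := h.η_mul_N_le
  have hγw : w ^ 2 / N ≤ γ := by
    refine le_trans (Real.le_sqrt_of_sq_le ?_) hγ.le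
    calc (w ^ 2 / N) ^ 2 = (N * N)⁻¹ * w ^ 4 := by field_simp
      _ ≤ (N * 1)⁻¹ * w ^ 4 := by gcongr
      _ = N⁻¹ * w ^ 4 := by rw [mul_one]
      _ ≤ ρ * w ^ 4 := by gcongr; exact h.hρN
  have hγ0 : 0 < γ := lt_of_lt_of_le (by positivity) hγw
  have hγN : γ ≤ N := hγL.trans h.hL
  have hx0 : 0 < η * γ := by positivity
  have hx1 : η * γ ≤ 1 := by
    calc η * γ ≤ η * N := by gcongr
      _ ≤ 1 := hηN.trans (by norm_num)
  -- Long enough for `(1 + η γ) ^ (2 n) ≥ exp N`, and short enough for `n η γ ≤ 2 N`. It depends on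
  -- `γ`; `I` is a bound that does not.
  set n := ⌈N / (η * γ)⌉₊ with hn
  have hn1 : N / (η * γ) ≤ n := Nat.le_ceil _
  have hn2 : (n : ℝ) < N / (η * γ) + 1 := Nat.ceil_lt_add_one (by positivity)
  have hnN : N ≤ n * (η * γ) := by rwa [div_le_iff₀ hx0] at hn1
  have hn2N : n * (η * γ) ≤ 2 * N := by
    have : n * (η * γ) ≤ (N / (η * γ) + 1) * (η * γ) := by gcongr
    rw [add_mul, div_mul_cancel₀ _ hx0.ne'] at this
    linarith
  have hn0 : 0 < n := by
    rcases Nat.eq_zero_or_pos n with h0 | h0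
    · rw [h0] at hnN; simp at hnN; linarith
    · exact h0
  have hnI : n ≤ I := by
    have : (n : ℝ) ≤ I := by
      refine hn2.le.trans (le_trans ?_ hI)
      gcongr ?_ + 1
      calc N / (η * γ) ≤ N / (η * (w ^ 2 / N)) := by gcongr
        _ = _ := by field_simp
    exact_mod_cast this
  have hn1' : (1 : ℝ) ≤ n := by exact_mod_cast hn0
  obtain ⟨q, ω, hω, hωn, hq1, hq⟩ := h.exists_moment_parameters hd hs hγw hγL hn2N hn0
  obtain ⟨hb1, hb2⟩ := two_mul_le_one_add_sq_sub_one hx0.le hx1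
  have hηr : η * r ^ 2 = w ^ 8 / N ^ 15 := by
    rw [h.hη, h.hr]; field_simp
  have hr0 : 0 < r ^ 2 := by rw [h.hr]; positivity
  have hexp := exp_le_one_add_pow hx0.le hx1 n
  have hexpN : Real.exp N ≤ (1 + η * γ) ^ (2 * n) := le_trans (Real.exp_le_exp.2 hnN) hexp
  set v := 4 * η ^ 2 * (r ^ 2 / d) / ((1 + η * γ) ^ 2 - 1) with hv
  have hb0 : 0 < (1 + η * γ) ^ 2 - 1 := lt_of_lt_of_le (by positivity) hb1
  have hv0 : 0 < v := by positivity
  -- The initial scale `v` is only polynomially small in `d` and `1 / ε`, so growth by `exp N`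
  -- suffices once `N` exceeds a multiple of `log (d / ε)`.
  have hvle : w ^ 8 / (d * N ^ 16) ≤ v := by
    calc w ^ 8 / (d * N ^ 16) = η * r ^ 2 / (d * N) := by rw [hηr]; field_simp
      _ ≤ η * r ^ 2 / (d * γ) := by gcongr
      _ ≤ 4 / 3 * (η * r ^ 2 / (d * γ)) := by
          have : 0 ≤ η * r ^ 2 / (d * γ) := by positivity
          linarith
      _ = 4 * η ^ 2 * (r ^ 2 / d) / (3 * (η * γ)) := by field_simp
      _ ≤ v := by rw [hv]; gcongr
  have hA : 240 * R ^ 2 < (1 + η * γ) ^ (2 * n) * v := by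
    have hR1 : R ^ 2 ≤ 1 := by
      have := h.pow_w_le_one 4
      calc R ^ 2 = w ^ 4 / N ^ 8 := by rw [h.hR]; field_simp
        _ ≤ 1 / 1 := by gcongr; exact one_le_pow₀ hN1
        _ = 1 := by norm_num
    calc 240 * R ^ 2 < 241 := by linarith
      _ ≤ Real.exp N * w ^ 8 / (d * N ^ 21) := by
          rw [le_div_iff₀ (by positivity)]; linarith
      _ ≤ Real.exp N * w ^ 8 / (d * N ^ 16) := by gcongr; norm_num
      _ = Real.exp N * (w ^ 8 / (d * N ^ 16)) := by ring
      _ ≤ (1 + η * γ) ^ (2 * n) * v := by gcongr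
  have hB : 10 ≤ (1 + η * γ) ^ (2 * n) := by
    have := Real.add_one_le_exp N
    have := h.hN
    linarith
  have hk := localLaw_region_le (r := r) (R := R) hf h.hL0 h.hρ0 hG hdiff hν hμ h.hμ1 hu hx0 hHu
    (fun v => hH η hη.le (by
      calc η * L ≤ η * N := by gcongr; exact h.hL
        _ ≤ 1 := hηN.trans (by norm_num)) v) hv0
    (by rw [hv]; field_simp) hn0 hω hωn hq1 hq hA hB
  have hηnn : n * η ≤ 2 * N ^ 2 / w ^ 2 := by
    have h1 : n * η = n * (η * γ) / γ := by field_simp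
    rw [h1]
    calc n * (η * γ) / γ ≤ 2 * N / (w ^ 2 / N) := by gcongr
      _ = _ := by field_simp
  refine ⟨γ, u, n, hn0, hnI, hnN.trans (by gcongr), hηnn, ?_⟩
  refine le_trans (le_of_eq ?_) (tsub_le_tsub_left hk 1)
  rw [← ENNReal.ofReal_one, ← ENNReal.ofReal_sub _ (by norm_num)]
  norm_num

/-- After a strict saddle point, the gradients within the next `I` iterations are large. -/
lemma radius_sq_le_sum_gradient [IsProbabilityMeasure D]
    (h : ParameterBounds N w α μ η r R L ρ σ ℓ) (hd : 0 < d) (hf : SmoothObjective f fmax L ρ)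
    (hG : StochasticOracle D f G σ) (hdiff : NoiseDifferenceBound D f G ℓ s)
    (hν : IsCompressor ν μ) (hs : s ^ 2 * d * N ^ 2 ≤ r ^ 2)
    (hgrow : 241 * d * N ^ 21 ≤ Real.exp N * w ^ 8) {s₀ : Vec d × Vec d}
    (hsaddle : ¬ IsSOSP f ρ (w ^ 4) s₀.1) (hgrad : ‖∇ f s₀.1‖ ≤ w ^ 4) {I : ℕ}
    (hI : N ^ 2 / (η * w ^ 2) + 1 ≤ I) :
    ENNReal.ofReal (R ^ 2) ≤ ENNReal.ofReal (864 * η ^ 2 * ‖s₀.2‖ ^ 2) +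
      ENNReal.ofReal (2160 * I * η ^ 2) *
        ∑ j ∈ Finset.range I, ∫⁻ s, ENNReal.ofReal (‖∇ f s.1‖ ^ 2) ∂(sgdLaw D r ν G η s₀ j) := by
  have hN := h.N_pos
  have hN1 := h.one_le_N
  have hw := h.hw0
  have hη := h.η_pos
  have hμ := h.hμ0
  have hα := h.hα
  have hR0 := h.R_pos
  obtain ⟨γ, u, n, hn0, hnI, hnN, hηnn, hk⟩ := exists_exit_time h hd hf hG hdiff hν hs hgrow hsaddle
    hgrad hI
  have hηr : η * r ^ 2 = w ^ 8 / N ^ 15 := by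
    rw [h.hη, h.hr]; field_simp
  have hexit := exit_probability_le (r := r) (η := η) (a := 1 + η * γ) (u := u) hd hf hG hν hμ h.hμ1
    s₀ hR0.le hn0
  set g : ℕ → ℝ≥0∞ := fun j =>
    ∫⁻ s, ENNReal.ofReal (‖∇ f s.1‖ ^ 2) ∂(sgdLaw D r ν G η s₀ j) with hg
  have h36 : ENNReal.ofReal (R ^ 2 / 36) ≤
      ENNReal.ofReal (12 * η ^ 2 * ‖s₀.2‖ ^ 2) +
        ENNReal.ofReal (30 * I * η ^ 2) * ∑ j ∈ Finset.range I, g j +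
        ENNReal.ofReal (R ^ 2 / 72) := by
    calc ENNReal.ofReal (R ^ 2 / 36) = ENNReal.ofReal (R ^ 2 / 3) * ENNReal.ofReal (1 / 12) := by
          rw [← ENNReal.ofReal_mul (by positivity)]; congr 1; ring
      _ ≤ _ := mul_le_mul_right hk _
      _ ≤ _ := hexit
      _ = ENNReal.ofReal (12 * η ^ 2 * ‖s₀.2‖ ^ 2) +
            ENNReal.ofReal (6 * ((1 + n + 3 / μ) * η ^ 2)) * ∑ j ∈ Finset.range n, g j +
            ENNReal.ofReal (12 * n * η ^ 2 * (σ ^ 2 + r ^ 2)) := by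
          rw [Finset.sum_add_distrib, ← Finset.mul_sum, ← Finset.mul_sum, Finset.sum_const,
            Finset.card_range, nsmul_eq_mul,
            show (12 * η ^ 2 * ‖s₀.2‖ ^ 2) = 3 * (4 * η ^ 2 * ‖s₀.2‖ ^ 2) by ring,
            show 12 * n * η ^ 2 * (σ ^ 2 + r ^ 2) = 6 * (n * (2 * η ^ 2 * (σ ^ 2 + r ^ 2))) by ring,
            ENNReal.ofReal_mul (p := 3) (by norm_num), ENNReal.ofReal_mul (p := 6) (by norm_num),
            ENNReal.ofReal_mul (p := 6) (by norm_num), ENNReal.ofReal_mul (p := (n : ℝ))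
              (by positivity), ENNReal.ofReal_natCast]
          simp only [ENNReal.ofReal_ofNat, hg]
          ring
      _ ≤ _ := by
          refine add_le_add (add_le_add le_rfl (mul_le_mul' (ENNReal.ofReal_le_ofReal ?_) ?_))
            (ENNReal.ofReal_le_ofReal ?_)
          -- The window outlasts the relaxation time `1 / μ` of the compression error: `1 / μ ≤ 1 /
          -- η ≤ n`. The last inequality is `hnN`.
          · have h1 : 1 / μ ≤ n := by
              have h2 : η / μ ≤ 1 := by
                calc η / μ ≤ w ^ 5 / N ^ 20 := h.η_div_μ_le
                  _ ≤ 1 / 1 := by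
                    gcongr
                    · exact h.pow_w_le_one 5
                    · exact one_le_pow₀ hN1
                  _ = 1 := by norm_num
              have h3 : 1 / μ ≤ 1 / η := by
                rw [div_le_one hμ] at h2
                gcongr
              refine h3.trans ?_
              rw [div_le_iff₀ hη]
              have h5 : N * 1 ≤ N * (n * η) := by linarith
              exact le_of_mul_le_mul_left h5 hN
            have h6 : (n : ℝ) ≤ I := by exact_mod_cast hnI
            have hn1' : (1 : ℝ) ≤ n := by exact_mod_cast hn0
            have h7 : 1 + n + 3 / μ ≤ 5 * I := by
              rw [show 3 / μ = 3 * (1 / μ) by ring]; linarith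
            calc 6 * ((1 + n + 3 / μ) * η ^ 2) ≤ 6 * (5 * I * η ^ 2) := by gcongr
              _ = _ := by ring
          · exact Finset.sum_le_sum_of_subset (Finset.range_mono hnI)
          -- Diffusion over the window is of order `(n η)(η r²)`, at most a constant times `w⁶ /
          -- N¹³`. This is far below `R² = w⁴ / N⁸`, so the noise accounts for at most half of the
          -- required displacement.
          · have hσr : σ ^ 2 ≤ r ^ 2 := by
              rw [h.hr]
              have h1 : σ ^ 2 ≤ N ^ 2 := pow_le_pow_left₀ h.hσ0 h.hσ 2
              have h2 : N ^ 2 ≤ N ^ 5 := pow_le_pow_right₀ hN1 (by norm_num)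
              exact (h1.trans h2).trans (le_mul_of_one_le_left (by positivity) hα)
            calc 12 * n * η ^ 2 * (σ ^ 2 + r ^ 2) ≤ 12 * n * η ^ 2 * (r ^ 2 + r ^ 2) := by gcongr
              _ = 24 * (n * η) * (η * r ^ 2) := by ring
              _ ≤ 24 * (2 * N ^ 2 / w ^ 2) * (w ^ 8 / N ^ 15) := by rw [hηr]; gcongr
              _ = w ^ 4 / N ^ 8 * (48 * w ^ 2 / N ^ 5) := by field_simp; norm_num
              _ ≤ w ^ 4 / N ^ 8 * (48 * 1 / 10 ^ 31) := by
                  gcongr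
                  · exact h.pow_w_le_one 2
                  · exact h.hN.trans (le_self_pow₀ hN1 (by norm_num))
              _ ≤ w ^ 4 / N ^ 8 * (1 / 72) :=
                  mul_le_mul_of_nonneg_left (by norm_num) (by positivity)
              _ = R ^ 2 / 72 := by rw [h.hR]; field_simp
  have h72 : ENNReal.ofReal (R ^ 2 / 72) ≤ ENNReal.ofReal (12 * η ^ 2 * ‖s₀.2‖ ^ 2) +
        ENNReal.ofReal (30 * I * η ^ 2) * ∑ j ∈ Finset.range I, g j := by
    rw [show R ^ 2 / 36 = R ^ 2 / 72 + R ^ 2 / 72 by ring,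
      ENNReal.ofReal_add (by positivity) (by positivity)] at h36
    exact (ENNReal.add_le_add_iff_right ENNReal.ofReal_ne_top).1 h36
  calc ENNReal.ofReal (R ^ 2) = ENNReal.ofReal 72 * ENNReal.ofReal (R ^ 2 / 72) := by
        rw [← ENNReal.ofReal_mul (by norm_num)]; congr 1; ring
    _ ≤ _ := mul_le_mul_right h72 _
    _ = _ := by
        rw [mul_add, ← mul_assoc, ← ENNReal.ofReal_mul (by norm_num),
          ← ENNReal.ofReal_mul (by norm_num), show 72 * (12 * η ^ 2 * ‖s₀.2‖ ^ 2) =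
            864 * η ^ 2 * ‖s₀.2‖ ^ 2 by ring, show 72 * (30 * I * η ^ 2) = 2160 * I * η ^ 2 by ring]

end Window

/-! ### Counting the iterates that are not second-order stationary. -/

section Counting

variable {d : ℕ} {Θ : Type u} [MeasurableSpace Θ] {D : Measure Θ}
  {r : ℝ} {ν : PMF (Finset (Fin d))} {f : Vec d → ℝ} {G : Vec d → Θ → Vec d}
  {η μ σ fmax L ρ ℓ s N w α R : ℝ}

/-- The squared gradient norm plus a multiple of the squared compression error. -/
def energy (f : Vec d → ℝ) (N η : ℝ) (s : Vec d × Vec d) : ℝ :=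
  ‖∇ f s.1‖ ^ 2 + 4 * (N ^ 2 * η ^ 2) * ‖s.2‖ ^ 2

lemma measurable_energy (hf : SmoothObjective f fmax L ρ) : Measurable (energy f N η) := by
  have hgm : Measurable (∇ f) := hf.continuous_gradient.measurable
  unfold energy
  fun_prop

lemma sum_lintegral_energy_le [IsProbabilityMeasure D]
    (h : ParameterBounds N w α μ η r R L ρ σ ℓ) (hd : 0 < d) (hf : SmoothObjective f fmax L ρ)
    (hfmax : 0 ≤ fmax) (hfN : fmax ≤ N) (hG : StochasticOracle D f G σ) (hν : IsCompressor ν μ)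
    (x₀ : Vec d) {T T' : ℕ} (hT : α * N ^ 34 / w ^ 16 ≤ T) (hTT : T' ≤ 2 * T) :
    ∑ t ∈ Finset.range T', ∫⁻ s, ENNReal.ofReal (energy f N η s) ∂(sgdLaw D r ν G η (x₀, 0) t) ≤
      ENNReal.ofReal (72 * T * w ^ 8 / N ^ 13) := by
  have hN := h.N_pos
  have hN1 := h.one_le_N
  have hw := h.hw0
  have hη := h.η_pos
  have hμ := h.hμ0
  have hα := h.hα
  have hL := h.hL
  have hL0 := h.hL0
  have hηN := h.η_mul_N_le
  have hημ : η / μ ≤ 1 / N ^ 20 := h.η_div_μ_le.trans (by gcongr; exact h.pow_w_le_one 5)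
  have hTT' : (T' : ℝ) ≤ 2 * T := by exact_mod_cast hTT
  have hr0 : 0 ≤ r ^ 2 := sq_nonneg r
  refine (sum_lintegral_gradient_le hd hf hfmax hL0 hG hν hμ h.hμ1 hη ?_
    (κ := N ^ 2 * η ^ 2) (by gcongr) ?_ x₀ T').trans (ENNReal.ofReal_le_ofReal ?_)
  · calc 4 * (η * L) ≤ 4 * (η * N) := by gcongr
      _ ≤ 4 * (1 / 10 ^ 31) := by gcongr
      _ ≤ 1 := by norm_num
  · have h48 : 48 * (N ^ 2 * (η / μ) ^ 2) ≤ 1 := by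
      calc 48 * (N ^ 2 * (η / μ) ^ 2) ≤ 48 * (N ^ 2 * (1 / N ^ 20) ^ 2) := by gcongr
        _ = 48 / N ^ 38 := by field_simp
        _ ≤ 1 := by
          rw [div_le_one (by positivity)]
          calc (48 : ℝ) ≤ 10 ^ 31 := by norm_num
            _ ≤ N := h.hN
            _ ≤ N ^ 38 := le_self_pow₀ hN1 (by norm_num)
    calc 48 * (N ^ 2 * η ^ 2) = 48 * (N ^ 2 * (η / μ) ^ 2) * μ ^ 2 := by field_simp
      _ ≤ 1 * μ ^ 2 := by gcongr
      _ = μ ^ 2 := one_mul _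
  -- This is what the power `N ^ 34` in the lower bound on `T` is for.
  · have hfη : fmax / η ≤ T * (w ^ 8 / N ^ 13) := by
      calc fmax / η ≤ N / η := by gcongr
        _ = α * N ^ 34 / w ^ 16 * (w ^ 8 / N ^ 13) := by rw [h.hη]; field_simp
        _ ≤ T * (w ^ 8 / N ^ 13) := by gcongr
    have hV : σ ^ 2 + r ^ 2 ≤ 2 * (α * N ^ 5) := by
      have h1 : σ ^ 2 ≤ N ^ 2 := pow_le_pow_left₀ h.hσ0 h.hσ 2
      have h2 : N ^ 2 ≤ N ^ 5 := pow_le_pow_right₀ hN1 (by norm_num)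
      have h3 : N ^ 5 ≤ α * N ^ 5 := le_mul_of_one_le_left (by positivity) hα
      rw [h.hr]; linarith
    have hLη : L * η ≤ w ^ 8 / (α * N ^ 19) := by
      calc L * η ≤ N * η := by gcongr
        _ = w ^ 8 / (α * N ^ 19) := by rw [h.hη]; field_simp
    have hκμ : 2 * (N ^ 2 * η ^ 2) / μ ≤ w ^ 8 / (α * N ^ 19) := by
      calc 2 * (N ^ 2 * η ^ 2) / μ = 2 * N ^ 2 * η * (η / μ) := by field_simp
        _ ≤ 2 * N ^ 2 * η * (1 / N ^ 20) := by gcongr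
        _ = w ^ 8 / (α * N ^ 19) * (2 / N ^ 19) := by rw [h.hη]; field_simp
        _ ≤ w ^ 8 / (α * N ^ 19) * 1 := by
            refine mul_le_mul_of_nonneg_left ?_ (by positivity)
            rw [div_le_one (by positivity)]
            calc (2 : ℝ) ≤ 10 ^ 31 := by norm_num
              _ ≤ N := h.hN
              _ ≤ N ^ 19 := le_self_pow₀ hN1 (by norm_num)
        _ = _ := mul_one _
    calc 8 * (fmax / η + T' * ((σ ^ 2 + r ^ 2) * (L * η + 2 * (N ^ 2 * η ^ 2) / μ))) ≤
          8 * (T * (w ^ 8 / N ^ 13) + 2 * T * (2 * (α * N ^ 5) *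
            (w ^ 8 / (α * N ^ 19) + w ^ 8 / (α * N ^ 19)))) := by gcongr
      _ = T * (w ^ 8 / N ^ 13) * (8 + 64 / N) := by field_simp; ring
      _ ≤ T * (w ^ 8 / N ^ 13) * 72 := by
          refine mul_le_mul_of_nonneg_left ?_ (by positivity)
          have : 64 / N ≤ 64 := div_le_self (by norm_num) hN1
          linarith
      _ = _ := by ring

/-- The expected number of strict saddle points among the first `T` iterates, in terms of the
energy along the first `2 T` iterates. -/
lemma sum_sgdLaw_saddle_le [IsProbabilityMeasure D]
    (h : ParameterBounds N w α μ η r R L ρ σ ℓ) (hd : 0 < d) (hf : SmoothObjective f fmax L ρ)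
    (hG : StochasticOracle D f G σ) (hdiff : NoiseDifferenceBound D f G ℓ s)
    (hν : IsCompressor ν μ) (hs : s ^ 2 * d * N ^ 2 ≤ r ^ 2)
    (hgrow : 241 * d * N ^ 21 ≤ Real.exp N * w ^ 8)
    (x₀ : Vec d) {T : ℕ} (hT : α * N ^ 34 / w ^ 16 ≤ T) :
    ENNReal.ofReal (R ^ 2) * ∑ t ∈ Finset.range T, sgdLaw D r ν G η (x₀, 0) t
        {s | ¬ IsSOSP f ρ (w ^ 4) s.1 ∧ ‖∇ f s.1‖ ≤ w ^ 4} ≤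
      ENNReal.ofReal (8856 * N ^ 4 / w ^ 4) * ∑ t ∈ Finset.range (2 * T),
        ∫⁻ s, ENNReal.ofReal (energy f N η s) ∂(sgdLaw D r ν G η (x₀, 0) t) := by
  have hN := h.N_pos
  have hN1 := h.one_le_N
  have hw := h.hw0
  have hη := h.η_pos
  have hα := h.hα
  have hgm : Measurable (∇ f) := hf.continuous_gradient.measurable
  have hem := measurable_energy (N := N) (η := η) hf
  have hstep := measurable_sgdStep (η := η) hG.measurable
  set A : ℕ → ℝ≥0∞ := fun t =>
    ∫⁻ s, ENNReal.ofReal (energy f N η s) ∂(sgdLaw D r ν G η (x₀, 0) t) with hA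
  set B := {s : Vec d × Vec d | ¬ IsSOSP f ρ (w ^ 4) s.1 ∧ ‖∇ f s.1‖ ≤ w ^ 4} with hB
  have hBm : MeasurableSet B :=
    (measurable_fst (measurableSet_isSOSP hf (w ^ 4))).compl.inter
      (measurableSet_le (hgm.comp measurable_fst).norm measurable_const)
  set I := ⌈N ^ 2 / (η * w ^ 2) + 1⌉₊ with hIdef
  have hI1 : N ^ 2 / (η * w ^ 2) + 1 ≤ I := Nat.le_ceil _
  have hI2 : (I : ℝ) ≤ N ^ 2 / (η * w ^ 2) + 2 := by
    have := (Nat.ceil_lt_add_one (a := N ^ 2 / (η * w ^ 2) + 1) (by positivity)).le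
    linarith
  have hIη : I * η ≤ 2 * N ^ 2 / w ^ 2 := by
    have h1 : 1 ≤ N ^ 2 / w ^ 2 := by
      rw [one_le_div (by positivity)]
      exact (h.pow_w_le_one 2).trans (one_le_pow₀ hN1)
    have h2 : 2 * η ≤ 1 := by
      have h3 : η * 1 ≤ η * N := by gcongr
      have h4 : η * N ≤ 1 / 2 := h.η_mul_N_le.trans (by norm_num)
      linarith
    calc I * η ≤ (N ^ 2 / (η * w ^ 2) + 2) * η := by gcongr
      _ = N ^ 2 / w ^ 2 + 2 * η := by field_simp
      _ ≤ N ^ 2 / w ^ 2 + N ^ 2 / w ^ 2 := by linarith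
      _ = _ := by ring
  -- Windows that start before `T` end before `2 * T`, which is why the energy is summed over twice
  -- the number of iterations.
  have hIT : I ≤ T := by
    have h1 : (I : ℝ) ≤ T := by
      have h2 : N ^ 2 / (η * w ^ 2) = α * N ^ 22 / w ^ 10 := by rw [h.hη]; field_simp
      have h3 : 1 ≤ α * N ^ 22 / w ^ 10 := by
        rw [one_le_div (by positivity)]
        exact (h.pow_w_le_one 10).trans (one_le_mul_of_one_le_of_one_le hα (one_le_pow₀ hN1))
      have h4 : 3 ≤ N ^ 12 :=
        le_trans (le_trans (by norm_num) h.hN) (le_self_pow₀ hN1 (by norm_num))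
      calc (I : ℝ) ≤ α * N ^ 22 / w ^ 10 * 3 := by linarith
        _ ≤ α * N ^ 22 / w ^ 10 * (N ^ 12 / w ^ 6) := by
            gcongr
            refine h4.trans (le_div_self (by positivity) (by positivity) (h.pow_w_le_one 6))
        _ = α * N ^ 34 / w ^ 16 := by field_simp
        _ ≤ T := hT
    exact_mod_cast h1
  have hpoint : ∀ t, ENNReal.ofReal (R ^ 2) * sgdLaw D r ν G η (x₀, 0) t B ≤
      ENNReal.ofReal 216 * A t +
        ENNReal.ofReal (2160 * I * η ^ 2) * ∑ j ∈ Finset.range I, A (t + j) := by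
    intro t
    calc ENNReal.ofReal (R ^ 2) * sgdLaw D r ν G η (x₀, 0) t B =
          ∫⁻ s, B.indicator (fun _ => ENNReal.ofReal (R ^ 2)) s ∂(sgdLaw D r ν G η (x₀, 0) t) := by
          rw [lintegral_indicator_const hBm]
      _ ≤ ∫⁻ s, (ENNReal.ofReal 216 * ENNReal.ofReal (energy f N η s) +
            ENNReal.ofReal (2160 * I * η ^ 2) * ∑ j ∈ Finset.range I,
              ∫⁻ y, ENNReal.ofReal (energy f N η y) ∂(sgdLaw D r ν G η s j))
            ∂(sgdLaw D r ν G η (x₀, 0) t) := by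
          refine lintegral_mono fun s => ?_
          by_cases hs' : s ∉ B
          · rw [Set.indicator_of_notMem hs']; exact zero_le
          rw [Set.indicator_of_mem (not_not.1 hs')]
          have hs' := not_not.1 hs'
          refine (radius_sq_le_sum_gradient h hd hf hG hdiff hν hs hgrow hs'.1 hs'.2 hI1).trans ?_
          rw [← ENNReal.ofReal_mul (by norm_num)]
          refine add_le_add (ENNReal.ofReal_le_ofReal ?_) (mul_le_mul' le_rfl
            (Finset.sum_le_sum fun j _ => lintegral_mono fun y => ENNReal.ofReal_le_ofReal ?_))
          · have h1 : 864 * η ^ 2 * 1 ≤ 864 * η ^ 2 * N ^ 2 := by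
              gcongr; exact one_le_pow₀ hN1
            calc 864 * η ^ 2 * ‖s.2‖ ^ 2 ≤ 864 * η ^ 2 * N ^ 2 * ‖s.2‖ ^ 2 := by
                  exact mul_le_mul_of_nonneg_right (by rwa [mul_one] at h1) (sq_nonneg _)
              _ ≤ 216 * ‖∇ f s.1‖ ^ 2 + 864 * η ^ 2 * N ^ 2 * ‖s.2‖ ^ 2 :=
                  le_add_of_nonneg_left (by positivity)
              _ = 216 * energy f N η s := by unfold energy; ring
          · exact le_add_of_nonneg_right (by positivity)
      _ = _ := by
          -- By the Markov property, averaging the energy `j` steps after a random starting state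
          -- gives the energy at time `t + j`.
          have hm : ∀ j, Measurable fun s =>
              ∫⁻ y, ENNReal.ofReal (energy f N η y) ∂(sgdLaw D r ν G η s j) := fun j =>
            measurable_lintegral_chainLaw_dirac hstep j hem.ennreal_ofReal
          rw [lintegral_add_left (by fun_prop), lintegral_const_mul _ (by fun_prop),
            lintegral_const_mul _ (Finset.measurable_fun_sum _ fun j _ => hm j),
            lintegral_finsetSum _ fun j _ => hm j]
          congr 2
          refine Finset.sum_congr rfl fun j _ => ?_
          exact (lintegral_chainLaw_add hstep t j hem.ennreal_ofReal).symm
  -- Overlapping windows count each time at most `I` times, so the total factor is of order `(I η)²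
  -- = O(N⁴ / w⁴)`, in which `η` and hence `α` cancel.
  have hshift : ∀ j ∈ Finset.range I,
      ∑ t ∈ Finset.range T, A (t + j) ≤ ∑ t ∈ Finset.range (2 * T), A t := by
    intro j hj
    have hj' := Finset.mem_range.1 hj
    rw [Finset.range_eq_Ico, Finset.sum_Ico_add' A 0 T j]
    refine Finset.sum_le_sum_of_subset fun t ht => ?_
    simp only [Finset.mem_Ico, Finset.mem_range] at ht ⊢
    omega
  rw [Finset.mul_sum]
  calc ∑ t ∈ Finset.range T, ENNReal.ofReal (R ^ 2) * sgdLaw D r ν G η (x₀, 0) t B ≤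
        ∑ t ∈ Finset.range T, (ENNReal.ofReal 216 * A t +
          ENNReal.ofReal (2160 * I * η ^ 2) * ∑ j ∈ Finset.range I, A (t + j)) :=
        Finset.sum_le_sum fun t _ => hpoint t
    _ = ENNReal.ofReal 216 * ∑ t ∈ Finset.range T, A t + ENNReal.ofReal (2160 * I * η ^ 2) *
          ∑ j ∈ Finset.range I, ∑ t ∈ Finset.range T, A (t + j) := by
        rw [Finset.sum_add_distrib, ← Finset.mul_sum, ← Finset.mul_sum,
          Finset.sum_comm (s := Finset.range T)]
    _ ≤ ENNReal.ofReal 216 * ∑ t ∈ Finset.range (2 * T), A t +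
          ENNReal.ofReal (2160 * I * η ^ 2) *
            (I * ∑ t ∈ Finset.range (2 * T), A t) := by
        refine add_le_add (mul_le_mul' le_rfl ?_) (mul_le_mul' le_rfl ?_)
        · exact Finset.sum_le_sum_of_subset (Finset.range_mono (by omega))
        · refine (Finset.sum_le_sum hshift).trans (le_of_eq ?_)
          rw [Finset.sum_const, Finset.card_range, nsmul_eq_mul]
    _ = ENNReal.ofReal (216 + 2160 * (I * η) ^ 2) * ∑ t ∈ Finset.range (2 * T), A t := by
        rw [show 2160 * ((I : ℝ) * η) ^ 2 = 2160 * I * η ^ 2 * I by ring,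
          ENNReal.ofReal_add (by norm_num) (by positivity),
          ENNReal.ofReal_mul (q := (I : ℝ)) (by positivity), ENNReal.ofReal_natCast]
        ring
    _ ≤ _ := by
        refine mul_le_mul' (ENNReal.ofReal_le_ofReal ?_) le_rfl
        have h1 : 1 ≤ N ^ 4 / w ^ 4 := by
          rw [one_le_div (by positivity)]
          exact (h.pow_w_le_one 4).trans (one_le_pow₀ hN1)
        calc 216 + 2160 * (I * η) ^ 2 ≤ 216 + 2160 * (2 * N ^ 2 / w ^ 2) ^ 2 := by gcongr
          _ = 216 + 8640 * (N ^ 4 / w ^ 4) := by field_simp; ring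
          _ ≤ 216 * (N ^ 4 / w ^ 4) + 8640 * (N ^ 4 / w ^ 4) := by linarith
          _ = _ := by ring

/-- The expected number of iterates that are not second-order stationary. -/
lemma sum_sgdLaw_not_isSOSP_le [IsProbabilityMeasure D]
    (h : ParameterBounds N w α μ η r R L ρ σ ℓ) (hd : 0 < d) (hf : SmoothObjective f fmax L ρ)
    (hfmax : 0 ≤ fmax) (hfN : fmax ≤ N)
    (hG : StochasticOracle D f G σ) (hdiff : NoiseDifferenceBound D f G ℓ s)
    (hν : IsCompressor ν μ) (hs : s ^ 2 * d * N ^ 2 ≤ r ^ 2)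
    (hgrow : 241 * d * N ^ 21 ≤ Real.exp N * w ^ 8)
    (x₀ : Vec d) {T : ℕ} (hT : α * N ^ 34 / w ^ 16 ≤ T) :
    ∑ t ∈ Finset.range T, sgdLaw D r ν G η (x₀, 0) t {s | ¬ IsSOSP f ρ (w ^ 4) s.1} ≤
      ENNReal.ofReal (10 ^ 6 * T / N) := by
  have hN := h.N_pos
  have hN1 := h.one_le_N
  have hw := h.hw0
  have hR := h.R_pos
  have hem := measurable_energy (N := N) (η := η) hf
  -- Here 637632 = 8856 · 72. Dividing by `R² = w⁴ / N⁸` cancels all powers of `w` and leaves `N ^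
  -- (4 - 13 + 8) = N⁻¹`.
  have hsaddle : ∑ t ∈ Finset.range T, sgdLaw D r ν G η (x₀, 0) t
      {s | ¬ IsSOSP f ρ (w ^ 4) s.1 ∧ ‖∇ f s.1‖ ≤ w ^ 4} ≤ ENNReal.ofReal (637632 * T / N) := by
    have h1 := (sum_sgdLaw_saddle_le h hd hf hG hdiff hν hs hgrow x₀ hT).trans
      (mul_le_mul' le_rfl (sum_lintegral_energy_le h hd hf hfmax hfN hG hν x₀ hT le_rfl))
    have hR' : ENNReal.ofReal (R ^ 2) ≠ 0 := by simpa using hR.ne'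
    refine (ENNReal.mul_le_mul_iff_right hR' ENNReal.ofReal_ne_top).1 (h1.trans (le_of_eq ?_))
    rw [← ENNReal.ofReal_mul (by positivity), ← ENNReal.ofReal_mul (by positivity), h.hR]
    congr 1
    field_simp
    ring
  have hlarge : ∑ t ∈ Finset.range T, sgdLaw D r ν G η (x₀, 0) t
      {s | w ^ 4 < ‖∇ f s.1‖} ≤ ENNReal.ofReal (72 * T / N) := by
    have hw8 : ENNReal.ofReal (w ^ 8) ≠ 0 := (ENNReal.ofReal_pos.2 (by positivity)).ne'
    refine (ENNReal.mul_le_mul_iff_right hw8 ENNReal.ofReal_ne_top).1 ?_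
    calc ENNReal.ofReal (w ^ 8) * ∑ t ∈ Finset.range T, sgdLaw D r ν G η (x₀, 0) t
            {s | w ^ 4 < ‖∇ f s.1‖} ≤
          ∑ t ∈ Finset.range T,
            ∫⁻ s, ENNReal.ofReal (energy f N η s) ∂(sgdLaw D r ν G η (x₀, 0) t) := by
          rw [Finset.mul_sum]
          refine Finset.sum_le_sum fun t _ => ?_
          refine le_trans (mul_le_mul' le_rfl (measure_mono ?_))
            (mul_meas_ge_le_lintegral hem.ennreal_ofReal _)
          intro s hs
          refine ENNReal.ofReal_le_ofReal ?_
          calc w ^ 8 = (w ^ 4) ^ 2 := by ring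
            _ ≤ ‖∇ f s.1‖ ^ 2 := pow_le_pow_left₀ (by positivity) (le_of_lt hs) 2
            _ ≤ _ := le_add_of_nonneg_right (by positivity)
      _ ≤ ENNReal.ofReal (72 * T * w ^ 8 / N ^ 13) :=
          sum_lintegral_energy_le h hd hf hfmax hfN hG hν x₀ hT (by omega)
      _ ≤ ENNReal.ofReal (w ^ 8 * (72 * T / N)) := by
          refine ENNReal.ofReal_le_ofReal ?_
          calc 72 * T * w ^ 8 / N ^ 13 ≤ 72 * T * w ^ 8 / N := by
                gcongr; exact le_self_pow₀ hN1 (by norm_num)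
            _ = _ := by ring
      _ = _ := ENNReal.ofReal_mul (by positivity)
  calc ∑ t ∈ Finset.range T, sgdLaw D r ν G η (x₀, 0) t {s | ¬ IsSOSP f ρ (w ^ 4) s.1} ≤
        ∑ t ∈ Finset.range T, (sgdLaw D r ν G η (x₀, 0) t
          {s | ¬ IsSOSP f ρ (w ^ 4) s.1 ∧ ‖∇ f s.1‖ ≤ w ^ 4} +
          sgdLaw D r ν G η (x₀, 0) t {s | w ^ 4 < ‖∇ f s.1‖}) := by
        refine Finset.sum_le_sum fun t _ => le_trans (measure_mono ?_) (measure_union_le _ _)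
        intro s hs
        by_cases h1 : ‖∇ f s.1‖ ≤ w ^ 4
        · exact Or.inl ⟨hs, h1⟩
        · exact Or.inr (not_le.1 h1)
    _ ≤ ENNReal.ofReal (637632 * T / N) + ENNReal.ofReal (72 * T / N) := by
        rw [Finset.sum_add_distrib]
        exact add_le_add hsaddle hlarge
    _ = ENNReal.ofReal (637704 * T / N) := by
        rw [← ENNReal.ofReal_add (by positivity) (by positivity)]; congr 1; ring
    _ ≤ _ := by gcongr; norm_num

end Counting

/-! ### From expected counts to the guarantees, and the communication ratio. -/

section Finding

/-- The number `m` of bad iterates has expectation at most `10 ^ 6 * T / N`, which is below both `T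
/ 2` and `δ * T / 2`; Markov's inequality at level `T / 2` gives the probability. -/
lemma findsSOSP_of_parameterBounds {d : ℕ} {ν : PMF (Finset (Fin d))}
    {r η μ σ fmax L ρ ℓ s N w α R δ : ℝ} {ℓ' : ℝ≥0∞}
    (h : ParameterBounds N w α μ η r R L ρ σ ℓ) (hd : 0 < d)
    (hfmax : 0 ≤ fmax) (hfN : fmax ≤ N)
    (hdiff : ∀ (Θ : Type u) [MeasurableSpace Θ] (D : Measure Θ) [IsProbabilityMeasure D]
      (f : Vec d → ℝ) (G : Vec d → Θ → Vec d), StochasticOracle D f G σ → LipschitzOracle G ℓ' →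
        NoiseDifferenceBound D f G ℓ s)
    (hν : IsCompressor ν μ) (hs : s ^ 2 * d * N ^ 2 ≤ r ^ 2)
    (hgrow : 241 * d * N ^ 21 ≤ Real.exp N * w ^ 8) (hδ : 10 ^ 31 ≤ N * δ)
    {T : ℕ} (hT : α * N ^ 34 / w ^ 16 ≤ T) :
    FindsSOSP.{u} ν η r T δ (w ^ 4) fmax L ρ σ ℓ' := by
  classical
  intro Θ _ D _ f G x₀ hf hG hGℓ
  have hN := h.N_pos
  have hw := h.hw0
  have hα := h.hα
  have hT0 : (0 : ℝ) < T := lt_of_lt_of_le (by positivity) hT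
  have hcount := sum_sgdLaw_not_isSOSP_le h hd hf hfmax hfN hG (hdiff Θ D f G hG hGℓ) hν hs hgrow
    x₀ hT
  have hP : IsProbabilityMeasure (runLaw D r ν) := by unfold runLaw; infer_instance
  have hlaw := fun t => map_infinitePi_eq_chainLaw (μ := stepLaw D r ν)
    (measurable_sgdStep (η := η) hG.measurable) (F := state G η x₀) (x₀ := (x₀, 0))
    (fun _ => rfl) (fun _ _ => rfl) t
  set A : Set (Vec d × Vec d) := {s | ¬ IsSOSP f ρ (w ^ 4) s.1} with hA
  have hAm : MeasurableSet A := (measurable_fst (measurableSet_isSOSP hf (w ^ 4))).compl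
  set m : (ℕ → Θ × Vec d × Finset (Fin d)) → ℝ≥0∞ := fun ω =>
    ∑ t ∈ Finset.range T, A.indicator 1 (state G η x₀ ω t) with hm
  have hmt : ∀ t, Measurable fun ω => A.indicator (1 : Vec d × Vec d → ℝ≥0∞) (state G η x₀ ω t) :=
    fun t => (measurable_one.indicator hAm).comp (hlaw t).1
  have hmm : Measurable m := Finset.measurable_fun_sum _ fun t _ => hmt t
  have hint : ∫⁻ ω, m ω ∂(runLaw D r ν) ≤ ENNReal.ofReal (10 ^ 6 * T / N) := by
    rw [hm, lintegral_finsetSum _ fun t _ => hmt t]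
    refine le_trans (Finset.sum_le_sum fun t _ => le_of_eq ?_) hcount
    calc ∫⁻ ω, A.indicator 1 (state G η x₀ ω t) ∂(runLaw D r ν) =
          ∫⁻ s, A.indicator 1 s ∂((runLaw D r ν).map fun ω => state G η x₀ ω t) :=
          (lintegral_map (measurable_one.indicator hAm) (hlaw t).1).symm
      _ = ∫⁻ s, A.indicator 1 s ∂(sgdLaw D r ν G η (x₀, 0) t) := by
          exact congrArg (fun κ => ∫⁻ s, A.indicator 1 s ∂κ) (hlaw t).2
      _ = _ := lintegral_indicator_one hAm
  have hnum : ∀ ω, (numSOSP f ρ (w ^ 4) G η x₀ T ω : ℝ) = T - (m ω).toReal := by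
    intro ω
    have h1 := Finset.card_filter_add_card_filter_not (s := Finset.range T)
      fun t => IsSOSP f ρ (w ^ 4) (state G η x₀ ω t).1
    have h2 : m ω =
        ((Finset.range T).filter fun t => ¬ IsSOSP f ρ (w ^ 4) (state G η x₀ ω t).1).card := by
      rw [Finset.card_filter]
      push_cast
      exact Finset.sum_congr rfl fun t _ => by simp [hA, Set.indicator_apply]
    rw [h2, ENNReal.toReal_natCast, eq_sub_iff_add_eq]
    rw [Finset.card_range] at h1
    unfold numSOSP
    exact_mod_cast h1
  have hNδ : 10 ^ 6 * T / N ≤ T / 2 * δ := by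
    rw [div_le_iff₀ hN]
    have h2 : 10 ^ 6 * (T : ℝ) ≤ T / 2 * 10 ^ 31 := by linarith
    have h3 : T / 2 * 10 ^ 31 ≤ T / 2 * (N * δ) := by gcongr
    linarith
  have hN2 : 10 ^ 6 * T / N ≤ T / 2 := by
    rw [div_le_iff₀ hN]
    have h3 : T / 2 * 10 ^ 31 ≤ T / 2 * N := by gcongr; exact h.hN
    linarith
  constructor
  · set E := {ω | (T : ℝ) / 2 ≤ numSOSP f ρ (w ^ 4) G η x₀ T ω} with hE
    have hEc : (runLaw D r ν).real Eᶜ ≤ δ := by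
      have hδ0 : 0 ≤ δ := (pos_of_mul_pos_right (lt_of_lt_of_le (by norm_num) hδ) hN.le).le
      refine ENNReal.toReal_le_of_le_ofReal hδ0 ?_
      have hT2 : ENNReal.ofReal (T / 2) ≠ 0 := (ENNReal.ofReal_pos.2 (by positivity)).ne'
      refine (ENNReal.mul_le_mul_iff_right hT2 ENNReal.ofReal_ne_top).1 ?_
      calc ENNReal.ofReal (T / 2) * runLaw D r ν Eᶜ ≤
            ENNReal.ofReal (T / 2) * runLaw D r ν {ω | ENNReal.ofReal (T / 2) ≤ m ω} := by
            refine mul_le_mul' le_rfl (measure_mono fun ω hω => ?_)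
            have h1 : (numSOSP f ρ (w ^ 4) G η x₀ T ω : ℝ) < T / 2 := not_le.1 hω
            rw [hnum] at h1
            exact ENNReal.ofReal_le_of_le_toReal (by linarith)
        _ ≤ ∫⁻ ω, m ω ∂(runLaw D r ν) := mul_meas_ge_le_lintegral hmm _
        _ ≤ ENNReal.ofReal (T / 2 * δ) := hint.trans (ENNReal.ofReal_le_ofReal hNδ)
        _ = _ := ENNReal.ofReal_mul (by positivity)
    have h1 := measureReal_union_le (μ := runLaw D r ν) E Eᶜ
    rw [Set.union_compl_self, probReal_univ] at h1
    linarith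
  · have hfin : ∫⁻ ω, m ω ∂(runLaw D r ν) ≠ ⊤ := (hint.trans_lt ENNReal.ofReal_lt_top).ne
    have hi := integrable_toReal_of_lintegral_ne_top hmm.aemeasurable hfin
    simp only [hnum]
    rw [integral_sub (integrable_const _) hi, integral_const, probReal_univ, one_smul,
      integral_toReal hmm.aemeasurable (ae_lt_top hmm hfin)]
    have h1 := ENNReal.toReal_le_of_le_ofReal (by positivity) (hint.trans
      (ENNReal.ofReal_le_ofReal hN2))
    linarith

lemma totalCommunication_of_card_eq {d c : ℕ} {ν : PMF (Finset (Fin d))}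
    (hν : ∀ S ∈ ν.support, S.card = c) (T : ℕ) : totalCommunication ν T = c * T := by
  have hae : ∀ᵐ S ∂ν.toMeasure, S.card = c := by
    rw [ae_iff, PMF.toMeasure_apply_eq_zero_iff _ (Set.toFinite _).measurableSet]
    exact Set.disjoint_left.2 fun S hS hS' => hS' (hν S hS)
  have hall : ∀ᵐ S ∂(Measure.infinitePi fun _ : ℕ => ν.toMeasure), ∀ t, (S t).card = c :=
    ae_all_iff.2 fun t =>
      (measurePreserving_eval_infinitePi (fun _ : ℕ => ν.toMeasure) t).quasiMeasurePreserving.ae hae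
  unfold totalCommunication
  rw [integral_congr_ae (g := fun _ => (c * T : ℝ)) ?_]
  · simp
  · filter_upwards [hall] with S hS
    simp [hS, mul_comm]

lemma totalCommunication_noCompression (d T : ℕ) :
    totalCommunication (noCompression d) T = d * T :=
  totalCommunication_of_card_eq (by simp [noCompression]) T

lemma totalCommunication_randomK {d k : ℕ} (hk : k ≤ d) (T : ℕ) :
    totalCommunication (randomK d k) T = k * T := by
  refine totalCommunication_of_card_eq (fun S hS => ?_) T
  rw [randomK, PMF.mem_support_uniformOfFinset_iff, Finset.mem_powersetCard] at hS
  rw [hS.2, min_eq_left hk]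

/-- One half of the exponent beats `x²`, the other half the power of `N`, through the term of order
22 of the exponential series. The threshold `10 ^ 31` exceeds 241 · 22! · 2²². -/
lemma exp_growth {N x : ℝ} (hN : 10 ^ 31 ≤ N) (hx : 0 < x) (hxN : 4 * Real.log x ≤ N) :
    241 * N ^ 21 * x ^ 2 ≤ Real.exp N := by
  have hN0 : 0 < N := lt_of_lt_of_le (by norm_num) hN
  have h1 : x ^ 2 ≤ Real.exp (N / 2) := by
    calc x ^ 2 = Real.exp (Real.log x) ^ 2 := by rw [Real.exp_log hx]
      _ = Real.exp (2 * Real.log x) := by rw [← Real.exp_nat_mul]; norm_num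
      _ ≤ _ := Real.exp_le_exp.2 (by linarith)
  have h2 : 241 * N ^ 21 ≤ Real.exp (N / 2) := by
    refine le_trans ?_ (Real.pow_div_factorial_le_exp (N / 2) (by positivity) 22)
    rw [le_div_iff₀ (by positivity), div_pow, le_div_iff₀ (by positivity), pow_succ N 21]
    calc 241 * N ^ 21 * (Nat.factorial 22 : ℕ) * 2 ^ 22 =
          N ^ 21 * (241 * (Nat.factorial 22 : ℕ) * 2 ^ 22) := by ring
      _ ≤ N ^ 21 * 10 ^ 31 := by
          refine mul_le_mul_of_nonneg_left ?_ (by positivity)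
          norm_num [Nat.factorial]
      _ ≤ N ^ 21 * N := by gcongr
  calc 241 * N ^ 21 * x ^ 2 ≤ Real.exp (N / 2) * Real.exp (N / 2) := by gcongr
    _ = Real.exp N := by rw [← Real.exp_add]; congr 1; ring

/-- Both algorithms run with identical `η`, `r` and `T`, so `T` cancels in the ratio. The hypothesis
that `k` is the ceiling of a number `x ≥ 1` gives `x ≤ k ≤ 2 x`, hence `d / k` is within a factor 2
of the claim. -/
lemma communicationDecreases_of_bounds {K δ ε fmax L ρ σ ℓ s N α : ℝ} {ℓ' : ℝ≥0∞} {d : ℕ}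
    (hd : 0 < d) (hε : 0 < ε) (hε1 : ε ≤ 1) (hfmax : 0 ≤ fmax) (hL : 0 ≤ L) (hρ : 0 < ρ)
    (hσ : 0 ≤ σ) (hℓ : 0 ≤ ℓ) (hα : 1 ≤ α) (hx : 1 ≤ d * ε ^ (3 / 4 : ℝ) / √α)
    (hN : 10 ^ 31 ≤ N) (hδ : 10 ^ 31 ≤ N * δ) (hlog : 4 * Real.log (d / ε) ≤ N)
    (hfN : fmax ≤ N) (hLN : L ≤ N) (hρN : ρ ≤ N) (hρN' : ρ⁻¹ ≤ N) (hσN : σ ≤ N) (hℓN : ℓ ≤ N)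
    (hs : s ^ 2 * d * N ^ 2 ≤ α * N ^ 5)
    (hdiff : ∀ (Θ : Type u) [MeasurableSpace Θ] (D : Measure Θ) [IsProbabilityMeasure D]
      (f : Vec d → ℝ) (G : Vec d → Θ → Vec d), StochasticOracle D f G σ → LipschitzOracle G ℓ' →
        NoiseDifferenceBound D f G ℓ s)
    (hK : 2 * N ^ 34 ≤ K) :
    CommunicationDecreases.{u} K δ d ⌈d * ε ^ (3 / 4 : ℝ) / √α⌉₊ ε fmax L ρ σ ℓ' α
      (√α * ε ^ (-(3 / 4) : ℝ)) := by
  have hN0 : 0 < N := lt_of_lt_of_le (by norm_num) hN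
  have hN1 : 1 ≤ N := le_trans (by norm_num) hN
  have hd' : (0 : ℝ) < d := by exact_mod_cast hd
  have hd1 : (1 : ℝ) ≤ d := by exact_mod_cast hd
  have hα0 : 0 < √α := Real.sqrt_pos.2 (by linarith)
  have hα1 : 1 ≤ √α := Real.one_le_sqrt.2 hα
  set w := ε ^ (1 / 4 : ℝ) with hw
  have hw0 : 0 < w := by positivity
  have hw1 : w ≤ 1 := Real.rpow_le_one hε.le hε1 (by norm_num)
  have hw3 : ε ^ (3 / 4 : ℝ) = w ^ 3 := by
    rw [hw, ← Real.rpow_natCast, ← Real.rpow_mul hε.le]; norm_num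
  have hw4 : w ^ 4 = ε := by
    rw [hw, ← Real.rpow_natCast, ← Real.rpow_mul hε.le]; norm_num
  have hw8 : w ^ 8 = ε ^ 2 := by rw [← hw4]; ring
  have hw16 : w ^ 16 = ε ^ 4 := by rw [← hw4]; ring
  have hw31 : w ^ 3 ≤ 1 := pow_le_one₀ hw0.le hw1
  rw [Real.rpow_neg hε.le, hw3]
  rw [hw3] at hx
  set x := d * w ^ 3 / √α with hxdef
  set k := ⌈x⌉₊ with hk
  have hxk : x ≤ k := Nat.le_ceil _
  have hkx : (k : ℝ) ≤ 2 * x := by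
    have := (Nat.ceil_lt_add_one (by linarith : 0 ≤ x)).le
    linarith
  have hk0 : (0 : ℝ) < k := by linarith
  have hkd : k ≤ d := by
    refine Nat.ceil_le.2 ?_
    calc x ≤ d * w ^ 3 := div_le_self (by positivity) hα1
      _ ≤ d := mul_le_of_le_one_right hd'.le hw31
  have hμ1 : w ^ 3 / √α ≤ 1 := (div_le_self (by positivity) hα1).trans hw31
  have hμk : w ^ 3 / √α ≤ k / d := by
    rw [le_div_iff₀ hd']
    calc w ^ 3 / √α * d = x := by rw [hxdef]; ring
      _ ≤ k := hxk
  have h : ParameterBounds N w α (w ^ 3 / √α) (w ^ 8 / (α * N ^ 20)) √(α * N ^ 5) (w ^ 2 / N ^ 4)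
      L ρ σ ℓ :=
    { hN, hw0, hw1, hα, hμ0 := by positivity, hμ1, hμα := by field_simp, hη := rfl,
      hr := Real.sq_sqrt (by positivity), hR := rfl, hL0 := hL, hL := hLN, hρ0 := hρ.le, hρ := hρN,
      hρN := inv_le_of_inv_le₀ hρ hρN', hσ0 := hσ, hσ := hσN, hℓ0 := hℓ, hℓ := hℓN }
  have hgrow : 241 * d * N ^ 21 ≤ Real.exp N * w ^ 8 := by
    have h1 := exp_growth hN (div_pos hd' hε) hlog
    rw [hw8]
    calc 241 * d * N ^ 21 ≤ 241 * N ^ 21 * d ^ 2 := by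
          rw [mul_right_comm]
          gcongr
          exact le_self_pow₀ hd1 (by norm_num)
      _ = 241 * N ^ 21 * (d / ε) ^ 2 * ε ^ 2 := by field_simp
      _ ≤ _ := by gcongr
  rw [← h.hr] at hs
  set T := ⌈α * N ^ 34 / w ^ 16⌉₊ with hTdef
  have hT : α * N ^ 34 / w ^ 16 ≤ T := Nat.le_ceil _
  have hT1 : 1 ≤ α / ε ^ 4 := by
    rw [one_le_div (by positivity)]
    exact (pow_le_one₀ hε.le hε1).trans hα
  have hT0 : (0 : ℝ) < T := lt_of_lt_of_le (by positivity) hT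
  have hN34 : 1 ≤ N ^ 34 := one_le_pow₀ hN1
  have hK1 : 2 ≤ K := by linarith
  have hKinv : K⁻¹ ≤ 1 / 2 := by rw [one_div]; exact inv_anti₀ (by norm_num) hK1
  have hTagree : AgreeUpTo K T (α / ε ^ 4) := by
    have h1 : α * N ^ 34 / w ^ 16 = N ^ 34 * (α / ε ^ 4) := by rw [hw16]; ring
    constructor
    · calc K⁻¹ * (α / ε ^ 4) ≤ N ^ 34 * (α / ε ^ 4) := by gcongr; linarith
        _ = α * N ^ 34 / w ^ 16 := h1.symm
        _ ≤ T := hT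
    · have h2 := (Nat.ceil_lt_add_one (a := α * N ^ 34 / w ^ 16) (by positivity)).le
      calc (T : ℝ) ≤ N ^ 34 * (α / ε ^ 4) + 1 * 1 := by rw [← h1]; linarith
        _ ≤ N ^ 34 * (α / ε ^ 4) + N ^ 34 * (α / ε ^ 4) := by gcongr
        _ = 2 * N ^ 34 * (α / ε ^ 4) := by ring
        _ ≤ _ := by gcongr
  have hratio : d / k = (x / k) * (√α * (w ^ 3)⁻¹) := by rw [hxdef]; field_simp
  have hlow : 1 / 2 ≤ x / k := by rw [div_le_div_iff₀ (by norm_num) hk0]; linarith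
  have hhigh : x / k ≤ 1 := by rw [div_le_one hk0]; exact hxk
  have hfind := fun ν hν => findsSOSP_of_parameterBounds (ν := ν) h hd hfmax hfN hdiff hν hs hgrow
    hδ hT
  rw [hw4] at hfind
  refine ⟨w ^ 8 / (α * N ^ 20), √(α * N ^ 5), T, w ^ 8 / (α * N ^ 20), √(α * N ^ 5), T, h.η_pos,
    by positivity, h.η_pos, by positivity, hfind _ (isCompressor_noCompression.mono hμ1),
    hfind _ ((isCompressor_randomK hd hkd).mono hμk), hTagree, hTagree, ?_⟩
  rw [totalCommunication_noCompression, totalCommunication_randomK hkd,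
    mul_div_mul_right _ _ hT0.ne', hratio]
  constructor
  · gcongr; linarith
  · gcongr; linarith

/-- `N` is `10 ^ 31 / min δ 1` times `Λ` times `1 + log (d / ε)`, so that `2 * N ^ 34` is precisely
a hidden factor with `p = 34`. -/
lemma hiddenFactor_bounds {δ Λ ε : ℝ} {d : ℕ} (hδ : 0 < δ) (hΛ : 1 ≤ Λ) (hd : 0 < d) (hε : 0 < ε)
    (hε1 : ε ≤ 1) : ∃ N : ℝ, 10 ^ 31 ≤ N ∧ 10 ^ 31 ≤ N * δ ∧ 4 * Real.log (d / ε) ≤ N ∧ Λ ≤ N ∧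
      2 * N ^ 34 ≤ hiddenFactor (2 * (10 ^ 31 / min δ 1) ^ 34) 34 Λ d ε := by
  set b := min δ 1 with hb
  have hb0 : 0 < b := lt_min hδ one_pos
  have hbδ : b ≤ δ := min_le_left _ _
  have hb1 : b ≤ 1 := min_le_right _ _
  have hd1 : (1 : ℝ) ≤ d := by exact_mod_cast hd
  have hlog : 0 ≤ Real.log (d / ε) := Real.log_nonneg ((one_le_div hε).2 (hε1.trans hd1))
  set l := 1 + Real.log (d / ε) with hl
  have hl1 : 1 ≤ l := by linarith
  have hΛl : 1 ≤ Λ * l := one_le_mul_of_one_le_of_one_le hΛ hl1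
  have hc : 10 ^ 31 ≤ 10 ^ 31 / b := le_div_self (by norm_num) hb0 hb1
  have hN : 10 ^ 31 * (Λ * l) ≤ 10 ^ 31 / b * Λ * l := by rw [mul_assoc]; gcongr
  have hl' : l ≤ Λ * l := le_mul_of_one_le_left (by linarith) hΛ
  have hΛ' : Λ ≤ Λ * l := le_mul_of_one_le_right (by linarith) hl1
  refine ⟨10 ^ 31 / b * Λ * l, ?_, ?_, ?_, ?_, ?_⟩
  · linarith
  · calc (10 : ℝ) ^ 31 ≤ 10 ^ 31 * (Λ * l) := by linarith
      _ = 10 ^ 31 / b * Λ * l * b := by field_simp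
      _ ≤ _ := by gcongr
  · linarith
  · linarith
  · unfold hiddenFactor
    rw [mul_pow, mul_pow, ← hl]
    exact le_of_eq (by ring)

end Finding

end CompressedSGD

end

theorem mainTheorem6 (δ : ℝ) (hδ : 0 < δ) :
    ∃ (C : ℝ) (p : ℕ), 0 < C ∧
      ∀ (d : ℕ) (ε fmax L ρ σ : ℝ), 0 < d → 0 < ε → ε ≤ 1 →
        0 ≤ fmax → 0 ≤ L → 0 < ρ → 0 ≤ σ →
        -- Lipschitz stochastic gradient
        (∀ ℓ : ℝ, 0 ≤ ℓ → 1 ≤ d * ε ^ (3 / 4 : ℝ) →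
          CompressedSGD.CommunicationDecreases.{u}
            (CompressedSGD.hiddenFactor C p (1 + fmax + L + ρ + ρ⁻¹ + σ + ℓ) d ε)
            δ d ⌈d * ε ^ (3 / 4 : ℝ)⌉₊ ε fmax L ρ σ (ENNReal.ofReal ℓ)
            1 (ε ^ (-(3 / 4) : ℝ))) ∧
        -- no Lipschitz assumption on the stochastic gradient
        (1 ≤ d * ε ^ (3 / 4 : ℝ) / √d →
          CompressedSGD.CommunicationDecreases.{u}
            (CompressedSGD.hiddenFactor C p (1 + fmax + L + ρ + ρ⁻¹ + σ) d ε)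
            δ d ⌈d * ε ^ (3 / 4 : ℝ) / √d⌉₊ ε fmax L ρ σ ⊤
            d (√d * ε ^ (-(3 / 4) : ℝ))) := by
  refine ⟨2 * (10 ^ 31 / min δ 1) ^ 34, 34, ?_, ?_⟩
  · have : 0 < min δ 1 := lt_min hδ one_pos
    positivity
  intro d ε fmax L ρ σ hd hε hε1 hfmax hL hρ hσ
  have hρ' : 0 < ρ⁻¹ := inv_pos.2 hρ
  constructor
  · intro ℓ hℓ hx
    obtain ⟨N, hN, hNδ, hlog, hΛ, hK⟩ := CompressedSGD.hiddenFactor_bounds (δ := δ)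
      (Λ := 1 + fmax + L + ρ + ρ⁻¹ + σ + ℓ) hδ (by linarith) hd hε hε1
    have hN0 : 0 < N := lt_of_lt_of_le (by norm_num) hN
    -- With a Lipschitz oracle the noise difference vanishes with the distance: `s = 0`, and `r²`
    -- needs no factor `d`.
    have h := CompressedSGD.communicationDecreases_of_bounds.{u} (s := 0) (α := 1)
      (ℓ' := ENNReal.ofReal ℓ) hd hε hε1 hfmax hL hρ hσ hℓ le_rfl (by simpa using hx) hN hNδ hlog
      (by linarith) (by linarith) (by linarith) (by linarith) (by linarith) (by linarith)
      (le_trans (by simp) (by positivity : 0 ≤ 1 * N ^ 5))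
      (fun Θ _ D _ f G hG h => CompressedSGD.LipschitzOracle.noiseDifferenceBound hG hℓ h) hK
    simpa only [Real.sqrt_one, div_one, one_mul] using h
  · intro hx
    obtain ⟨N, hN, hNδ, hlog, hΛ, hK⟩ := CompressedSGD.hiddenFactor_bounds (δ := δ)
      (Λ := 1 + fmax + L + ρ + ρ⁻¹ + σ) hδ (by linarith) hd hε hε1
    have hN0 : 0 < N := lt_of_lt_of_le (by norm_num) hN
    have hσN : σ ≤ N := by linarith
    have hd1 : (1 : ℝ) ≤ d := by exact_mod_cast hd
    -- Here `s = 2 σ`, and `α = d` provides the factor `d` in `s² d N² ≤ α N⁵`.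
    refine CompressedSGD.communicationDecreases_of_bounds (s := 2 * σ) (ℓ := 0) hd hε hε1 hfmax hL
      hρ hσ le_rfl hd1 hx hN hNδ hlog (by linarith) (by linarith) (by linarith) (by linarith) hσN
      hN0.le ?_ (fun Θ _ D _ f G hG _ => hG.noiseDifferenceBound) hK
    have h4 : 4 ≤ N := le_trans (by norm_num) hN
    calc (2 * σ) ^ 2 * d * N ^ 2 = 4 * σ ^ 2 * (d * N ^ 2) := by ring
      _ ≤ N * N ^ 2 * (d * N ^ 2) := by gcongr
      _ = d * N ^ 5 := by ring
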